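/- **Theorem 2.2.** Let $M$ be a compact complex manifold of complex dimension $n\ge 2$, let $\chi=\sqrt{-1}\,\chi_{i\bar j}\,dz^i\wedge d\bar z^j$ be a (smooth) Hermitian metric and $\omega=\sqrt{-1}\,g_{i\bar j}\,dz^i\wedge d\bar z^j$ a Kähler metric on $M$, and let $F$ be a real-valued smooth function on $M$ such that $$\chi-\frac{n-1}{n e^{F}}\,\omega>0 .$$ Then there exist positive constants $A_1$, $C_1$, $C_2$, depending only on $M$, $\chi$, $\omega$ and $F$, with the following property. Let $0<T\le\infty$ and let $\varphi$ be a real-valued smooth function on $M\times[0,T)$ such that $\chi_\varphi:=\chi+\sqrt{-1}\,\partial\bar\partial\varphi>0$ and $$\frac{\partial\varphi}{\partial t}=\log\frac{\chi_\varphi^{\,n}}{\omega\wedge\chi_\varphi^{\,n-1}}+F\quad\text{on } M\times[0,T),\qquad \varphi(\cdot,0)=0 .$$ Then $$C_1\le \operatorname{tr}_\omega\chi_\varphi\le C_2\,e^{A_1\left(\varphi-\inf_{M\times[0,T)}\varphi\right)}\quad\text{on } M\times[0,T),$$ where $\operatorname{tr}_\omega\chi_\varphi=g^{i\bar j}(\chi_\varphi)_{i\bar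 j}$. Here the infimum is taken in $[-\infty,\infty)$; if it is $-\infty$, the right-hand side is $+\infty$. -/

import Mathlib

open scoped Manifold ContDiff ComplexConjugate ComplexOrder

noncomputable section

namespace ParabolicDonaldson

/-- The operator `∂/∂zᵢ = (∂/∂xᵢ - √-1 ∂/∂yᵢ) / 2` on complex-valued functions on `ℂⁿ`
(real differentiability). -/
def dz {n : ℕ} (i : Fin n) (f : (Fin n → ℂ) → ℂ) (z : Fin n → ℂ) : ℂ :=
  (1 / 2 : ℂ) *
    (fderiv ℝ f z (Pi.single i 1) - Complex.I * fderiv ℝ f z (Pi.single i Complex.I))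

/-- The operator `∂/∂z̄ᵢ = (∂/∂xᵢ + √-1 ∂/∂yᵢ) / 2` on complex-valued functions on `ℂⁿ`. -/
def dzbar {n : ℕ} (i : Fin n) (f : (Fin n → ℂ) → ℂ) (z : Fin n → ℂ) : ℂ :=
  (1 / 2 : ℂ) *
    (fderiv ℝ f z (Pi.single i 1) + Complex.I * fderiv ℝ f z (Pi.single i Complex.I))

/-- The matrix `(∂ᵢ ∂_j̄ u)` of coefficients of `√-1 ∂∂̄u = √-1 ∑ (∂ᵢ ∂_j̄ u) dzⁱ ∧ dz̄ʲ`. -/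
def complexHessian {n : ℕ} (u : (Fin n → ℂ) → ℝ) (z : Fin n → ℂ) :
    Matrix (Fin n) (Fin n) ℂ :=
  Matrix.of fun i j => dz i (dzbar j (fun w => (u w : ℂ))) z

/-- The exterior product of the `n` forms `aₖ = √-1 ∑ (aₖ)_{ij̄} dzⁱ ∧ dz̄ʲ` of type (1,1) on `ℂⁿ`
is a multiple of the form `(√-1)ⁿ dz¹ ∧ dz̄¹ ∧ ⋯ ∧ dzⁿ ∧ dz̄ⁿ`. This is the factor: expanding
the product, only the terms `∏ₖ (aₖ)_{σ(k) τ(k)‾} √-1 dz^{σ(k)} ∧ dz̄^{τ(k)}` with `σ`, `τ`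
permutations survive, and reordering one of them gives the sign `sgn σ · sgn τ`. -/
def wedgeCoeff {n : ℕ} (a : Fin n → Matrix (Fin n) (Fin n) ℂ) : ℂ :=
  ∑ σ : Equiv.Perm (Fin n), ∑ τ : Equiv.Perm (Fin n),
    ((Equiv.Perm.sign σ : ℤ) : ℂ) * ((Equiv.Perm.sign τ : ℤ) : ℂ) * ∏ k, a k (σ k) (τ k)

/-- For coefficient matrices `X` of `χ` and `G` of `ω` (at a point, in one coordinate system), the
quotient `χⁿ / (ω ∧ χⁿ⁻¹)` of top-degree forms. It is a real number when `X`, `G` are Hermitian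
and positive definite. -/
def topFormRatio {n : ℕ} (X G : Matrix (Fin n) (Fin n) ℂ) : ℝ :=
  (wedgeCoeff (fun _ : Fin n => X) /
    wedgeCoeff (fun k : Fin n => if (k : ℕ) = 0 then G else X)).re

/-- The trace `g^{ij̄} X_{ij̄}` of the (1,1)-form with coefficients `X` with respect to the Hermitian
metric with coefficients `G`. It is a real number when `X`, `G` are Hermitian. -/
def traceWrt {n : ℕ} (G X : Matrix (Fin n) (Fin n) ℂ) : ℝ :=
  (G⁻¹ * X).trace.re

/-- The coordinate vector field `∂/∂zᵢ` of the chart `e`, at the point with coordinates `z`. -/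
def coordVec {n : ℕ} {M : Type*} [TopologicalSpace M] [ChartedSpace (Fin n → ℂ) M]
    (e : OpenPartialHomeomorph M (Fin n → ℂ)) (z : Fin n → ℂ) (i : Fin n) :
    TangentSpace 𝓘(ℂ, Fin n → ℂ) (e.symm z) :=
  mfderiv 𝓘(ℂ, Fin n → ℂ) 𝓘(ℂ, Fin n → ℂ) e.symm z (Pi.single i (1 : ℂ) : Fin n → ℂ)

/-- A (smooth) Hermitian metric on a complex manifold: a positive definite Hermitian form on each
holomorphic tangent space (linear in the first and conjugate-linear in the second variable), whose
coefficients in the charts are real-smooth functions. -/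
structure HermitianMetric (n : ℕ) (M : Type*) [TopologicalSpace M]
    [ChartedSpace (Fin n → ℂ) M] where
  form : ∀ x : M, TangentSpace 𝓘(ℂ, Fin n → ℂ) x →ₗ[ℂ]
    TangentSpace 𝓘(ℂ, Fin n → ℂ) x →ₗ⋆[ℂ] ℂ
  conj_symm : ∀ x v w, conj (form x v w) = form x w v
  pos : ∀ x v, v ≠ 0 → 0 < (form x v v).re
  smooth : ∀ e ∈ atlas (Fin n → ℂ) M, ∀ i j : Fin n,
    ContDiffOn ℝ ∞ (fun z => form (e.symm z) (coordVec e z i) (coordVec e z j)) e.target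

/-- The coefficients `g_{ij̄}` of the metric in the chart `e`, at the point with coordinates `z`. -/
def HermitianMetric.coeff {n : ℕ} {M : Type*} [TopologicalSpace M] [ChartedSpace (Fin n → ℂ) M]
    (g : HermitianMetric n M) (e : OpenPartialHomeomorph M (Fin n → ℂ)) (z : Fin n → ℂ) :
    Matrix (Fin n) (Fin n) ℂ :=
  Matrix.of fun i j => g.form (e.symm z) (coordVec e z i) (coordVec e z j)

/-- The metric is Kähler: `dω = 0` for the form `ω = √-1 ∑ g_{ij̄} dzⁱ ∧ dz̄ʲ`. In coordinates,
the (2,1)-part of `dω` is `√-1 ∑ ∂ₖ g_{ij̄} dzᵏ ∧ dzⁱ ∧ dz̄ʲ`, which vanishes exactly when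
`∂ₖ g_{ij̄}` is symmetric in `k`, `i`; the (1,2)-part is its complex conjugate. -/
def HermitianMetric.IsKahler {n : ℕ} {M : Type*} [TopologicalSpace M]
    [ChartedSpace (Fin n → ℂ) M] (g : HermitianMetric n M) : Prop :=
  ∀ e ∈ atlas (Fin n → ℂ) M, ∀ z ∈ e.target, ∀ i j k : Fin n,
    dz k (fun w => g.coeff e w i j) z = dz i (fun w => g.coeff e w k j) z

/-- The coefficients, in the chart `e`, of `χ_u = χ + √-1 ∂∂̄u`, for a function `u` on `M`. -/
def HermitianMetric.perturbedCoeff {n : ℕ} {M : Type*} [TopologicalSpace M]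
    [ChartedSpace (Fin n → ℂ) M] (χ : HermitianMetric n M) (u : M → ℝ)
    (e : OpenPartialHomeomorph M (Fin n → ℂ)) (z : Fin n → ℂ) : Matrix (Fin n) (Fin n) ℂ :=
  χ.coeff e z + complexHessian (fun w => u (e.symm w)) z

/-- The condition `χ - (n-1)/(n e^F) ω > 0`, where `g` is the metric with form `ω`. -/
def ConeCondition {n : ℕ} {M : Type*} [TopologicalSpace M] [ChartedSpace (Fin n → ℂ) M]
    (χ g : HermitianMetric n M) (F : M → ℝ) : Prop :=
  ∀ (x : M) (v : TangentSpace 𝓘(ℂ, Fin n → ℂ) x), v ≠ 0 →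
    0 < (χ.form x v v).re - ((n : ℝ) - 1) / (n * Real.exp (F x)) * (g.form x v v).re

/-- The time interval `[0, T)`, where `T` may be infinite. -/
def timeInterval (T : EReal) : Set ℝ := {t : ℝ | 0 ≤ t ∧ (t : EReal) < T}

/-- `φ` is a smooth solution on `M × [0, T)` of
`∂φ/∂t = log (χ_φⁿ / (ω ∧ χ_φⁿ⁻¹)) + F`, `χ_φ = χ + √-1 ∂∂̄φ > 0`, `φ(·, 0) = 0`,
where `g` is the metric with form `ω`. Smoothness is joint and up to `t = 0`; the time derivative
at `t = 0` is one-sided. -/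
structure IsSmoothSolution {n : ℕ} {M : Type*} [TopologicalSpace M]
    [ChartedSpace (Fin n → ℂ) M] (χ g : HermitianMetric n M) (F : M → ℝ) (T : EReal)
    (φ : ℝ → M → ℝ) : Prop where
  smooth : ContMDiffOn (𝓘(ℝ, ℝ).prod 𝓘(ℝ, Fin n → ℂ)) 𝓘(ℝ, ℝ) ∞
    (fun p : ℝ × M => φ p.1 p.2) (timeInterval T ×ˢ Set.univ)
  initial : ∀ x, φ 0 x = 0
  pos : ∀ t ∈ timeInterval T, ∀ e ∈ atlas (Fin n → ℂ) M, ∀ z ∈ e.target,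
    (χ.perturbedCoeff (φ t) e z).PosDef
  equation : ∀ t ∈ timeInterval T, ∀ e ∈ atlas (Fin n → ℂ) M, ∀ z ∈ e.target,
    HasDerivWithinAt (fun s => φ s (e.symm z))
      (Real.log (topFormRatio (χ.perturbedCoeff (φ t) e z) (g.coeff e z)) + F (e.symm z))
      (timeInterval T) t

end ParabolicDonaldson

end

open ParabolicDonaldson

/-!
The lower bound is a bound on the time derivative. With `X` and `G` the coefficient matrices of
`χ_φ` and `ω`, the right-hand side of the flow is `log n - log tr (X⁻¹ G) + F`
(`log_topFormRatio`), which is monotone in `X`, so that solutions can be compared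
(`comparison_principle`). Comparing `φ` with linear functions of time, and then with its own
translates in time, shows that `∂φ/∂t` is bounded by its initial size (`exists_velocity_bound`).
Hence `S = tr (X⁻¹ G) = ∑ 1 / λᵢ` lies between two positive constants, where `λᵢ` are the
eigenvalues of `χ_φ` with respect to `ω`. In particular every `λᵢ` is bounded below, and so is the
trace `∑ λᵢ` (`exists_lower_bound_trace`).

For the upper bound, let `m₀` be a lower bound of `φ` and put `ψ = φ - m₀ + 1 ≥ 1`. The maximum
principle is applied to
`log χ_φ(v, v) - log ω(v, v) - A φ + 1 / ψ`,
a function of time, a point and a tangent vector `v` there (`testFunction`). At a maximum `v` is an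
eigenvector for the largest eigenvalue `λₘ`. A quadratic holomorphic change of coordinates makes
`G = 1`, `dG = 0` and `X` diagonal at the point; this uses that `ω` is Kähler. The first- and
second-order conditions at the maximum, the flow differentiated twice in the direction `m`, and the
concavity of `-log tr (X⁻¹ G)` in `X` (`complexHessian_log_trace_ge`) combine to the inequality
`maximum_point_inequality`. As `χ` is not assumed closed, third derivatives of `φ` do not
cancel exactly but leave torsion terms that are linear in `∂φ`; the second derivative of `1 / ψ`
supplies the good term `2 |∂φ|² / ψ³` which absorbs them.

The dominant term of this inequality is `A` times
`1 - ∂φ/∂t - S⁻¹ ∑ λᵢ⁻² χ_{iī}`. The cone condition, `1 - s ≤ e^{-s}` and the Cauchy-Schwarz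
inequality for the `n - 1` summands of `S` other than `1 / λₘ` show that it is at most a negative
constant when `λₘ` is large (`barrier_coefficient_le`). Therefore, for `A` large,
`λₘ ≤ L ψ²` at the maximum (`exists_barrier_constants`). Since `log ψ` is dominated by `A φ`, the
test function is at most `C - A m₀` everywhere (`exists_bound_testFunction`), which is the claim
with `m₀ = inf φ`.

All constants have to be independent of the maximum point. They come from compactness: `M` is
covered by finitely many closed coordinate balls, the unitary frames of `ω` over such a ball form a
compact set (`isCompact_unitaryFrames`), and the pullbacks of `χ`, `ω` and `F` to normal coordinates
depend smoothly on the frame (`exists_bound_normal_derivatives`, `exists_cone_gap`).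

A Hermitian form with coefficients `H` sends `v` to `∑ v_i H_{ij̄} v̄_j`, whereas `star x ⬝ᵥ H *ᵥ x`
conjugates the first factor. A change of frame with matrix `P` therefore acts on coefficient
matrices by `H ↦ Rᴴ * H * R` with `R` the entrywise conjugate of `P`.
-/

namespace ParabolicDonaldson

open Matrix Filter Topology

/-! ### Hermitian linear algebra -/

section LinearAlgebra

variable {n : ℕ}

/-- Averaging over permutations: each index is the image of `k₀` equally often. -/
lemma sum_perm_apply_zero_mul {α : Type*} [CommRing α] (f : Fin n → α) (k₀ : Fin n) :
    (n : α) * ∑ σ : Equiv.Perm (Fin n), f (σ k₀) = (n.factorial : α) * ∑ i, f i := by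
  have h1 : ∀ k : Fin n, ∑ σ : Equiv.Perm (Fin n), f (σ k) =
      ∑ σ : Equiv.Perm (Fin n), f (σ k₀) := fun k => by
    refine Fintype.sum_equiv (Equiv.mulRight (Equiv.swap k k₀)) _ _ fun σ => ?_
    simp
  have h2 : ∑ k : Fin n, ∑ σ : Equiv.Perm (Fin n), f (σ k) =
      (n.factorial : α) * ∑ i, f i := by
    rw [Finset.sum_comm]
    have : ∀ σ : Equiv.Perm (Fin n), ∑ k, f (σ k) = ∑ i, f i := fun σ => Equiv.sum_comp σ f
    simp [this, Fintype.card_perm]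
  rw [← h2, Finset.sum_congr rfl fun k _ => h1 k]
  simp

lemma wedgeCoeff_eq_sum_det (a : Fin n → Matrix (Fin n) (Fin n) ℂ) :
    wedgeCoeff a = ∑ σ : Equiv.Perm (Fin n), ((Equiv.Perm.sign σ : ℤ) : ℂ) *
      (Matrix.of fun k l => a k (σ k) l).det := by
  unfold wedgeCoeff
  refine Finset.sum_congr rfl fun σ _ => ?_
  rw [← det_transpose, det_apply', Finset.mul_sum]
  refine Finset.sum_congr rfl fun τ _ => ?_
  simp [mul_assoc]

lemma wedgeCoeff_const (X : Matrix (Fin n) (Fin n) ℂ) :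
    wedgeCoeff (fun _ => X) = n.factorial * X.det := by
  rw [wedgeCoeff_eq_sum_det]
  have : ∀ σ : Equiv.Perm (Fin n), ((Equiv.Perm.sign σ : ℤ) : ℂ) *
      (Matrix.of fun k l => X (σ k) l).det = X.det := fun σ => by
    have h := det_permute σ X
    change (Matrix.of fun k l => X (σ k) l).det = _ at h
    rw [h, ← mul_assoc, ← Int.cast_mul]
    simp
  simp [this, Fintype.card_perm]

/-- The coefficient of `ω ∧ χⁿ⁻¹`: expanding along the row of `G` gives cofactors of `X`. -/
lemma card_mul_wedgeCoeff_mixed (hn : 0 < n) (X G : Matrix (Fin n) (Fin n) ℂ) :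
    (n : ℂ) * wedgeCoeff (fun k : Fin n => if (k : ℕ) = 0 then G else X) =
      n.factorial * (G * X.adjugate).trace := by
  have key : ∀ σ : Equiv.Perm (Fin n), ((Equiv.Perm.sign σ : ℤ) : ℂ) *
      (Matrix.of fun (k l : Fin n) => (if (k : ℕ) = 0 then G else X) (σ k) l).det =
      (G * X.adjugate) (σ ⟨0, hn⟩) (σ ⟨0, hn⟩) := fun σ => by
    have h1 : (Matrix.of fun (k l : Fin n) => (if (k : ℕ) = 0 then G else X) (σ k) l) =
        (X.updateRow (σ ⟨0, hn⟩) (G (σ ⟨0, hn⟩))).submatrix σ id := by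
      ext k l
      by_cases hk : (k : ℕ) = 0
      · have : k = ⟨0, hn⟩ := Fin.ext hk
        subst this
        simp
      · have h2 : σ k ≠ σ ⟨0, hn⟩ := fun h => hk (by rw [σ.injective h])
        simp [hk, updateRow_ne h2]
    rw [h1, det_permute, ← mul_assoc, ← Int.cast_mul]
    simp only [Int.units_coe_mul_self, Int.cast_one, one_mul]
    rw [Matrix.mul_apply, ← cramer_transpose_apply, cramer_eq_adjugate_mulVec,
      mulVec_eq_sum]
    simp [adjugate_transpose]
  rw [wedgeCoeff_eq_sum_det, Finset.sum_congr rfl fun σ _ => key σ,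
    sum_perm_apply_zero_mul (fun i => (G * X.adjugate) i i)]
  rfl

/-- The quotient `χⁿ / (ω ∧ χⁿ⁻¹)` is `n / tr_χ ω`. -/
lemma topFormRatio_eq (hn : 0 < n) {X : Matrix (Fin n) (Fin n) ℂ} (hX : X.PosDef)
    (G : Matrix (Fin n) (Fin n) ℂ) :
    topFormRatio X G = ((n : ℂ) / (X⁻¹ * G).trace).re := by
  have hdet : X.det ≠ 0 := hX.det_pos.ne'
  have hn' : (n : ℂ) ≠ 0 := by exact_mod_cast hn.ne'
  have hf : (n.factorial : ℂ) ≠ 0 := by exact_mod_cast n.factorial_ne_zero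
  have h1 : wedgeCoeff (fun k : Fin n => if (k : ℕ) = 0 then G else X) =
      n.factorial * X.det * (X⁻¹ * G).trace / n := by
    rw [eq_div_iff hn', mul_comm, card_mul_wedgeCoeff_mixed hn, Matrix.inv_def,
      Ring.inverse_eq_inv', smul_mul_assoc, trace_smul, trace_mul_comm G, smul_eq_mul]
    field_simp
  unfold topFormRatio
  rw [wedgeCoeff_const, h1]
  congr 1
  by_cases h0 : (X⁻¹ * G).trace = 0
  · simp [h0]
  · field_simp

/-- The trace of one form with respect to another does not depend on the frame. -/
lemma trace_inv_mul_congr {X G R : Matrix (Fin n) (Fin n) ℂ}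
    (hR : IsUnit R.det) :
    ((Rᴴ * X * R)⁻¹ * (Rᴴ * G * R)).trace = (X⁻¹ * G).trace := by
  have hR' : IsUnit (Rᴴ).det := by rw [det_conjTranspose]; exact hR.star
  have : (Rᴴ * X * R)⁻¹ * (Rᴴ * G * R) = R⁻¹ * (X⁻¹ * G) * R := by
    rw [Matrix.mul_inv_rev, Matrix.mul_inv_rev]
    calc R⁻¹ * (X⁻¹ * Rᴴ⁻¹) * (Rᴴ * G * R) = R⁻¹ * X⁻¹ * (Rᴴ⁻¹ * Rᴴ) * G * R := by
          simp only [Matrix.mul_assoc]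
      _ = _ := by rw [nonsing_inv_mul _ hR']; simp only [Matrix.mul_assoc, Matrix.one_mul]
  rw [this, trace_mul_comm, ← Matrix.mul_assoc, mul_nonsing_inv _ hR, Matrix.one_mul]

lemma exists_unitary_diagonal {H : Matrix (Fin n) (Fin n) ℂ} (hH : H.IsHermitian) :
    ∃ (U : Matrix (Fin n) (Fin n) ℂ) (d : Fin n → ℝ), Uᴴ * U = 1 ∧
      Uᴴ * H * U = diagonal fun i => (d i : ℂ) := by
  refine ⟨hH.eigenvectorUnitary, hH.eigenvalues, ?_, ?_⟩
  · exact Unitary.coe_star_mul_self hH.eigenvectorUnitary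
  · have := hH.conjStarAlgAut_star_eigenvectorUnitary
    rw [Unitary.conjStarAlgAut_star_apply] at this
    exact this

/-- Simultaneous diagonalization of a Hermitian form and an inner product. -/
lemma exists_simultaneous_diagonal {G X : Matrix (Fin n) (Fin n) ℂ} (hG : G.PosDef)
    (hX : X.IsHermitian) :
    ∃ (R : Matrix (Fin n) (Fin n) ℂ) (d : Fin n → ℝ), IsUnit R.det ∧ Rᴴ * G * R = 1 ∧
      Rᴴ * X * R = diagonal fun i => (d i : ℂ) := by
  obtain ⟨U, e, hU, hUe⟩ := exists_unitary_diagonal hG.isHermitian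
  have hUdet : IsUnit U.det := by
    have := congrArg det hU
    rw [det_mul, det_one] at this
    exact IsUnit.of_mul_eq_one_right _ this
  have hpos : ∀ i, 0 < e i := fun i => by
    have h1 : (Uᴴ * G * U).PosDef :=
      (Matrix.IsUnit.posDef_star_left_conjugate_iff ((isUnit_iff_isUnit_det _).2 hUdet)).2 hG
    rw [hUe, posDef_diagonal_iff] at h1
    exact_mod_cast h1 i
  set D : Matrix (Fin n) (Fin n) ℂ := diagonal fun i => (((Real.sqrt (e i))⁻¹ : ℝ) : ℂ) with hD
  have hDH : Dᴴ = D := by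
    rw [hD, diagonal_conjTranspose]
    congr 1
    ext i
    simp
  have h2 : (U * D)ᴴ * G * (U * D) = 1 := by
    rw [conjTranspose_mul, hDH]
    have : D * Uᴴ * G * (U * D) = D * (Uᴴ * G * U) * D := by simp only [Matrix.mul_assoc]
    rw [this, hUe, hD, diagonal_mul_diagonal, diagonal_mul_diagonal, ← diagonal_one]
    congr 1
    ext i
    have hs := Real.mul_self_sqrt (hpos i).le
    have hs' : Real.sqrt (e i) ≠ 0 := (Real.sqrt_pos.2 (hpos i)).ne'
    rw [← Complex.ofReal_mul, ← Complex.ofReal_mul, ← Complex.ofReal_one]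
    congr 1
    field_simp
    rw [sq, hs]
  have hXH : ((U * D)ᴴ * X * (U * D)).IsHermitian :=
    isHermitian_conjTranspose_mul_mul _ hX
  obtain ⟨V, d, hV, hVd⟩ := exists_unitary_diagonal hXH
  have h3 : (U * D * V)ᴴ * G * (U * D * V) = 1 := by
    rw [conjTranspose_mul (U * D)]
    have : Vᴴ * (U * D)ᴴ * G * (U * D * V) = Vᴴ * ((U * D)ᴴ * G * (U * D)) * V := by
      simp only [Matrix.mul_assoc]
    rw [this, h2, Matrix.mul_one, hV]
  refine ⟨U * D * V, d, ?_, h3, ?_⟩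
  · have := congrArg det h3
    rw [det_mul, det_one] at this
    exact IsUnit.of_mul_eq_one_right _ this
  · rw [conjTranspose_mul (U * D), ← hVd]
    simp only [Matrix.mul_assoc]

lemma posDef_congr {X R : Matrix (Fin n) (Fin n) ℂ} (hX : X.PosDef) (hR : IsUnit R.det) :
    (Rᴴ * X * R).PosDef :=
  (Matrix.IsUnit.posDef_star_left_conjugate_iff ((isUnit_iff_isUnit_det _).2 hR)).2 hX

lemma trace_inv_mul_diagonal {d : Fin n → ℝ} (hd : ∀ i, 0 < d i)
    (A : Matrix (Fin n) (Fin n) ℂ) :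
    ((diagonal fun i => (d i : ℂ))⁻¹ * A).trace = ∑ i, (d i : ℂ)⁻¹ * A i i := by
  have : (diagonal fun i => (d i : ℂ))⁻¹ = diagonal fun i => (d i : ℂ)⁻¹ := by
    refine inv_eq_right_inv ?_
    rw [diagonal_mul_diagonal, ← diagonal_one]
    congr 1
    ext i
    exact mul_inv_cancel₀ (by exact_mod_cast (hd i).ne')
  rw [this]
  simp [Matrix.trace, diagonal_mul]

lemma trace_inv_mul_eq_ofReal {X G : Matrix (Fin n) (Fin n) ℂ} (hX : X.PosDef)
    (hG : G.PosDef) : (X⁻¹ * G).trace = (((X⁻¹ * G).trace.re : ℝ) : ℂ) := by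
  obtain ⟨R, d, hR, hRX, hRG⟩ := exists_simultaneous_diagonal hX hG.isHermitian
  have := trace_inv_mul_congr (X := X) (G := G) hR
  rw [← this, hRX, hRG]
  simp [trace_diagonal]

lemma trace_inv_mul_pos (hn : 0 < n) {X G : Matrix (Fin n) (Fin n) ℂ} (hX : X.PosDef)
    (hG : G.PosDef) : 0 < (X⁻¹ * G).trace.re := by
  obtain ⟨R, d, hR, hRX, hRG⟩ := exists_simultaneous_diagonal hX hG.isHermitian
  have := trace_inv_mul_congr (X := X) (G := G) hR
  have hd : ∀ i, 0 < d i := fun i => by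
    have h1 := posDef_congr hG hR
    rw [hRG, posDef_diagonal_iff] at h1
    exact_mod_cast h1 i
  rw [← this, hRX, hRG]
  have : Nonempty (Fin n) := ⟨⟨0, hn⟩⟩
  simpa [trace_diagonal] using Finset.sum_pos (fun i _ => hd i) Finset.univ_nonempty

/-- Monotonicity of `X ↦ -tr_X G`: this is the ellipticity of the flow. -/
lemma trace_inv_mul_le_of_le {X Y G : Matrix (Fin n) (Fin n) ℂ} (hX : X.PosDef)
    (hY : Y.PosDef) (hXY : (Y - X).PosSemidef) (hG : G.PosDef) :
    (Y⁻¹ * G).trace.re ≤ (X⁻¹ * G).trace.re := by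
  obtain ⟨R, d, hR, hRX, hRY⟩ := exists_simultaneous_diagonal hX hY.isHermitian
  have h1 := trace_inv_mul_congr (X := X) (G := G) hR
  have h2 := trace_inv_mul_congr (G := G) (X := Y) hR
  have hG' := posDef_congr hG hR
  have hd : ∀ i, 1 ≤ d i := fun i => by
    have h3 := hXY.conjTranspose_mul_mul_same R
    have h4 : Rᴴ * (Y - X) * R = diagonal fun i => ((d i - 1 : ℝ) : ℂ) := by
      rw [Matrix.mul_sub, Matrix.sub_mul, hRX, hRY, ← diagonal_one, diagonal_sub]
      congr 1
      ext i
      simp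
    rw [h4, posSemidef_diagonal_iff] at h3
    have := h3 i
    norm_cast at this
    linarith
  rw [← h1, ← h2, hRX, hRY, trace_inv_mul_diagonal fun i => one_pos.trans_le (hd i)]
  simp only [inv_one, Matrix.one_mul, Complex.re_sum, Matrix.trace, Matrix.diag]
  refine Finset.sum_le_sum fun i _ => ?_
  have h5 : 0 ≤ ((Rᴴ * G * R) i i).re := by
    have := hG'.posSemidef.diag_nonneg (i := i)
    exact (Complex.nonneg_iff.1 this).1
  rw [← Complex.ofReal_inv, Complex.re_ofReal_mul]
  exact mul_le_of_le_one_left h5 (inv_le_one_of_one_le₀ (hd i))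

lemma topFormRatio_eq_div (hn : 0 < n) {X G : Matrix (Fin n) (Fin n) ℂ} (hX : X.PosDef)
    (hG : G.PosDef) : topFormRatio X G = n / (X⁻¹ * G).trace.re := by
  rw [topFormRatio_eq hn hX, trace_inv_mul_eq_ofReal hX hG]
  norm_cast

lemma log_topFormRatio (hn : 0 < n) {X G : Matrix (Fin n) (Fin n) ℂ} (hX : X.PosDef)
    (hG : G.PosDef) :
    Real.log (topFormRatio X G) = Real.log n - Real.log (X⁻¹ * G).trace.re := by
  rw [topFormRatio_eq_div hn hX hG, Real.log_div (by exact_mod_cast hn.ne')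
    (trace_inv_mul_pos hn hX hG).ne']

end LinearAlgebra

/-! ### Calculus of the Wirtinger operators -/

section Wirtinger

variable {n : ℕ} {U : Set (Fin n → ℂ)} {z : Fin n → ℂ} {f g : (Fin n → ℂ) → ℂ}

lemma dz_congr (h : f =ᶠ[𝓝 z] g) (i : Fin n) : dz i f z = dz i g z := by
  simp only [dz, h.fderiv_eq]

lemma dzbar_congr (h : f =ᶠ[𝓝 z] g) (i : Fin n) : dzbar i f z = dzbar i g z := by
  simp only [dzbar, h.fderiv_eq]

lemma dzbar_eventuallyEq (h : f =ᶠ[𝓝 z] g) (i : Fin n) : dzbar i f =ᶠ[𝓝 z] dzbar i g :=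
  h.eventuallyEq_nhds.mono fun _ hw => dzbar_congr hw i

lemma dz_const (c : ℂ) (i : Fin n) : dz i (fun _ => c) z = 0 := by
  simp [dz]

lemma dzbar_const (c : ℂ) (i : Fin n) : dzbar i (fun _ => c) z = 0 := by
  simp [dzbar]

lemma dz_add (hf : DifferentiableAt ℝ f z) (hg : DifferentiableAt ℝ g z) (i : Fin n) :
    dz i (fun w => f w + g w) z = dz i f z + dz i g z := by
  simp only [dz, fderiv_fun_add hf hg, _root_.add_apply]
  ring

lemma dzbar_add (hf : DifferentiableAt ℝ f z) (hg : DifferentiableAt ℝ g z) (i : Fin n) :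
    dzbar i (fun w => f w + g w) z = dzbar i f z + dzbar i g z := by
  simp only [dzbar, fderiv_fun_add hf hg, _root_.add_apply]
  ring

lemma dz_sub (hf : DifferentiableAt ℝ f z) (hg : DifferentiableAt ℝ g z) (i : Fin n) :
    dz i (fun w => f w - g w) z = dz i f z - dz i g z := by
  simp only [dz, fderiv_fun_sub hf hg, _root_.sub_apply]
  ring

lemma dzbar_sub (hf : DifferentiableAt ℝ f z) (hg : DifferentiableAt ℝ g z) (i : Fin n) :
    dzbar i (fun w => f w - g w) z = dzbar i f z - dzbar i g z := by
  simp only [dzbar, fderiv_fun_sub hf hg, _root_.sub_apply]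
  ring

lemma dz_mul (hf : DifferentiableAt ℝ f z) (hg : DifferentiableAt ℝ g z) (i : Fin n) :
    dz i (fun w => f w * g w) z = dz i f z * g z + f z * dz i g z := by
  simp only [dz, fderiv_fun_mul hf hg, _root_.add_apply,
    _root_.smul_apply, smul_eq_mul]
  ring

lemma dzbar_mul (hf : DifferentiableAt ℝ f z) (hg : DifferentiableAt ℝ g z) (i : Fin n) :
    dzbar i (fun w => f w * g w) z = dzbar i f z * g z + f z * dzbar i g z := by
  simp only [dzbar, fderiv_fun_mul hf hg, _root_.add_apply,
    _root_.smul_apply, smul_eq_mul]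
  ring

lemma dz_const_mul (c : ℂ) (hf : DifferentiableAt ℝ f z) (i : Fin n) :
    dz i (fun w => c * f w) z = c * dz i f z := by
  rw [dz_mul (differentiableAt_const c) hf, dz_const]
  ring

lemma dz_sum {ι : Type*} (s : Finset ι) {F : ι → (Fin n → ℂ) → ℂ}
    (hF : ∀ k ∈ s, DifferentiableAt ℝ (F k) z) (i : Fin n) :
    dz i (fun w => ∑ k ∈ s, F k w) z = ∑ k ∈ s, dz i (F k) z := by
  simp only [dz, fderiv_fun_sum hF, _root_.sum_apply]
  rw [Finset.mul_sum, ← Finset.sum_sub_distrib, Finset.mul_sum]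

lemma dzbar_sum {ι : Type*} (s : Finset ι) {F : ι → (Fin n → ℂ) → ℂ}
    (hF : ∀ k ∈ s, DifferentiableAt ℝ (F k) z) (i : Fin n) :
    dzbar i (fun w => ∑ k ∈ s, F k w) z = ∑ k ∈ s, dzbar i (F k) z := by
  simp only [dzbar, fderiv_fun_sum hF, _root_.sum_apply]
  rw [Finset.mul_sum, ← Finset.sum_add_distrib, Finset.mul_sum]

lemma fderiv_conj_comp (v : Fin n → ℂ) :
    fderiv ℝ (fun w => conj (f w)) z v = conj (fderiv ℝ f z v) := by
  have := (Complex.conjCLE : ℂ ≃L[ℝ] ℂ).comp_fderiv (f := f) (x := z)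
  have h2 := DFunLike.congr_fun this v
  simpa [Function.comp_def] using h2

lemma dz_conj (i : Fin n) : dz i (fun w => conj (f w)) z = conj (dzbar i f z) := by
  simp only [dz, dzbar, fderiv_conj_comp, map_mul, map_add, Complex.conj_I]
  simp only [map_div₀, map_one, map_ofNat]
  ring

lemma dzbar_conj (i : Fin n) : dzbar i (fun w => conj (f w)) z = conj (dz i f z) := by
  simp only [dz, dzbar, fderiv_conj_comp, map_mul, map_sub, Complex.conj_I]
  simp only [map_div₀, map_one, map_ofNat]
  ring

lemma dzbar_ofReal (u : (Fin n → ℂ) → ℝ) (i : Fin n) :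
    dzbar i (fun w => (u w : ℂ)) z = conj (dz i (fun w => (u w : ℂ)) z) := by
  rw [← dzbar_conj]
  simp

lemma ContDiffOn.dz (hf : ContDiffOn ℝ ∞ f U) (hU : IsOpen U) (i : Fin n) :
    ContDiffOn ℝ ∞ (dz i f) U := by
  have h : ContDiffOn ℝ ∞ (fderiv ℝ f) U := hf.fderiv_of_isOpen hU (by simp)
  unfold ParabolicDonaldson.dz
  exact contDiffOn_const.mul ((h.clm_apply contDiffOn_const).sub
    (contDiffOn_const.mul (h.clm_apply contDiffOn_const)))

lemma ContDiffOn.dzbar (hf : ContDiffOn ℝ ∞ f U) (hU : IsOpen U) (i : Fin n) :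
    ContDiffOn ℝ ∞ (dzbar i f) U := by
  have h : ContDiffOn ℝ ∞ (fderiv ℝ f) U := hf.fderiv_of_isOpen hU (by simp)
  unfold ParabolicDonaldson.dzbar
  exact contDiffOn_const.mul ((h.clm_apply contDiffOn_const).add
    (contDiffOn_const.mul (h.clm_apply contDiffOn_const)))

lemma ContDiffOn.differentiableAt_of_isOpen {E G : Type*} [NormedAddCommGroup E]
    [NormedSpace ℝ E] [NormedAddCommGroup G] [NormedSpace ℝ G] {f : E → G} {U : Set E} {z : E}
    (hf : ContDiffOn ℝ ∞ f U) (hU : IsOpen U)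
    (hz : z ∈ U) : DifferentiableAt ℝ f z :=
  (hf.contDiffAt (hU.mem_nhds hz)).differentiableAt (by simp)

lemma ContDiffOn.ofReal {E : Type*} [NormedAddCommGroup E] [NormedSpace ℝ E] {s : Set E}
    {u : E → ℝ} (hu : ContDiffOn ℝ ∞ u s) : ContDiffOn ℝ ∞ (fun w => (u w : ℂ)) s :=
  Complex.ofRealCLM.contDiff.comp_contDiffOn hu

lemma ContDiffOn.re {E : Type*} [NormedAddCommGroup E] [NormedSpace ℝ E] {s : Set E}
    {u : E → ℂ} (hu : ContDiffOn ℝ ∞ u s) : ContDiffOn ℝ ∞ (fun w => (u w).re) s :=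
  Complex.reCLM.contDiff.comp_contDiffOn hu

lemma ContDiffOn.conj {E : Type*} [NormedAddCommGroup E] [NormedSpace ℝ E] {s : Set E}
    {u : E → ℂ} (hu : ContDiffOn ℝ ∞ u s) : ContDiffOn ℝ ∞ (fun w => conj (u w)) s :=
  Complex.conjCLE.contDiff.comp_contDiffOn hu

/-- Directional derivatives of a smooth function commute. -/
lemma fderiv_fderiv_comm {E : Type*} [NormedAddCommGroup E] [NormedSpace ℝ E] {f : E → ℂ}
    {U : Set E} {z : E} (hf : ContDiffOn ℝ ∞ f U) (hU : IsOpen U) (hz : z ∈ U) (a b : E) :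
    fderiv ℝ (fun w => fderiv ℝ f w a) z b = fderiv ℝ (fun w => fderiv ℝ f w b) z a := by
  have hd : DifferentiableAt ℝ (fderiv ℝ f) z :=
    ContDiffOn.differentiableAt_of_isOpen (hf.fderiv_of_isOpen hU (by simp)) hU hz
  have h1 : ∀ c d : E, fderiv ℝ (fun w => fderiv ℝ f w c) z d =
      fderiv ℝ (fderiv ℝ f) z d c := fun c d => by
    rw [fderiv_clm_apply hd (differentiableAt_const c)]
    simp
  rw [h1, h1]
  have hs : IsSymmSndFDerivAt ℝ f z :=
    (hf.contDiffAt (hU.mem_nhds hz)).isSymmSndFDerivAt (by simpa using ENat.LEInfty.out)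
  exact hs b a

lemma differentiableAt_fderiv_apply {E : Type*} [NormedAddCommGroup E] [NormedSpace ℝ E]
    {f : E → ℂ} {U : Set E} {z : E} (hf : ContDiffOn ℝ ∞ f U) (hU : IsOpen U) (hz : z ∈ U)
    (a : E) : DifferentiableAt ℝ (fun w => fderiv ℝ f w a) z :=
  (ContDiffOn.differentiableAt_of_isOpen (hf.fderiv_of_isOpen hU (by simp)) hU hz).clm_apply
    (differentiableAt_const a)

lemma fderiv_dz (hf : ContDiffOn ℝ ∞ f U) (hU : IsOpen U) (hz : z ∈ U) (i : Fin n)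
    (a : Fin n → ℂ) : fderiv ℝ (dz i f) z a = (1 / 2 : ℂ) *
      (fderiv ℝ (fun w => fderiv ℝ f w (Pi.single i 1)) z a -
        Complex.I * fderiv ℝ (fun w => fderiv ℝ f w (Pi.single i Complex.I)) z a) := by
  have h := fun b => differentiableAt_fderiv_apply hf hU hz b
  unfold dz
  rw [fderiv_const_mul ((h _).fun_sub ((h _).const_mul _)), _root_.smul_apply,
    fderiv_fun_sub (h _) ((h _).const_mul _), _root_.sub_apply,
    fderiv_const_mul (h _)]
  simp

lemma fderiv_dzbar (hf : ContDiffOn ℝ ∞ f U) (hU : IsOpen U) (hz : z ∈ U) (i : Fin n)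
    (a : Fin n → ℂ) : fderiv ℝ (dzbar i f) z a = (1 / 2 : ℂ) *
      (fderiv ℝ (fun w => fderiv ℝ f w (Pi.single i 1)) z a +
        Complex.I * fderiv ℝ (fun w => fderiv ℝ f w (Pi.single i Complex.I)) z a) := by
  have h := fun b => differentiableAt_fderiv_apply hf hU hz b
  unfold dzbar
  rw [fderiv_const_mul ((h _).fun_add ((h _).const_mul _)), _root_.smul_apply,
    fderiv_fun_add (h _) ((h _).const_mul _), _root_.add_apply,
    fderiv_const_mul (h _)]
  simp

lemma dz_dzbar_comm (hf : ContDiffOn ℝ ∞ f U) (hU : IsOpen U) (hz : z ∈ U) (i j : Fin n) :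
    dz i (dzbar j f) z = dzbar j (dz i f) z := by
  have h := fderiv_fderiv_comm hf hU hz
  simp only [dz, dzbar]
  change (1 / 2 : ℂ) * (fderiv ℝ (dzbar j f) z _ - _ * fderiv ℝ (dzbar j f) z _) =
    (1 / 2 : ℂ) * (fderiv ℝ (dz i f) z _ + _ * fderiv ℝ (dz i f) z _)
  simp only [fderiv_dz hf hU hz, fderiv_dzbar hf hU hz]
  rw [h (Pi.single j 1) (Pi.single i 1), h (Pi.single j 1) (Pi.single i Complex.I),
    h (Pi.single j Complex.I) (Pi.single i 1), h (Pi.single j Complex.I) (Pi.single i Complex.I)]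
  ring

lemma dz_dz_comm (hf : ContDiffOn ℝ ∞ f U) (hU : IsOpen U) (hz : z ∈ U) (i j : Fin n) :
    dz i (dz j f) z = dz j (dz i f) z := by
  have h := fderiv_fderiv_comm hf hU hz
  simp only [dz]
  change (1 / 2 : ℂ) * (fderiv ℝ (dz j f) z _ - _ * fderiv ℝ (dz j f) z _) =
    (1 / 2 : ℂ) * (fderiv ℝ (dz i f) z _ - _ * fderiv ℝ (dz i f) z _)
  simp only [fderiv_dz hf hU hz]
  rw [h (Pi.single j 1) (Pi.single i 1), h (Pi.single j 1) (Pi.single i Complex.I),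
    h (Pi.single j Complex.I) (Pi.single i 1), h (Pi.single j Complex.I) (Pi.single i Complex.I)]
  ring

lemma dzbar_dzbar_comm (hf : ContDiffOn ℝ ∞ f U) (hU : IsOpen U) (hz : z ∈ U) (i j : Fin n) :
    dzbar i (dzbar j f) z = dzbar j (dzbar i f) z := by
  have h := fderiv_fderiv_comm hf hU hz
  simp only [dzbar]
  change (1 / 2 : ℂ) * (fderiv ℝ (dzbar j f) z _ + _ * fderiv ℝ (dzbar j f) z _) =
    (1 / 2 : ℂ) * (fderiv ℝ (dzbar i f) z _ + _ * fderiv ℝ (dzbar i f) z _)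
  simp only [fderiv_dzbar hf hU hz]
  rw [h (Pi.single j 1) (Pi.single i 1), h (Pi.single j 1) (Pi.single i Complex.I),
    h (Pi.single j Complex.I) (Pi.single i 1), h (Pi.single j Complex.I) (Pi.single i Complex.I)]
  ring

/-- Decomposition of a real-linear functional on `ℂⁿ` into its complex-linear and
conjugate-linear parts. -/
lemma realLinear_apply_eq (L : (Fin n → ℂ) →L[ℝ] ℂ) (v : Fin n → ℂ) :
    L v = ∑ b, ((1 / 2 : ℂ) * (L (Pi.single b 1) - Complex.I * L (Pi.single b Complex.I)) * v b +
      (1 / 2 : ℂ) * (L (Pi.single b 1) + Complex.I * L (Pi.single b Complex.I)) * conj (v b)) := by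
  have hv : v = ∑ b, ((v b).re • (Pi.single b (1 : ℂ) : Fin n → ℂ) +
      (v b).im • (Pi.single b Complex.I : Fin n → ℂ)) := by
    ext c
    simp only [Finset.sum_apply, Pi.add_apply, Pi.smul_apply, Pi.single_apply]
    rw [Finset.sum_eq_single c (fun b _ hb => by simp [hb.symm]) (by simp)]
    simp
  conv_lhs => rw [hv]
  rw [map_sum]
  refine Finset.sum_congr rfl fun b _ => ?_
  rw [map_add, map_smul, map_smul]
  have h1 : v b = (v b).re + (v b).im * Complex.I := (Complex.re_add_im _).symm
  have h2 : conj (v b) = (v b).re - (v b).im * Complex.I := by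
    apply Complex.ext <;> simp
  rw [h2]
  nth_rewrite 3 [h1]
  simp only [Complex.real_smul]
  linear_combination ((v b).im * L (Pi.single b Complex.I)) * Complex.I_mul_I

/-- The matrix `(∂φ_b / ∂z_i)` of the complex derivative of a map `ℂⁿ → ℂⁿ`; it is zero where the
map is not complex differentiable. -/
noncomputable def jacobian (φ : (Fin n → ℂ) → (Fin n → ℂ)) (z : Fin n → ℂ) :
    Matrix (Fin n) (Fin n) ℂ :=
  Matrix.of fun b i => fderiv ℂ φ z (Pi.single i 1) b

lemma fderiv_comp_holomorphic {φ : (Fin n → ℂ) → (Fin n → ℂ)}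
    (hf : DifferentiableAt ℝ f (φ z)) (hφ : DifferentiableAt ℂ φ z) (v : Fin n → ℂ) :
    fderiv ℝ (fun w => f (φ w)) z v = fderiv ℝ f (φ z) (fderiv ℂ φ z v) := by
  have h := hf.hasFDerivAt.comp z (hφ.hasFDerivAt.restrictScalars ℝ)
  have h2 : fderiv ℝ (fun w => f (φ w)) z = _ := h.fderiv
  rw [h2]
  rfl

lemma single_I_eq_smul (i : Fin n) :
    (Pi.single i Complex.I : Fin n → ℂ) = Complex.I • (Pi.single i 1 : Fin n → ℂ) := by
  rw [← Pi.single_smul]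
  simp

/-- Chain rule for `∂` and a holomorphic map. -/
lemma dz_comp_holomorphic {φ : (Fin n → ℂ) → (Fin n → ℂ)}
    (hf : DifferentiableAt ℝ f (φ z)) (hφ : DifferentiableAt ℂ φ z) (i : Fin n) :
    dz i (fun w => f (φ w)) z = ∑ b, dz b f (φ z) * jacobian φ z b i := by
  unfold dz
  rw [fderiv_comp_holomorphic hf hφ, fderiv_comp_holomorphic hf hφ, single_I_eq_smul i, map_smul,
    realLinear_apply_eq (fderiv ℝ f (φ z)) (fderiv ℂ φ z (Pi.single i 1)),
    realLinear_apply_eq (fderiv ℝ f (φ z)) (Complex.I • fderiv ℂ φ z (Pi.single i 1)),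
    Finset.mul_sum, ← Finset.sum_sub_distrib, Finset.mul_sum]
  refine Finset.sum_congr rfl fun b _ => ?_
  simp only [jacobian, of_apply, Pi.smul_apply, smul_eq_mul, map_mul, Complex.conj_I]
  ring_nf
  simp only [Complex.I_sq, Complex.I_pow_three]
  ring

/-- Chain rule for `∂̄` and a holomorphic map. -/
lemma dzbar_comp_holomorphic {φ : (Fin n → ℂ) → (Fin n → ℂ)}
    (hf : DifferentiableAt ℝ f (φ z)) (hφ : DifferentiableAt ℂ φ z) (i : Fin n) :
    dzbar i (fun w => f (φ w)) z = ∑ b, dzbar b f (φ z) * conj (jacobian φ z b i) := by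
  unfold dzbar
  rw [fderiv_comp_holomorphic hf hφ, fderiv_comp_holomorphic hf hφ, single_I_eq_smul i, map_smul,
    realLinear_apply_eq (fderiv ℝ f (φ z)) (fderiv ℂ φ z (Pi.single i 1)),
    realLinear_apply_eq (fderiv ℝ f (φ z)) (Complex.I • fderiv ℂ φ z (Pi.single i 1)),
    Finset.mul_sum, ← Finset.sum_add_distrib, Finset.mul_sum]
  refine Finset.sum_congr rfl fun b _ => ?_
  simp only [jacobian, of_apply, Pi.smul_apply, smul_eq_mul, map_mul, Complex.conj_I]
  ring_nf
  simp only [Complex.I_sq, Complex.I_pow_three]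
  ring

lemma dzbar_holomorphic (hf : DifferentiableAt ℂ f z) (i : Fin n) : dzbar i f z = 0 := by
  unfold dzbar
  have h2 : fderiv ℝ f z = _ := (hf.hasFDerivAt.restrictScalars ℝ).fderiv
  rw [h2]
  simp only [ContinuousLinearMap.coe_restrictScalars', single_I_eq_smul i, map_smul, smul_eq_mul]
  linear_combination (1 / 2 : ℂ) * (fderiv ℂ f z (Pi.single i 1)) * Complex.I_mul_I

lemma dz_holomorphic (hf : DifferentiableAt ℂ f z) (i : Fin n) :
    dz i f z = fderiv ℂ f z (Pi.single i 1) := by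
  unfold dz
  have h2 : fderiv ℝ f z = _ := (hf.hasFDerivAt.restrictScalars ℝ).fderiv
  rw [h2]
  simp only [ContinuousLinearMap.coe_restrictScalars', single_I_eq_smul i, map_smul, smul_eq_mul]
  linear_combination (-1 / 2 : ℂ) * (fderiv ℂ f z (Pi.single i 1)) * Complex.I_mul_I

end Wirtinger

/-! ### The complex Hessian -/

section ComplexHessian

variable {n : ℕ} {U : Set (Fin n → ℂ)} {z : Fin n → ℂ} {u v : (Fin n → ℂ) → ℝ}

lemma complexHessian_congr (h : u =ᶠ[𝓝 z] v) : complexHessian u z = complexHessian v z := by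
  ext i j
  refine dz_congr (dzbar_eventuallyEq ?_ j) i
  exact h.mono fun w hw => by simp only [hw]

lemma complexHessian_isHermitian (hu : ContDiffOn ℝ ∞ u U) (hU : IsOpen U) (hz : z ∈ U) :
    (complexHessian u z).IsHermitian := by
  ext i j
  simp only [conjTranspose_apply, complexHessian, of_apply]
  rw [dz_dzbar_comm (ContDiffOn.ofReal hu) hU hz, ← starRingEnd_apply, ← dz_conj]
  have : (fun w => conj (dz j (fun w => (u w : ℂ)) w)) = dzbar j fun w => (u w : ℂ) := by
    ext w
    rw [← dzbar_ofReal]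
  rw [this]

lemma complexHessian_sub (hu : ContDiffOn ℝ ∞ u U) (hv : ContDiffOn ℝ ∞ v U) (hU : IsOpen U)
    (hz : z ∈ U) : complexHessian (fun w => u w - v w) z =
      complexHessian u z - complexHessian v z := by
  have hu' := ContDiffOn.ofReal hu
  have hv' := ContDiffOn.ofReal hv
  ext i j
  simp only [complexHessian, of_apply, Matrix.sub_apply]
  rw [← dz_sub (ContDiffOn.differentiableAt_of_isOpen (ContDiffOn.dzbar hu' hU j) hU hz)
    (ContDiffOn.differentiableAt_of_isOpen (ContDiffOn.dzbar hv' hU j) hU hz)]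
  refine dz_congr ?_ i
  filter_upwards [hU.mem_nhds hz] with w hw
  rw [← dzbar_sub (ContDiffOn.differentiableAt_of_isOpen hu' hU hw)
    (ContDiffOn.differentiableAt_of_isOpen hv' hU hw)]
  simp

/-- Transformation law of `√-1 ∂∂̄u` under a holomorphic map. -/
lemma complexHessian_comp_holomorphic {φ : (Fin n → ℂ) → (Fin n → ℂ)} {V : Set (Fin n → ℂ)}
    (hu : ContDiffOn ℝ ∞ u V) (hV : IsOpen V) (hφ : ContDiffOn ℂ ∞ φ U) (hU : IsOpen U)
    (hφV : Set.MapsTo φ U V) (hz : z ∈ U) :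
    complexHessian (fun w => u (φ w)) z =
      ((jacobian φ z).map conj)ᴴ * complexHessian u (φ z) * (jacobian φ z).map conj := by
  have hu' := ContDiffOn.ofReal hu
  have hd : ∀ w ∈ U, DifferentiableAt ℂ φ w := fun w hw =>
    (hφ.contDiffAt (hU.mem_nhds hw)).differentiableAt (by simp)
  have hJ : ∀ b j, DifferentiableAt ℂ (fun w => jacobian φ w b j) z := fun b j => by
    have h1 : ContDiffOn ℂ ∞ (fderiv ℂ φ) U := hφ.fderiv_of_isOpen hU (by simp)
    have h2 := ((h1.contDiffAt (hU.mem_nhds hz)).differentiableAt (by simp)).clm_apply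
      (differentiableAt_const (Pi.single j 1))
    exact (differentiableAt_pi.1 h2) b
  have hdu : ∀ b, DifferentiableAt ℝ (dzbar b fun w => (u w : ℂ)) (φ z) := fun b =>
    ContDiffOn.differentiableAt_of_isOpen (ContDiffOn.dzbar hu' hV b) hV (hφV hz)
  have hJc : ∀ b j, DifferentiableAt ℝ (fun w => conj (jacobian φ w b j)) z := fun b j =>
    Complex.conjCLE.differentiable.differentiableAt.comp z ((hJ b j).restrictScalars ℝ)
  have hduφ : ∀ b, DifferentiableAt ℝ (fun w => dzbar b (fun w => (u w : ℂ)) (φ w)) z := fun b =>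
    (hdu b).comp z ((hd z hz).restrictScalars ℝ)
  ext i j
  have h1 : dzbar j (fun w => (u (φ w) : ℂ)) =ᶠ[𝓝 z]
      fun w => ∑ b, dzbar b (fun w => (u w : ℂ)) (φ w) * conj (jacobian φ w b j) := by
    filter_upwards [hU.mem_nhds hz] with w hw
    exact dzbar_comp_holomorphic (f := fun w => (u w : ℂ))
      (ContDiffOn.differentiableAt_of_isOpen hu' hV (hφV hw)) (hd w hw) j
  simp only [complexHessian, of_apply]
  rw [dz_congr h1, dz_sum _ fun b _ => (hduφ b).fun_mul (hJc b j)]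
  have h2 : ∀ b, dz i (fun w => dzbar b (fun w => (u w : ℂ)) (φ w) * conj (jacobian φ w b j)) z =
      ∑ a, jacobian φ z a i * dz a (dzbar b fun w => (u w : ℂ)) (φ z) *
        conj (jacobian φ z b j) := fun b => by
    rw [dz_mul (hduφ b) (hJc b j), dz_conj, dzbar_holomorphic (hJ b j),
      dz_comp_holomorphic (hdu b) (hd z hz), map_zero, mul_zero, add_zero, Finset.sum_mul]
    exact Finset.sum_congr rfl fun a _ => by ring
  rw [Finset.sum_congr rfl fun b _ => h2 b]
  simp [Matrix.mul_apply, Finset.sum_mul]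

/-! ### Second-order conditions at a local maximum -/

/-- If the second derivative were positive, the local maximum would also be a local minimum, and the
function locally constant. -/
lemma deriv_deriv_nonpos_of_isLocalMax {g : ℝ → ℝ} {s : ℝ} (hg : IsLocalMax g s)
    (hc : ContinuousAt g s) : deriv (deriv g) s ≤ 0 := by
  by_contra! hlt
  have h1 : IsLocalMin g s := isLocalMin_of_deriv_deriv_pos hlt hg.deriv_eq_zero hc
  have h2 : g =ᶠ[𝓝 s] fun _ => g s := by
    filter_upwards [hg, h1] with x hx hx'
    exact le_antisymm hx hx'
  have h3 : deriv (deriv g) s = 0 := by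
    rw [(h2.deriv).deriv_eq]
    simp
  linarith

lemma fderiv_fderiv_nonpos_of_isLocalMax (hu : ContDiffOn ℝ ∞ u U) (hU : IsOpen U) (hz : z ∈ U)
    (hmax : IsLocalMax u z) (a : Fin n → ℂ) :
    fderiv ℝ (fun w => fderiv ℝ u w a) z a ≤ 0 := by
  set l : ℝ → (Fin n → ℂ) := fun s => z + s • a with hl
  have hl' : ∀ s, HasDerivAt l a s := fun s => by
    have := ((hasDerivAt_id s).smul_const a).const_add z
    rw [one_smul] at this
    exact this
  have hl0 : l 0 = z := by simp [hl]
  have hlc : ContinuousAt l 0 := (hl' 0).continuousAt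
  have hz0 : U ∈ 𝓝 (l 0) := by rw [hl0]; exact hU.mem_nhds hz
  have hmax' : IsLocalMax (fun s => u (l s)) 0 := by
    have : ∀ᶠ w in 𝓝 (l 0), u w ≤ u (l 0) := by rw [hl0]; exact hmax
    exact hlc.eventually this
  have h1 : deriv (fun s => u (l s)) =ᶠ[𝓝 0] fun s => fderiv ℝ u (l s) a := by
    filter_upwards [hlc.eventually hz0] with s hs
    exact ((ContDiffOn.differentiableAt_of_isOpen hu hU hs).hasFDerivAt.comp_hasDerivAt s
      (hl' s)).deriv
  have hd : DifferentiableAt ℝ (fun w => fderiv ℝ u w a) (l 0) :=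
    (ContDiffOn.differentiableAt_of_isOpen (hu.fderiv_of_isOpen hU (by simp)) hU
      (hl0 ▸ hz)).clm_apply (differentiableAt_const a)
  have h2 : deriv (deriv fun s => u (l s)) 0 = fderiv ℝ (fun w => fderiv ℝ u w a) z a := by
    have h3 : deriv (fun s => fderiv ℝ u (l s) a) 0 = _ :=
      (hd.hasFDerivAt.comp_hasDerivAt 0 (hl' 0)).deriv
    rw [h1.deriv_eq, h3, hl0]
  rw [← h2]
  refine deriv_deriv_nonpos_of_isLocalMax hmax' ?_
  exact ((ContDiffOn.differentiableAt_of_isOpen hu hU (hl0 ▸ hz)).continuousAt).comp hlc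

lemma fderiv_ofReal_comp (hu : DifferentiableAt ℝ u z) (a : Fin n → ℂ) :
    fderiv ℝ (fun w => (u w : ℂ)) z a = ((fderiv ℝ u z a : ℝ) : ℂ) := by
  have h2 : fderiv ℝ (fun w => (u w : ℂ)) z = _ :=
    (Complex.ofRealCLM.hasFDerivAt.comp z hu.hasFDerivAt).fderiv
  rw [h2]
  simp

lemma dz_eq_zero_of_isLocalMax (hmax : IsLocalMax u z) (hu : DifferentiableAt ℝ u z)
    (i : Fin n) : dz i (fun w => (u w : ℂ)) z = 0 := by
  simp [dz, fderiv_ofReal_comp hu, hmax.fderiv_eq_zero]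

/-- `∂∂̄` in one complex direction is a quarter of the Laplacian. -/
lemma complexHessian_diag_eq (hu : ContDiffOn ℝ ∞ u U) (hU : IsOpen U) (hz : z ∈ U)
    (i : Fin n) : complexHessian u z i i = ((1 / 4 * (
      fderiv ℝ (fun w => fderiv ℝ u w (Pi.single i 1)) z (Pi.single i 1) +
      fderiv ℝ (fun w => fderiv ℝ u w (Pi.single i Complex.I)) z (Pi.single i Complex.I)) : ℝ) :
        ℂ) := by
  have hu' := ContDiffOn.ofReal hu
  have h1 : ∀ a b : Fin n → ℂ, fderiv ℝ (fun w => fderiv ℝ (fun w => (u w : ℂ)) w a) z b =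
      ((fderiv ℝ (fun w => fderiv ℝ u w a) z b : ℝ) : ℂ) := fun a b => by
    have h2 : (fun w => fderiv ℝ (fun w => (u w : ℂ)) w a) =ᶠ[𝓝 z]
        fun w => ((fderiv ℝ u w a : ℝ) : ℂ) := by
      filter_upwards [hU.mem_nhds hz] with w hw
      exact fderiv_ofReal_comp (ContDiffOn.differentiableAt_of_isOpen hu hU hw) a
    rw [h2.fderiv_eq]
    exact fderiv_ofReal_comp ((ContDiffOn.differentiableAt_of_isOpen
      (hu.fderiv_of_isOpen hU (by simp)) hU hz).clm_apply (differentiableAt_const a)) b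
  have hsymm := fderiv_fderiv_comm hu' hU hz (Pi.single i 1) (Pi.single i Complex.I)
  simp only [complexHessian, of_apply]
  change (1 / 2 : ℂ) * (fderiv ℝ (dzbar i _) z _ - _ * fderiv ℝ (dzbar i _) z _) = _
  rw [fderiv_dzbar hu' hU hz, fderiv_dzbar hu' hU hz, hsymm]
  simp only [h1]
  push_cast
  linear_combination (-(1 / 4 : ℂ) *
    (fderiv ℝ (fun w => fderiv ℝ u w (Pi.single i Complex.I)) z (Pi.single i Complex.I) : ℝ)) *
      Complex.I_mul_I

lemma complexHessian_diag_re_nonpos_of_isLocalMax (hu : ContDiffOn ℝ ∞ u U) (hU : IsOpen U)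
    (hz : z ∈ U) (hmax : IsLocalMax u z) (i : Fin n) : (complexHessian u z i i).re ≤ 0 := by
  rw [complexHessian_diag_eq hu hU hz, Complex.ofReal_re]
  have h1 := fderiv_fderiv_nonpos_of_isLocalMax hu hU hz hmax (Pi.single i 1)
  have h2 := fderiv_fderiv_nonpos_of_isLocalMax hu hU hz hmax (Pi.single i Complex.I)
  linarith

lemma complexHessian_diag_im (hu : ContDiffOn ℝ ∞ u U) (hU : IsOpen U)
    (hz : z ∈ U) (i : Fin n) : (complexHessian u z i i).im = 0 := by
  rw [complexHessian_diag_eq hu hU hz, Complex.ofReal_im]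

lemma jacobian_const_add_mulVec (c : Fin n → ℂ) (P : Matrix (Fin n) (Fin n) ℂ)
    (w : Fin n → ℂ) : jacobian (fun w => c + P *ᵥ w) w = P := by
  have h : HasFDerivAt (fun w => c + P *ᵥ w) (LinearMap.toContinuousLinearMap (mulVecLin P)) w :=
    (LinearMap.toContinuousLinearMap (mulVecLin P)).hasFDerivAt.const_add c
  ext b i
  simp [jacobian, h.fderiv]

/-- The complex Hessian at a local maximum is negative semidefinite. -/
lemma complexHessian_posSemidef_of_isLocalMax (hu : ContDiffOn ℝ ∞ u U) (hU : IsOpen U)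
    (hz : z ∈ U) (hmax : IsLocalMax u z) : (-complexHessian u z).PosSemidef := by
  have hH := complexHessian_isHermitian hu hU hz
  refine PosSemidef.of_dotProduct_mulVec_nonneg hH.neg fun x => ?_
  rcases Nat.eq_zero_or_pos n with hn | hn
  · subst hn
    simp [dotProduct]
  set i₀ : Fin n := ⟨0, hn⟩
  -- Pull back along the affine map whose differential sends every basis vector to `conj x`.
  set P : Matrix (Fin n) (Fin n) ℂ := Matrix.of fun b _ => conj (x b) with hP
  set φ : (Fin n → ℂ) → (Fin n → ℂ) := fun w => z + P *ᵥ w with hφ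
  have hφc : ContDiff ℂ ∞ φ :=
    contDiff_const.add (LinearMap.toContinuousLinearMap (mulVecLin P)).contDiff
  have hφ0 : φ 0 = z := by simp [hφ]
  have hopen : IsOpen (φ ⁻¹' U) := hU.preimage hφc.continuous
  have h0 : (0 : Fin n → ℂ) ∈ φ ⁻¹' U := by simpa [hφ0] using hz
  have hmax' : IsLocalMax (fun w => u (φ w)) 0 := by
    have : ∀ᶠ w in 𝓝 (φ 0), u w ≤ u (φ 0) := by rw [hφ0]; exact hmax
    exact hφc.continuous.continuousAt.eventually this
  have hsm : ContDiffOn ℝ ∞ (fun w => u (φ w)) (φ ⁻¹' U) :=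
    hu.comp (hφc.restrict_scalars ℝ).contDiffOn fun _ hw => hw
  have h1 := complexHessian_diag_re_nonpos_of_isLocalMax hsm hopen h0 hmax' i₀
  have h1' := complexHessian_diag_im hsm hopen h0 i₀
  have hJ : jacobian φ 0 = P := jacobian_const_add_mulVec z P 0
  have h2 := complexHessian_comp_holomorphic hu hU hφc.contDiffOn hopen (fun _ hw => hw) h0
  have h3 : complexHessian (fun w => u (φ w)) 0 i₀ i₀ =
      star x ⬝ᵥ complexHessian u z *ᵥ x := by
    rw [h2, hJ, hφ0]
    simp only [Matrix.mul_apply, conjTranspose_apply, map_apply, hP, of_apply, dotProduct,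
      mulVec, Pi.star_apply, Finset.sum_mul, Finset.mul_sum, Complex.conj_conj]
    rw [Finset.sum_comm]
    exact Finset.sum_congr rfl fun a _ => Finset.sum_congr rfl fun b _ => by ring
  rw [neg_mulVec, dotProduct_neg, ← h3, Complex.nonneg_iff]
  simp [h1, h1']

/-- The first derivative of a composition with a real function of one variable. -/
lemma dz_comp_real {θ : ℝ → ℝ} {θ' : ℝ} (hθ : HasDerivAt θ θ' (u z))
    (hu : DifferentiableAt ℝ u z) (i : Fin n) :
    dz i (fun w => (θ (u w) : ℂ)) z = θ' * dz i (fun w => (u w : ℂ)) z := by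
  have h : HasFDerivAt (fun w => θ (u w)) (θ' • fderiv ℝ u z) z :=
    hθ.comp_hasFDerivAt z hu.hasFDerivAt
  simp only [dz, fderiv_ofReal_comp hu, fderiv_ofReal_comp h.differentiableAt, h.fderiv,
    _root_.smul_apply, smul_eq_mul]
  push_cast
  ring

/-- The diagonal of the complex Hessian of a composition with a real function of one variable. -/
lemma complexHessian_diag_comp_real {θ θ' : ℝ → ℝ} {θ'' : ℝ}
    (hθ : ∀ᶠ y in 𝓝 (u z), HasDerivAt θ (θ' y) y) (hθ' : HasDerivAt θ' θ'' (u z))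
    (hu : ContDiffOn ℝ ∞ u U) (hU : IsOpen U) (hz : z ∈ U) (i : Fin n) :
    (complexHessian (fun w => θ (u w)) z i i).re =
      θ'' * ‖dz i (fun w => (u w : ℂ)) z‖ ^ 2 + θ' (u z) * (complexHessian u z i i).re := by
  have hu' := ContDiffOn.ofReal hu
  have hd := ContDiffOn.differentiableAt_of_isOpen hu hU hz
  have hdb := ContDiffOn.differentiableAt_of_isOpen (ContDiffOn.dzbar hu' hU i) hU hz
  have h1 : dzbar i (fun w => (θ (u w) : ℂ)) =ᶠ[𝓝 z]
      fun w => (θ' (u w) : ℂ) * dzbar i (fun w => (u w : ℂ)) w := by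
    filter_upwards [hU.mem_nhds hz, hd.continuousAt.eventually hθ] with w hw hw'
    rw [dzbar_ofReal, dzbar_ofReal,
      dz_comp_real hw' (ContDiffOn.differentiableAt_of_isOpen hu hU hw)]
    simp
  have hd' : DifferentiableAt ℝ (fun w => (θ' (u w) : ℂ)) z :=
    Complex.ofRealCLM.differentiableAt.comp z (hθ'.differentiableAt.comp z hd)
  simp only [complexHessian, of_apply]
  rw [dz_congr h1, dz_mul hd' hdb, dz_comp_real hθ' hd, dzbar_ofReal]
  rw [mul_assoc, Complex.mul_conj', Complex.add_re, Complex.re_ofReal_mul, Complex.re_ofReal_mul]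
  norm_cast

end ComplexHessian

/-! ### Smooth dependence of slice derivatives on parameters -/

section Slices

variable {n : ℕ} {E : Type*} [NormedAddCommGroup E] [NormedSpace ℝ E]
  {D : Set (E × (Fin n → ℂ))} {Φ : E × (Fin n → ℂ) → ℂ}

/-- Derivatives of a slice are partial derivatives. The set `D` is open only in the second variable,
so as to include products with a half-open time interval. -/
lemma fderiv_slice_eq (hΦ : ContDiffOn ℝ ∞ Φ D)
    (hs : ∀ p ∈ D, ∀ᶠ w in 𝓝 p.2, (p.1, w) ∈ D) {p : E × (Fin n → ℂ)} (hp : p ∈ D)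
    (v : Fin n → ℂ) :
    fderiv ℝ (fun w => Φ (p.1, w)) p.2 v = fderivWithin ℝ Φ D p (0, v) := by
  have h1 : HasFDerivWithinAt Φ (fderivWithin ℝ Φ D p) D (p.1, p.2) :=
    ((hΦ p hp).differentiableWithinAt (by simp)).hasFDerivWithinAt
  have h2 : HasFDerivWithinAt (fun w : Fin n → ℂ => (p.1, w))
      (ContinuousLinearMap.inr ℝ E (Fin n → ℂ)) {w | (p.1, w) ∈ D} p.2 :=
    (hasFDerivAt_prodMk_right p.1 p.2).hasFDerivWithinAt
  have h3 := h1.comp p.2 h2 (fun _ hw => hw)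
  have h4 := h3.hasFDerivAt (hs p hp)
  have h5 : fderiv ℝ (fun w => Φ (p.1, w)) p.2 = _ := h4.fderiv
  rw [h5]
  simp

lemma contDiffOn_dz_slice (hΦ : ContDiffOn ℝ ∞ Φ D) (hD : UniqueDiffOn ℝ D)
    (hs : ∀ p ∈ D, ∀ᶠ w in 𝓝 p.2, (p.1, w) ∈ D) (k : Fin n) :
    ContDiffOn ℝ ∞ (fun p => dz k (fun w => Φ (p.1, w)) p.2) D := by
  have h : ContDiffOn ℝ ∞ (fderivWithin ℝ Φ D) D := hΦ.fderivWithin hD (by simp)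
  refine ContDiffOn.congr (f := fun p => (1 / 2 : ℂ) *
    (fderivWithin ℝ Φ D p (0, Pi.single k 1) -
      Complex.I * fderivWithin ℝ Φ D p (0, Pi.single k Complex.I))) ?_ fun p hp => ?_
  · exact contDiffOn_const.mul ((h.clm_apply contDiffOn_const).sub
      (contDiffOn_const.mul (h.clm_apply contDiffOn_const)))
  · simp only [dz, fderiv_slice_eq hΦ hs hp]

lemma contDiffOn_dzbar_slice (hΦ : ContDiffOn ℝ ∞ Φ D) (hD : UniqueDiffOn ℝ D)
    (hs : ∀ p ∈ D, ∀ᶠ w in 𝓝 p.2, (p.1, w) ∈ D) (k : Fin n) :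
    ContDiffOn ℝ ∞ (fun p => dzbar k (fun w => Φ (p.1, w)) p.2) D := by
  have h : ContDiffOn ℝ ∞ (fderivWithin ℝ Φ D) D := hΦ.fderivWithin hD (by simp)
  refine ContDiffOn.congr (f := fun p => (1 / 2 : ℂ) *
    (fderivWithin ℝ Φ D p (0, Pi.single k 1) +
      Complex.I * fderivWithin ℝ Φ D p (0, Pi.single k Complex.I))) ?_ fun p hp => ?_
  · exact contDiffOn_const.mul ((h.clm_apply contDiffOn_const).add
      (contDiffOn_const.mul (h.clm_apply contDiffOn_const)))
  · simp only [dzbar, fderiv_slice_eq hΦ hs hp]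

lemma contDiffOn_dz_dzbar_slice (hΦ : ContDiffOn ℝ ∞ Φ D) (hD : UniqueDiffOn ℝ D)
    (hs : ∀ p ∈ D, ∀ᶠ w in 𝓝 p.2, (p.1, w) ∈ D) (k l : Fin n) :
    ContDiffOn ℝ ∞ (fun p => dz k (dzbar l fun w => Φ (p.1, w)) p.2) D :=
  contDiffOn_dz_slice (contDiffOn_dzbar_slice hΦ hD hs l) hD hs k

omit [NormedSpace ℝ E] in
lemma exists_bound_at_origin {g : E × (Fin n → ℂ) → ℂ} (hg : ContinuousOn g D) {K : Set E}
    (hK : IsCompact K) (hKD : ∀ θ ∈ K, (θ, (0 : Fin n → ℂ)) ∈ D) :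
    ∃ C : ℝ, ∀ θ ∈ K, ‖g (θ, 0)‖ ≤ C := by
  have hι : ContinuousOn (fun θ : E => (θ, (0 : Fin n → ℂ))) K := by fun_prop
  exact hK.exists_bound_of_continuousOn (hg.comp hι hKD)

/-- Derivatives at the origin of a smooth family of functions are bounded for parameters in a
compact set. -/
lemma exists_bound_slice_derivatives (hΦ : ContDiffOn ℝ ∞ Φ D) (hD : IsOpen D) {K : Set E}
    (hK : IsCompact K) (hKD : ∀ θ ∈ K, (θ, (0 : Fin n → ℂ)) ∈ D) :
    ∃ C : ℝ, ∀ θ ∈ K, ∀ k : Fin n, ‖dz k (fun w => Φ (θ, w)) 0‖ ≤ C ∧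
      ‖dz k (dzbar k fun w => Φ (θ, w)) 0‖ ≤ C := by
  have hs : ∀ p ∈ D, ∀ᶠ w in 𝓝 p.2, (p.1, w) ∈ D := fun p hp =>
    (Continuous.prodMk_right p.1).continuousAt.eventually (hD.mem_nhds hp)
  choose C₁ hC₁ using fun k => exists_bound_at_origin
    (contDiffOn_dz_slice hΦ hD.uniqueDiffOn hs k).continuousOn hK hKD
  choose C₂ hC₂ using fun k => exists_bound_at_origin
    (contDiffOn_dz_dzbar_slice hΦ hD.uniqueDiffOn hs k k).continuousOn hK hKD
  refine ⟨∑ k, (|C₁ k| + |C₂ k|), fun θ hθ k => ?_⟩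
  have h : |C₁ k| + |C₂ k| ≤ ∑ k, (|C₁ k| + |C₂ k|) :=
    Finset.single_le_sum (f := fun k => |C₁ k| + |C₂ k|) (fun k _ => by positivity)
      (Finset.mem_univ k)
  refine ⟨(hC₁ k θ hθ).trans (le_trans ?_ h), (hC₂ k θ hθ).trans (le_trans ?_ h)⟩
  · exact (le_abs_self _).trans (le_add_of_nonneg_right (abs_nonneg _))
  · exact (le_abs_self _).trans (le_add_of_nonneg_left (abs_nonneg _))

end Slices

section TimeDerivative

variable {n : ℕ} {D : Set (ℝ × (Fin n → ℂ))} {Φ : ℝ × (Fin n → ℂ) → ℂ}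

lemma hasDerivAt_time_slice (hΦ : ContDiffOn ℝ ∞ Φ D) (hD : IsOpen D)
    {p : ℝ × (Fin n → ℂ)} (hp : p ∈ D) :
    HasDerivAt (fun s => Φ (s, p.2)) (fderiv ℝ Φ p (1, 0)) p.1 := by
  have h1 : HasFDerivAt Φ (fderiv ℝ Φ p) (p.1, p.2) :=
    (ContDiffOn.differentiableAt_of_isOpen hΦ hD hp).hasFDerivAt
  exact h1.comp_hasDerivAt p.1 ((hasDerivAt_id p.1).prodMk (hasDerivAt_const p.1 p.2))

lemma fderiv_space_slice (hΦ : ContDiffOn ℝ ∞ Φ D) (hD : IsOpen D)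
    {p : ℝ × (Fin n → ℂ)} (hp : p ∈ D) (v : Fin n → ℂ) :
    fderiv ℝ (fun w => Φ (p.1, w)) p.2 v = fderiv ℝ Φ p (0, v) := by
  have hs : ∀ p ∈ D, ∀ᶠ w in 𝓝 p.2, (p.1, w) ∈ D := fun p hp =>
    (Continuous.prodMk_right p.1).continuousAt.eventually (hD.mem_nhds hp)
  rw [fderiv_slice_eq hΦ hs hp, fderivWithin_of_isOpen hD hp]

lemma hasDerivAt_fderiv_slice (hΦ : ContDiffOn ℝ ∞ Φ D) (hD : IsOpen D)
    {p : ℝ × (Fin n → ℂ)} (hp : p ∈ D) (v : Fin n → ℂ) :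
    HasDerivAt (fun s => fderiv ℝ (fun w => Φ (s, w)) p.2 v)
      (fderiv ℝ (fun w => deriv (fun s => Φ (s, w)) p.1) p.2 v) p.1 := by
  have hsm : ∀ a, ContDiffOn ℝ ∞ (fun q => fderiv ℝ Φ q a) D := fun a =>
    (hΦ.fderiv_of_isOpen hD (by simp)).clm_apply contDiffOn_const
  have h1 := hasDerivAt_time_slice (hsm (0, v)) hD hp
  have h2 : (fun s => fderiv ℝ (fun w => Φ (s, w)) p.2 v) =ᶠ[𝓝 p.1]
      fun s => fderiv ℝ Φ (s, p.2) (0, v) := by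
    have hc : ContinuousAt (fun s : ℝ => (s, p.2)) p.1 := by fun_prop
    filter_upwards [hc.eventually (hD.mem_nhds hp)] with s hs
    exact fderiv_space_slice hΦ hD (p := (s, p.2)) hs v
  have h3 : (fun w => deriv (fun s => Φ (s, w)) p.1) =ᶠ[𝓝 p.2]
      fun w => fderiv ℝ Φ (p.1, w) (1, 0) := by
    have hc : ContinuousAt (fun w : Fin n → ℂ => (p.1, w)) p.2 := by fun_prop
    filter_upwards [hc.eventually (hD.mem_nhds hp)] with w hw
    exact (hasDerivAt_time_slice hΦ hD (p := (p.1, w)) hw).deriv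
  rw [h3.fderiv_eq]
  have h4 := fderiv_space_slice (hsm (1, 0)) hD hp v
  rw [h4, ← fderiv_fderiv_comm hΦ hD hp]
  exact h1.congr_of_eventuallyEq h2

/-- The time derivative commutes with `∂`. -/
lemma hasDerivAt_dz_slice (hΦ : ContDiffOn ℝ ∞ Φ D) (hD : IsOpen D)
    {p : ℝ × (Fin n → ℂ)} (hp : p ∈ D) (k : Fin n) :
    HasDerivAt (fun s => dz k (fun w => Φ (s, w)) p.2)
      (dz k (fun w => deriv (fun s => Φ (s, w)) p.1) p.2) p.1 :=
  ((hasDerivAt_fderiv_slice hΦ hD hp _).sub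
    ((hasDerivAt_fderiv_slice hΦ hD hp _).const_mul _)).const_mul _

/-- The time derivative commutes with `∂̄`. -/
lemma hasDerivAt_dzbar_slice (hΦ : ContDiffOn ℝ ∞ Φ D) (hD : IsOpen D)
    {p : ℝ × (Fin n → ℂ)} (hp : p ∈ D) (k : Fin n) :
    HasDerivAt (fun s => dzbar k (fun w => Φ (s, w)) p.2)
      (dzbar k (fun w => deriv (fun s => Φ (s, w)) p.1) p.2) p.1 :=
  ((hasDerivAt_fderiv_slice hΦ hD hp _).add
    ((hasDerivAt_fderiv_slice hΦ hD hp _).const_mul _)).const_mul _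

lemma hasDerivAt_dz_dzbar_slice (hΦ : ContDiffOn ℝ ∞ Φ D) (hD : IsOpen D)
    {p : ℝ × (Fin n → ℂ)} (hp : p ∈ D) (k l : Fin n) :
    HasDerivAt (fun s => dz k (dzbar l fun w => Φ (s, w)) p.2)
      (dz k (dzbar l fun w => deriv (fun s => Φ (s, w)) p.1) p.2) p.1 := by
  have hs : ∀ p ∈ D, ∀ᶠ w in 𝓝 p.2, (p.1, w) ∈ D := fun p hp =>
    (Continuous.prodMk_right p.1).continuousAt.eventually (hD.mem_nhds hp)
  have h1 := hasDerivAt_dz_slice (contDiffOn_dzbar_slice hΦ hD.uniqueDiffOn hs l) hD hp k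
  have h2 : (fun w => deriv (fun s => dzbar l (fun w => Φ (s, w)) w) p.1) =ᶠ[𝓝 p.2]
      dzbar l fun w => deriv (fun s => Φ (s, w)) p.1 := by
    filter_upwards [hs p hp] with w hw
    exact (hasDerivAt_dzbar_slice hΦ hD (p := (p.1, w)) hw l).deriv
  rw [dz_congr h2] at h1
  exact h1

end TimeDerivative

/-! ### Derivatives of matrix-valued functions -/

section MatrixCalculus

variable {n : ℕ}

/-- A matrix-valued function has smooth entries on `U`. -/
def SmoothEntriesOn (A : (Fin n → ℂ) → Matrix (Fin n) (Fin n) ℂ) (U : Set (Fin n → ℂ)) : Prop :=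
  ∀ i j, ContDiffOn ℝ ∞ (fun w => A w i j) U

/-- The operator `∂/∂zₘ` applied to the entries of a matrix-valued function. -/
noncomputable def dzMatrix (m : Fin n) (A : (Fin n → ℂ) → Matrix (Fin n) (Fin n) ℂ)
    (z : Fin n → ℂ) : Matrix (Fin n) (Fin n) ℂ :=
  Matrix.of fun i j => dz m (fun w => A w i j) z

/-- The operator `∂/∂z̄ₘ` applied to the entries of a matrix-valued function. -/
noncomputable def dzbarMatrix (m : Fin n) (A : (Fin n → ℂ) → Matrix (Fin n) (Fin n) ℂ)
    (z : Fin n → ℂ) : Matrix (Fin n) (Fin n) ℂ :=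
  Matrix.of fun i j => dzbar m (fun w => A w i j) z

variable {U : Set (Fin n → ℂ)} {z : Fin n → ℂ}
  {A B : (Fin n → ℂ) → Matrix (Fin n) (Fin n) ℂ}

lemma SmoothEntriesOn.differentiableAt (hA : SmoothEntriesOn A U) (hU : IsOpen U) (hz : z ∈ U)
    (i j : Fin n) : DifferentiableAt ℝ (fun w => A w i j) z :=
  ContDiffOn.differentiableAt_of_isOpen (hA i j) hU hz

lemma SmoothEntriesOn.mul (hA : SmoothEntriesOn A U) (hB : SmoothEntriesOn B U) :
    SmoothEntriesOn (fun w => A w * B w) U := fun i j => by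
  simp only [Matrix.mul_apply]
  exact ContDiffOn.sum fun k _ => (hA i k).mul (hB k j)

lemma SmoothEntriesOn.dzbarMatrix (hA : SmoothEntriesOn A U) (hU : IsOpen U) (m : Fin n) :
    SmoothEntriesOn (dzbarMatrix m A) U := fun i j => ContDiffOn.dzbar (hA i j) hU m

lemma SmoothEntriesOn.det {ι : Type*} [Fintype ι] [DecidableEq ι]
    {A : (Fin n → ℂ) → Matrix ι ι ℂ} (hA : ∀ i j, ContDiffOn ℝ ∞ (fun w => A w i j) U) :
    ContDiffOn ℝ ∞ (fun w => (A w).det) U := by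
  simp only [det_apply']
  exact ContDiffOn.sum fun σ _ => contDiffOn_const.mul (contDiffOn_prod fun i _ => hA _ _)

lemma SmoothEntriesOn.inv (hA : SmoothEntriesOn A U) (hdet : ∀ w ∈ U, (A w).det ≠ 0) :
    SmoothEntriesOn (fun w => (A w)⁻¹) U := fun i j => by
  simp only [Matrix.inv_def, Matrix.smul_apply, Ring.inverse_eq_inv', smul_eq_mul, adjugate_apply]
  refine ((SmoothEntriesOn.det hA).inv hdet).mul (SmoothEntriesOn.det fun a b => ?_)
  by_cases h : a = j
  · subst h
    simpa using contDiffOn_const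
  · simpa [updateRow_ne h] using hA a b

lemma dzMatrix_congr (h : ∀ᶠ w in 𝓝 z, A w = B w) (m : Fin n) :
    dzMatrix m A z = dzMatrix m B z := by
  ext i j
  exact dz_congr (h.mono fun w hw => by simp only [hw]) m

lemma dzMatrix_mul (hA : ∀ i j, DifferentiableAt ℝ (fun w => A w i j) z)
    (hB : ∀ i j, DifferentiableAt ℝ (fun w => B w i j) z) (m : Fin n) :
    dzMatrix m (fun w => A w * B w) z = dzMatrix m A z * B z + A z * dzMatrix m B z := by
  ext i j
  simp only [dzMatrix, of_apply, Matrix.add_apply, Matrix.mul_apply]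
  rw [dz_sum _ fun k _ => (hA i k).fun_mul (hB k j), ← Finset.sum_add_distrib]
  exact Finset.sum_congr rfl fun k _ => dz_mul (hA i k) (hB k j) m

lemma dzbarMatrix_mul (hA : ∀ i j, DifferentiableAt ℝ (fun w => A w i j) z)
    (hB : ∀ i j, DifferentiableAt ℝ (fun w => B w i j) z) (m : Fin n) :
    dzbarMatrix m (fun w => A w * B w) z = dzbarMatrix m A z * B z + A z * dzbarMatrix m B z := by
  ext i j
  simp only [dzbarMatrix, of_apply, Matrix.add_apply, Matrix.mul_apply]
  rw [dzbar_sum _ fun k _ => (hA i k).fun_mul (hB k j), ← Finset.sum_add_distrib]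
  exact Finset.sum_congr rfl fun k _ => dzbar_mul (hA i k) (hB k j) m

lemma dzMatrix_add (hA : ∀ i j, DifferentiableAt ℝ (fun w => A w i j) z)
    (hB : ∀ i j, DifferentiableAt ℝ (fun w => B w i j) z) (m : Fin n) :
    dzMatrix m (fun w => A w + B w) z = dzMatrix m A z + dzMatrix m B z := by
  ext i j
  exact dz_add (hA i j) (hB i j) m

lemma dzMatrix_neg (hA : ∀ i j, DifferentiableAt ℝ (fun w => A w i j) z) (m : Fin n) :
    dzMatrix m (fun w => -A w) z = -dzMatrix m A z := by
  ext i j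
  have := dz_const_mul (-1) (hA i j) m
  simpa [dzMatrix] using this

lemma dzMatrix_inv (hA : SmoothEntriesOn A U) (hU : IsOpen U)
    (hdet : ∀ w ∈ U, (A w).det ≠ 0) (hz : z ∈ U) (m : Fin n) :
    dzMatrix m (fun w => (A w)⁻¹) z = -((A z)⁻¹ * dzMatrix m A z * (A z)⁻¹) := by
  have hZ := SmoothEntriesOn.inv hA hdet
  have h1 := dzMatrix_mul (hZ.differentiableAt hU hz) (hA.differentiableAt hU hz) m
  have h2 : dzMatrix m (fun w => (A w)⁻¹ * A w) z = 0 := by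
    rw [dzMatrix_congr (B := fun _ => 1)]
    · ext i j
      exact dz_const _ m
    · filter_upwards [hU.mem_nhds hz] with w hw
      exact nonsing_inv_mul _ (isUnit_iff_ne_zero.2 (hdet w hw))
  rw [h2] at h1
  have h3 := congrArg (· * (A z)⁻¹) h1
  simp only [Matrix.zero_mul, Matrix.add_mul, Matrix.mul_assoc] at h3
  rw [mul_nonsing_inv _ (isUnit_iff_ne_zero.2 (hdet z hz)), Matrix.mul_one] at h3
  rw [Matrix.mul_assoc]
  exact eq_neg_of_add_eq_zero_left h3.symm

lemma dzbarMatrix_inv (hA : SmoothEntriesOn A U) (hU : IsOpen U)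
    (hdet : ∀ w ∈ U, (A w).det ≠ 0) (hz : z ∈ U) (m : Fin n) :
    dzbarMatrix m (fun w => (A w)⁻¹) z = -((A z)⁻¹ * dzbarMatrix m A z * (A z)⁻¹) := by
  have hZ := SmoothEntriesOn.inv hA hdet
  have h1 := dzbarMatrix_mul (hZ.differentiableAt hU hz) (hA.differentiableAt hU hz) m
  have h2 : dzbarMatrix m (fun w => (A w)⁻¹ * A w) z = 0 := by
    ext i j
    simp only [dzbarMatrix, of_apply, Matrix.zero_apply]
    rw [dzbar_congr (g := fun _ => (1 : Matrix (Fin n) (Fin n) ℂ) i j), dzbar_const]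
    filter_upwards [hU.mem_nhds hz] with w hw
    rw [nonsing_inv_mul _ (isUnit_iff_ne_zero.2 (hdet w hw))]
  rw [h2] at h1
  have h3 := congrArg (· * (A z)⁻¹) h1
  simp only [Matrix.zero_mul, Matrix.add_mul, Matrix.mul_assoc] at h3
  rw [mul_nonsing_inv _ (isUnit_iff_ne_zero.2 (hdet z hz)), Matrix.mul_one] at h3
  rw [Matrix.mul_assoc]
  exact eq_neg_of_add_eq_zero_left h3.symm

/-- The second derivative of the inverse of a matrix-valued function. -/
lemma dzMatrix_dzbarMatrix_inv (hA : SmoothEntriesOn A U) (hU : IsOpen U)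
    (hdet : ∀ w ∈ U, (A w).det ≠ 0) (hz : z ∈ U) (m : Fin n) :
    dzMatrix m (dzbarMatrix m fun w => (A w)⁻¹) z =
      (A z)⁻¹ * dzMatrix m A z * (A z)⁻¹ * dzbarMatrix m A z * (A z)⁻¹ +
      (A z)⁻¹ * dzbarMatrix m A z * (A z)⁻¹ * dzMatrix m A z * (A z)⁻¹ -
      (A z)⁻¹ * dzMatrix m (dzbarMatrix m A) z * (A z)⁻¹ := by
  have hZ := SmoothEntriesOn.inv hA hdet
  have hb := hA.dzbarMatrix hU m
  have hZb := hZ.mul hb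
  rw [dzMatrix_congr (B := fun w => -((A w)⁻¹ * dzbarMatrix m A w * (A w)⁻¹)),
    dzMatrix_neg ((hZb.mul hZ).differentiableAt hU hz),
    dzMatrix_mul (hZb.differentiableAt hU hz) (hZ.differentiableAt hU hz),
    dzMatrix_mul (hZ.differentiableAt hU hz) (hb.differentiableAt hU hz),
    dzMatrix_inv hA hU hdet hz]
  · noncomm_ring
  · filter_upwards [hU.mem_nhds hz] with w hw
    exact dzbarMatrix_inv hA hU hdet hw m

lemma dzbarMatrix_eq_conjTranspose (hA : ∀ᶠ w in 𝓝 z, (A w).IsHermitian) (m : Fin n) :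
    dzbarMatrix m A z = (dzMatrix m A z)ᴴ := by
  ext i j
  simp only [dzbarMatrix, dzMatrix, of_apply, conjTranspose_apply]
  rw [← starRingEnd_apply, ← dzbar_conj]
  refine dzbar_congr (hA.mono fun w hw => ?_) m
  simpa using (hw.apply i j).symm

lemma dz_trace (hA : ∀ i j, DifferentiableAt ℝ (fun w => A w i j) z) (m : Fin n) :
    dz m (fun w => (A w).trace) z = (dzMatrix m A z).trace := by
  simp only [Matrix.trace, Matrix.diag, dzMatrix, of_apply]
  exact dz_sum _ (fun k _ => hA k k) m

lemma dzbar_trace (hA : ∀ i j, DifferentiableAt ℝ (fun w => A w i j) z) (m : Fin n) :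
    dzbar m (fun w => (A w).trace) z = (dzbarMatrix m A z).trace := by
  simp only [Matrix.trace, Matrix.diag, dzbarMatrix, of_apply]
  exact dzbar_sum _ (fun k _ => hA k k) m

/-! ### Concavity of `-log tr_X G` -/

variable {X G : (Fin n → ℂ) → Matrix (Fin n) (Fin n) ℂ} {d : Fin n → ℝ}

lemma inv_diagonal_ofReal (hd : ∀ i, 0 < d i) :
    (diagonal fun i => (d i : ℂ))⁻¹ = diagonal fun i => (((d i)⁻¹ : ℝ) : ℂ) := by
  refine inv_eq_right_inv ?_
  rw [diagonal_mul_diagonal, ← diagonal_one]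
  congr 1
  ext i
  rw [← Complex.ofReal_mul, mul_inv_cancel₀ (hd i).ne', Complex.ofReal_one]

/-- First derivative of `tr_X G` at a point where `G = 1`, `dG = 0` and `X` is diagonal. -/
lemma dz_trace_inv_mul (hX : SmoothEntriesOn X U) (hG : SmoothEntriesOn G U) (hU : IsOpen U)
    (hz : z ∈ U) (hdet : ∀ w ∈ U, (X w).det ≠ 0) (hd : ∀ i, 0 < d i)
    (hXz : X z = diagonal fun i => (d i : ℂ)) (hGz : G z = 1) (m : Fin n)
    (hdG : dzMatrix m G z = 0) :
    dz m (fun w => ((X w)⁻¹ * G w).trace) z =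
      -∑ i, (((d i)⁻¹ ^ 2 : ℝ) : ℂ) * dzMatrix m X z i i := by
  have hZ := SmoothEntriesOn.inv hX hdet
  rw [dz_trace ((hZ.mul hG).differentiableAt hU hz), dzMatrix_mul (hZ.differentiableAt hU hz)
    (hG.differentiableAt hU hz), hdG, hGz, dzMatrix_inv hX hU hdet hz, hXz,
    inv_diagonal_ofReal hd]
  simp only [Matrix.mul_one, Matrix.mul_zero, add_zero, trace_neg]
  congr 1
  refine Finset.sum_congr rfl fun i _ => ?_
  rw [diag_apply, mul_diagonal, diagonal_mul]
  push_cast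
  ring

/-- Second derivative of `tr_X G` at a point where `G = 1`, `dG = 0` and `X` is diagonal. -/
lemma dz_dzbar_trace_inv_mul (hX : SmoothEntriesOn X U) (hG : SmoothEntriesOn G U)
    (hU : IsOpen U) (hz : z ∈ U) (hdet : ∀ w ∈ U, (X w).det ≠ 0)
    (hXH : ∀ w ∈ U, (X w).IsHermitian) (hd : ∀ i, 0 < d i)
    (hXz : X z = diagonal fun i => (d i : ℂ)) (hGz : G z = 1) (m : Fin n)
    (hdG : dzMatrix m G z = 0) (hdbG : dzbarMatrix m G z = 0) :
    dz m (dzbar m fun w => ((X w)⁻¹ * G w).trace) z =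
      ∑ i, ∑ j, (((d i)⁻¹ ^ 2 * (d j)⁻¹ * ‖dzMatrix m X z i j‖ ^ 2 : ℝ) : ℂ) +
      ∑ i, ∑ j, (((d i)⁻¹ ^ 2 * (d j)⁻¹ * ‖dzMatrix m X z j i‖ ^ 2 : ℝ) : ℂ) -
      ∑ i, (((d i)⁻¹ ^ 2 : ℝ) : ℂ) * dz m (dzbar m fun w => X w i i) z +
      ∑ i, (((d i)⁻¹ : ℝ) : ℂ) * dz m (dzbar m fun w => G w i i) z := by
  have hZ := SmoothEntriesOn.inv hX hdet
  have hZb := hZ.dzbarMatrix hU m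
  have hGb := hG.dzbarMatrix hU m
  have h1 : dzbar m (fun w => ((X w)⁻¹ * G w).trace) =ᶠ[𝓝 z]
      fun w => (dzbarMatrix m (fun w => (X w)⁻¹) w * G w +
        (X w)⁻¹ * dzbarMatrix m G w).trace := by
    filter_upwards [hU.mem_nhds hz] with w hw
    rw [dzbar_trace ((hZ.mul hG).differentiableAt hU hw),
      dzbarMatrix_mul (hZ.differentiableAt hU hw) (hG.differentiableAt hU hw)]
  have h2 : ∀ i j, DifferentiableAt ℝ (fun w => (dzbarMatrix m (fun w => (X w)⁻¹) w * G w +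
      (X w)⁻¹ * dzbarMatrix m G w) i j) z := fun i j =>
    ((hZb.mul hG).differentiableAt hU hz i j).add ((hZ.mul hGb).differentiableAt hU hz i j)
  have hb : dzbarMatrix m X z = (dzMatrix m X z)ᴴ :=
    dzbarMatrix_eq_conjTranspose (by filter_upwards [hU.mem_nhds hz] with w hw using hXH w hw) m
  rw [dz_congr h1, dz_trace h2, dzMatrix_add ((hZb.mul hG).differentiableAt hU hz)
    ((hZ.mul hGb).differentiableAt hU hz), dzMatrix_mul (hZb.differentiableAt hU hz)
    (hG.differentiableAt hU hz), dzMatrix_mul (hZ.differentiableAt hU hz)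
    (hGb.differentiableAt hU hz), hdG, hdbG, hGz, dzMatrix_dzbarMatrix_inv hX hU hdet hz, hXz,
    inv_diagonal_ofReal hd, hb]
  simp only [Matrix.mul_one, Matrix.mul_zero, add_zero, zero_add, trace_add, trace_sub]
  congr 1
  · congr 1
    · congr 1
      · refine Finset.sum_congr rfl fun i _ => ?_
        rw [diag_apply, mul_diagonal, Matrix.mul_apply, Finset.sum_mul]
        refine Finset.sum_congr rfl fun j _ => ?_
        rw [mul_diagonal, diagonal_mul, conjTranspose_apply, ← starRingEnd_apply]
        push_cast
        rw [← Complex.mul_conj']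
        ring
      · refine Finset.sum_congr rfl fun i _ => ?_
        rw [diag_apply, mul_diagonal, Matrix.mul_apply, Finset.sum_mul]
        refine Finset.sum_congr rfl fun j _ => ?_
        rw [mul_diagonal, diagonal_mul, conjTranspose_apply, ← starRingEnd_apply]
        push_cast
        rw [← Complex.mul_conj']
        ring
    · refine Finset.sum_congr rfl fun i _ => ?_
      rw [diag_apply, mul_diagonal, diagonal_mul]
      simp only [dzMatrix, dzbarMatrix, of_apply]
      push_cast
      ring
  · refine Finset.sum_congr rfl fun i _ => ?_
    rw [diag_apply, diagonal_mul]
    rfl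

/-- The Cauchy-Schwarz inequality with weights `1 / d i`, which makes the square of the first
derivative of `tr_X G` a part of its second derivative. -/
lemma norm_sum_sq_le (hd : ∀ i, 0 < d i) (a : Fin n → ℂ) :
    ‖∑ i, (((d i)⁻¹ ^ 2 : ℝ) : ℂ) * a i‖ ^ 2 ≤
      (∑ i, (d i)⁻¹) * ∑ i, (d i)⁻¹ ^ 2 * (d i)⁻¹ * ‖a i‖ ^ 2 := by
  have h1 : ‖∑ i, (((d i)⁻¹ ^ 2 : ℝ) : ℂ) * a i‖ ≤ ∑ i, (d i)⁻¹ ^ 2 * ‖a i‖ := by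
    refine (norm_sum_le _ _).trans (Finset.sum_le_sum fun i _ => ?_)
    rw [norm_mul, Complex.norm_real, Real.norm_of_nonneg (by positivity)]
  refine (pow_le_pow_left₀ (norm_nonneg _) h1 2).trans ?_
  refine Finset.sum_sq_le_sum_mul_sum_of_sq_le_mul _ (fun i _ => (inv_pos.2 (hd i)).le)
    (fun i _ => ?_) fun i _ => le_of_eq (by ring)
  have := (inv_pos.2 (hd i)).le
  positivity

/-- Lower bound for `∂ₘ∂_m̄ log tr_X G` at a point where `G = 1`, `dG = 0` and `X` is diagonal: the
concavity of `-log tr_X G` in `X`, with the quadratic term that controls the gradient of the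
largest eigenvalue kept. -/
lemma complexHessian_log_trace_ge (hX : SmoothEntriesOn X U) (hG : SmoothEntriesOn G U)
    (hU : IsOpen U) (hz : z ∈ U) (hXp : ∀ w ∈ U, (X w).PosDef) (hGp : ∀ w ∈ U, (G w).PosDef)
    (hXz : X z = diagonal fun i => (d i : ℂ)) (hGz : G z = 1) (m : Fin n)
    (hdG : dzMatrix m G z = 0) :
    (∑ i, (d i)⁻¹)⁻¹ * (∑ i, (d i)⁻¹ ^ 2 * (d m)⁻¹ * ‖dz m (fun w => X w i m) z‖ ^ 2 -
      ∑ i, (d i)⁻¹ ^ 2 * (dz m (dzbar m fun w => X w i i) z).re +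
      ∑ i, (d i)⁻¹ * (dz m (dzbar m fun w => G w i i) z).re) ≤
    (complexHessian (fun w => Real.log ((X w)⁻¹ * G w).trace.re) z m m).re := by
  have hn : 0 < n := m.pos
  have hdet : ∀ w ∈ U, (X w).det ≠ 0 := fun w hw => (hXp w hw).det_pos.ne'
  have hXH : ∀ w ∈ U, (X w).IsHermitian := fun w hw => (hXp w hw).isHermitian
  have hd : ∀ i, 0 < d i := fun i => by
    have h1 := hXp z hz
    rw [hXz, posDef_diagonal_iff] at h1
    exact_mod_cast h1 i
  have hZ := SmoothEntriesOn.inv hX hdet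
  set S : (Fin n → ℂ) → ℝ := fun w => ((X w)⁻¹ * G w).trace.re with hS
  have hSsm : ContDiffOn ℝ ∞ S U := by
    refine ContDiffOn.re ?_
    simp only [Matrix.trace, Matrix.diag]
    exact ContDiffOn.sum fun i _ => hZ.mul hG i i
  have hSz : S z = ∑ i, (d i)⁻¹ := by
    simp only [hS]
    rw [hXz, hGz, Matrix.mul_one, inv_diagonal_ofReal hd, trace_diagonal, ← Complex.ofReal_sum,
      Complex.ofReal_re]
  have hSpos : 0 < S z := trace_inv_mul_pos hn (hXp z hz) (hGp z hz)
  have hSc : (fun w => (S w : ℂ)) =ᶠ[𝓝 z] fun w => ((X w)⁻¹ * G w).trace := by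
    filter_upwards [hU.mem_nhds hz] with w hw
    exact (trace_inv_mul_eq_ofReal (hXp w hw) (hGp w hw)).symm
  have hdbG : dzbarMatrix m G z = 0 := by
    rw [dzbarMatrix_eq_conjTranspose (by
      filter_upwards [hU.mem_nhds hz] with w hw using (hGp w hw).isHermitian) m, hdG,
      conjTranspose_zero]
  have hlog := complexHessian_diag_comp_real (θ := Real.log) (θ' := fun y => y⁻¹)
    (θ'' := -(S z ^ 2)⁻¹) (u := S) (z := z)
    (by filter_upwards [lt_mem_nhds hSpos] with y hy using Real.hasDerivAt_log hy.ne')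
    (hasDerivAt_inv hSpos.ne') hSsm hU hz m
  rw [hlog]
  have h1 := dz_trace_inv_mul hX hG hU hz hdet hd hXz hGz m hdG
  have h2 := dz_dzbar_trace_inv_mul hX hG hU hz hdet hXH hd hXz hGz m hdG hdbG
  rw [← dz_congr hSc] at h1
  rw [← dz_congr (dzbar_eventuallyEq hSc m)] at h2
  have h3 : (complexHessian S z m m).re =
      ∑ i, ∑ j, (d i)⁻¹ ^ 2 * (d j)⁻¹ * ‖dzMatrix m X z i j‖ ^ 2 +
      ∑ i, ∑ j, (d i)⁻¹ ^ 2 * (d j)⁻¹ * ‖dzMatrix m X z j i‖ ^ 2 -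
      ∑ i, (d i)⁻¹ ^ 2 * (dz m (dzbar m fun w => X w i i) z).re +
      ∑ i, (d i)⁻¹ * (dz m (dzbar m fun w => G w i i) z).re := by
    have : complexHessian S z m m = dz m (dzbar m fun w => (S w : ℂ)) z := rfl
    rw [this, h2]
    simp only [Complex.add_re, Complex.sub_re, Complex.re_sum, Complex.ofReal_re,
      Complex.re_ofReal_mul]
  rw [h3, h1, norm_neg, hSz]
  have h4 := norm_sum_sq_le hd fun i => dzMatrix m X z i i
  rw [← hSz] at h4 ⊢
  have h5 : ∑ i, (d i)⁻¹ ^ 2 * (d i)⁻¹ * ‖dzMatrix m X z i i‖ ^ 2 ≤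
      ∑ i, ∑ j, (d i)⁻¹ ^ 2 * (d j)⁻¹ * ‖dzMatrix m X z j i‖ ^ 2 :=
    Finset.sum_le_sum fun i _ => Finset.single_le_sum
      (f := fun j => (d i)⁻¹ ^ 2 * (d j)⁻¹ * ‖dzMatrix m X z j i‖ ^ 2)
      (fun j _ => by have := hd i; have := hd j; positivity) (Finset.mem_univ i)
  have h6 : ∑ i, (d i)⁻¹ ^ 2 * (d m)⁻¹ * ‖dz m (fun w => X w i m) z‖ ^ 2 ≤
      ∑ i, ∑ j, (d i)⁻¹ ^ 2 * (d j)⁻¹ * ‖dzMatrix m X z i j‖ ^ 2 :=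
    Finset.sum_le_sum fun i _ => Finset.single_le_sum
      (f := fun j => (d i)⁻¹ ^ 2 * (d j)⁻¹ * ‖dzMatrix m X z i j‖ ^ 2)
      (fun j _ => by have := hd i; have := hd j; positivity) (Finset.mem_univ m)
  have h7 : (S z ^ 2)⁻¹ * ‖∑ i, (((d i)⁻¹ ^ 2 : ℝ) : ℂ) * dzMatrix m X z i i‖ ^ 2 ≤
      (S z)⁻¹ * ∑ i, ∑ j, (d i)⁻¹ ^ 2 * (d j)⁻¹ * ‖dzMatrix m X z j i‖ ^ 2 := by
    calc _ ≤ (S z ^ 2)⁻¹ * (S z * ∑ i, (d i)⁻¹ ^ 2 * (d i)⁻¹ * ‖dzMatrix m X z i i‖ ^ 2) := by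
          gcongr
      _ = (S z)⁻¹ * ∑ i, (d i)⁻¹ ^ 2 * (d i)⁻¹ * ‖dzMatrix m X z i i‖ ^ 2 := by
          field_simp
      _ ≤ _ := by gcongr
  have h8 := mul_le_mul_of_nonneg_left h6 (inv_pos.2 hSpos).le
  linarith

end MatrixCalculus

/-! ### The differential inequality at a maximum point -/

section Commutation

variable {n : ℕ} {U : Set (Fin n → ℂ)} {z : Fin n → ℂ} {f : (Fin n → ℂ) → ℂ}

/-- Commutation of fourth derivatives, for the terms `∂ᵢ∂_ī X_{mm̄}` and `∂ₘ∂_m̄ X_{iī}`. -/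
lemma dz_dzbar_dz_dzbar_comm (hf : ContDiffOn ℝ ∞ f U) (hU : IsOpen U) (hz : z ∈ U)
    (i m : Fin n) :
    dz i (dzbar i (dz m (dzbar m f))) z = dz m (dzbar m (dz i (dzbar i f))) z := by
  have hb := fun k => ContDiffOn.dzbar hf hU k
  have h1 : dzbar i (dz m (dzbar m f)) =ᶠ[𝓝 z] dz m (dzbar m (dzbar i f)) := by
    filter_upwards [hU.mem_nhds hz] with w hw
    rw [← dz_dzbar_comm (hb m) hU hw]
    refine dz_congr ?_ m
    filter_upwards [hU.mem_nhds hw] with y hy using dzbar_dzbar_comm hf hU hy i m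
  rw [dz_congr h1, dz_dz_comm (ContDiffOn.dzbar (hb i) hU m) hU hz]
  refine dz_congr ?_ m
  filter_upwards [hU.mem_nhds hz] with w hw using dz_dzbar_comm (hb i) hU hw i m

/-- For a Kähler metric, the second derivatives `∂ₘ∂_m̄ g_{iī}` and `∂ᵢ∂_ī g_{mm̄}` agree. -/
lemma dz_dzbar_diag_of_kahler {G : (Fin n → ℂ) → Matrix (Fin n) (Fin n) ℂ}
    (hG : SmoothEntriesOn G U) (hU : IsOpen U) (hz : z ∈ U)
    (hGH : ∀ w ∈ U, (G w).IsHermitian)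
    (hk : ∀ w ∈ U, ∀ i j k, dz k (fun w => G w i j) w = dz i (fun w => G w k j) w)
    (i m : Fin n) :
    dz m (dzbar m fun w => G w i i) z = dz i (dzbar i fun w => G w m m) z := by
  have hconj : ∀ a b, ∀ w ∈ U, ∀ k, dzbar k (fun w => G w a b) w =
      conj (dz k (fun w => G w b a) w) := fun a b w hw k => by
    rw [← dzbar_conj]
    refine dzbar_congr ?_ k
    filter_upwards [hU.mem_nhds hw] with y hy
    simpa using ((hGH y hy).apply a b).symm
  have h1 : dz m (fun w => G w i i) =ᶠ[𝓝 z] dz i fun w => G w m i := by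
    filter_upwards [hU.mem_nhds hz] with w hw using hk w hw i i m
  have h2 : dzbar m (fun w => G w m i) =ᶠ[𝓝 z] dzbar i fun w => G w m m := by
    filter_upwards [hU.mem_nhds hz] with w hw
    rw [hconj m i w hw, hconj m m w hw, hk w hw i m m]
  rw [dz_dzbar_comm (hG i i) hU hz, dzbar_congr h1, ← dz_dzbar_comm (hG m i) hU hz, dz_congr h2]

end Commutation

lemma HasDerivAt.nonneg_of_le_left {f : ℝ → ℝ} {f' t : ℝ} (hf : HasDerivAt f f' t)
    (h : ∀ᶠ s in 𝓝[<] t, f s ≤ f t) : 0 ≤ f' := by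
  have h1 : Tendsto (slope f t) (𝓝[<] t) (𝓝 f') :=
    (hasDerivAt_iff_tendsto_slope_left_right.1 hf).1
  refine ge_of_tendsto h1 ?_
  filter_upwards [h, self_mem_nhdsWithin] with s hs hst
  rw [slope_def_field]
  exact div_nonneg_of_nonpos (by linarith) (by linarith [Set.mem_Iio.1 hst])

/-- The algebra that combines the first- and second-order conditions at a maximum of
`log λ - A u + 1 / ψ`. In the application `e i = 1 / λᵢ` for the eigenvalues `λᵢ` of `X`, `m` is the
index of the largest one, `N i = |∂ᵢu|`, and the torsion of `X` enters through `K`. The gradient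
term it produces is absorbed by Young's inequality in the term `2 N² / ψ³`. -/
lemma maximum_algebra {n : ℕ} {m : Fin n} {e Hx Xi N Hg Hy Xm c : Fin n → ℝ}
    {S B K ψ HF HW ut xt : ℝ} (he : ∀ i, 0 < e i) (hS : S = ∑ i, e i) (hψ : 0 < ψ)
    (hB : 0 ≤ B) (hK : 0 ≤ K)
    (hXi : ∀ i, 0 ≤ Xi i) (hN : ∀ i, 0 ≤ N i)
    (hspace : ∀ i, Hx i * e m - B ^ 2 * N i ^ 2 - Hg i + 2 * N i ^ 2 / ψ ^ 3 - B * Hy i ≤ 0)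
    (htime : 0 ≤ e m * xt - B * ut) (hxt : xt = HF - HW)
    (hHW : S⁻¹ * (∑ i, e i ^ 2 * e m * Xi i ^ 2 - ∑ i, e i ^ 2 * Xm i + ∑ i, e i * Hg i) ≤ HW)
    (hHF : HF ≤ K) (hHx : ∀ i, Xm i - Hx i ≤ 2 * K)
    (hgrad : ∀ i, B * N i ≤ e m * (Xi i + 2 * K)) (hHg : ∀ i, |Hg i| ≤ K)
    (hHy : ∀ i, e i * (c i + Hy i) = 1) :
    0 ≤ 2 * K * e m + (2 * K * e m + K + 2 * K ^ 2 * e m ^ 2 * B ^ 2 * ψ ^ 3) *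
      (S⁻¹ * ∑ i, e i ^ 2) + B * (1 - ut - S⁻¹ * ∑ i, e i ^ 2 * c i) := by
  have hSpos : 0 < S := hS ▸ Finset.sum_pos (fun i _ => he i) ⟨m, Finset.mem_univ m⟩
  have hem := he m
  have key : ∀ i, -(e m * (e i ^ 2 * e m * Xi i ^ 2)) + e m * (e i ^ 2 * Xm i) -
      e m * (e i * Hg i) ≤
      (2 * K * e m + K + 2 * K ^ 2 * e m ^ 2 * B ^ 2 * ψ ^ 3) * e i ^ 2 + K * e m * e i +
        B * e i - B * (e i ^ 2 * c i) := fun i => by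
    have hei := he i
    have h1 : B ^ 2 * N i ^ 2 - e m ^ 2 * Xi i ^ 2 ≤ 4 * K * e m * B * N i := by
      have ha : 0 ≤ B * N i := mul_nonneg hB (hN i)
      have hb : 0 ≤ e m * Xi i := mul_nonneg hem.le (hXi i)
      have hc : B * N i ≤ e m * Xi i + 2 * K * e m := by linarith [hgrad i]
      rcases le_total (B * N i) (e m * Xi i) with h | h
      · have : (B * N i) ^ 2 ≤ (e m * Xi i) ^ 2 := pow_le_pow_left₀ ha h 2
        have h' : 0 ≤ 4 * K * e m * (B * N i) := by positivity
        nlinarith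
      · have : (B * N i - e m * Xi i) * (B * N i + e m * Xi i) ≤
            (2 * K * e m) * (2 * (B * N i)) := by
          apply mul_le_mul <;> nlinarith
        nlinarith
    have h2 : 4 * K * e m * B * N i ≤ 2 * N i ^ 2 / ψ ^ 3 +
        2 * K ^ 2 * e m ^ 2 * B ^ 2 * ψ ^ 3 := by
      have h3 : 0 ≤ 2 * (N i / ψ ^ 3 - K * e m * B) ^ 2 * ψ ^ 3 := by positivity
      have h4 : 2 * (N i / ψ ^ 3 - K * e m * B) ^ 2 * ψ ^ 3 = 2 * N i ^ 2 / ψ ^ 3 -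
          4 * K * e m * B * N i + 2 * K ^ 2 * e m ^ 2 * B ^ 2 * ψ ^ 3 := by
        field_simp
        ring
      linarith
    have h5 := hspace i
    have h6 : e m * Xm i ≤ e m * Hx i + e m * (2 * K) := by nlinarith [hHx i]
    -- multiply the spatial inequality by `e i ^ 2`
    have h7 : e m * Xm i - e m ^ 2 * Xi i ^ 2 ≤ 2 * K * e m + Hg i + B * Hy i +
        2 * K ^ 2 * e m ^ 2 * B ^ 2 * ψ ^ 3 := by linarith
    have h8 := mul_le_mul_of_nonneg_left h7 (sq_nonneg (e i))
    have h9 : e i ^ 2 * Hg i ≤ e i ^ 2 * K :=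
      mul_le_mul_of_nonneg_left ((le_abs_self _).trans (hHg i)) (sq_nonneg _)
    have h10 : -(e m * (e i * Hg i)) ≤ K * e m * e i := by
      have := mul_le_mul_of_nonneg_left ((neg_le_abs _).trans (hHg i)) (mul_pos hem hei).le
      linarith
    have h11 : e i ^ 2 * (B * Hy i) = B * e i - B * (e i ^ 2 * c i) := by
      have : e i ^ 2 * Hy i = e i - e i ^ 2 * c i := by linear_combination e i * hHy i
      linear_combination B * this
    linarith
  have hsum := Finset.sum_le_sum fun i (_ : i ∈ Finset.univ) => key i
  simp only [Finset.sum_add_distrib, Finset.sum_sub_distrib, Finset.sum_neg_distrib,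
    ← Finset.mul_sum] at hsum
  rw [← hS] at hsum
  have h12 := mul_le_mul_of_nonneg_left hsum (inv_pos.2 hSpos).le
  have h13 : S⁻¹ * S = 1 := inv_mul_cancel₀ hSpos.ne'
  have h14 := mul_le_mul_of_nonneg_left hHW hem.le
  have h15 := mul_le_mul_of_nonneg_left hHF hem.le
  rw [hxt] at htime
  have e1 : S⁻¹ * (K * e m * S) = K * e m := by linear_combination K * e m * h13
  have e2 : S⁻¹ * (B * S) = B := by linear_combination B * h13
  simp only [mul_add, mul_sub, mul_neg] at h12 h14 htime ⊢
  rw [e1, e2] at h12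
  linarith

section MaximumPoint

variable {n : ℕ} {U : Set (Fin n → ℂ)} {z : Fin n → ℂ}

lemma complexHessian_const (c : ℝ) : complexHessian (fun _ : Fin n → ℂ => c) z = 0 := by
  ext i j
  simp only [complexHessian, of_apply, Matrix.zero_apply]
  have : (dzbar j fun _ : Fin n → ℂ => (c : ℂ)) = fun _ => 0 := funext fun w => dzbar_const _ j
  rw [this, dz_const]

lemma contDiffOn_time_slice {n : ℕ} {u : ℝ × (Fin n → ℂ) → ℝ} {I : Set ℝ}
    {U : Set (Fin n → ℂ)} (hu : ContDiffOn ℝ ∞ u (I ×ˢ U)) {t : ℝ} (ht : t ∈ I) :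
    ContDiffOn ℝ ∞ (fun w => u (t, w)) U :=
  hu.comp (contDiff_prodMk_right t).contDiffOn fun _ hw => ⟨ht, hw⟩

/-- The entries of `χ + √-1 ∂∂̄u`. -/
lemma smoothEntriesOn_add_complexHessian {χ : (Fin n → ℂ) → Matrix (Fin n) (Fin n) ℂ}
    (hχ : SmoothEntriesOn χ U) (hU : IsOpen U) {u : (Fin n → ℂ) → ℝ}
    (hu : ContDiffOn ℝ ∞ u U) : SmoothEntriesOn (fun w => χ w + complexHessian u w) U :=
  fun i j => (hχ i j).add (ContDiffOn.dz (ContDiffOn.dzbar (ContDiffOn.ofReal hu) hU j) hU i)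

/-- First- and second-order conditions in space at a maximum point of
`log X_{mm̄} - log G_{mm̄} + θ(y)`, where `G = 1` and `dG = 0` at that point. -/
lemma space_conditions_at_max {x g y : (Fin n → ℂ) → ℝ} (hU : IsOpen U) (hz : z ∈ U)
    (hx : ContDiffOn ℝ ∞ x U) (hg : ContDiffOn ℝ ∞ g U) (hy : ContDiffOn ℝ ∞ y U)
    (hxp : ∀ w ∈ U, 0 < x w) (hgp : ∀ w ∈ U, 0 < g w) (hgz : g z = 1)
    {A m₀ : ℝ} (hm : ∀ w ∈ U, m₀ ≤ y w)
    (hmax : IsLocalMax (fun w => Real.log (x w) - Real.log (g w) - A * y w +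
      (y w - m₀ + 1)⁻¹) z) (i : Fin n) (hdg : dz i (fun w => (g w : ℂ)) z = 0) :
    dz i (fun w => (x w : ℂ)) z =
      ((x z * (A + ((y z - m₀ + 1) ^ 2)⁻¹) : ℝ) : ℂ) * dz i (fun w => (y w : ℂ)) z ∧
    -(x z ^ 2)⁻¹ * ‖dz i (fun w => (x w : ℂ)) z‖ ^ 2 + (x z)⁻¹ * (complexHessian x z i i).re -
      (complexHessian g z i i).re +
      2 / (y z - m₀ + 1) ^ 3 * ‖dz i (fun w => (y w : ℂ)) z‖ ^ 2 -
      (A + ((y z - m₀ + 1) ^ 2)⁻¹) * (complexHessian y z i i).re ≤ 0 := by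
  set θ : ℝ → ℝ := fun s => A * s - (s - m₀ + 1)⁻¹ with hθ
  set θ' : ℝ → ℝ := fun s => A + ((s - m₀ + 1) ^ 2)⁻¹ with hθ'
  have hψ : ∀ w ∈ U, 0 < y w - m₀ + 1 := fun w hw => by linarith [hm w hw]
  have hd1 : ∀ s, 0 < s - m₀ + 1 → HasDerivAt θ (θ' s) s := fun s hs => by
    have h1 : HasDerivAt (fun s : ℝ => s - m₀ + 1) 1 s :=
      ((hasDerivAt_id s).sub_const m₀).add_const 1
    have h2 : HasDerivAt θ (A * 1 - -1 / (s - m₀ + 1) ^ 2) s :=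
      ((hasDerivAt_id s).const_mul A).sub (h1.inv hs.ne')
    exact h2.congr_deriv (by simp only [hθ']; ring)
  have hd2 : HasDerivAt θ' (-2 / (y z - m₀ + 1) ^ 3) (y z) := by
    have h0 := hψ z hz
    have h1 : HasDerivAt (fun s : ℝ => s - m₀ + 1) 1 (y z) :=
      ((hasDerivAt_id (y z)).sub_const m₀).add_const 1
    have h2 : HasDerivAt (fun s : ℝ => (s - m₀ + 1) ^ 2) (2 * (y z - m₀ + 1)) (y z) :=
      (h1.pow 2).congr_deriv (by norm_num)
    have h3 : HasDerivAt θ' (-(2 * (y z - m₀ + 1)) / ((y z - m₀ + 1) ^ 2) ^ 2) (y z) :=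
      (h2.inv (pow_pos h0 2).ne').const_add A
    refine h3.congr_deriv ?_
    field_simp
  have hev : ∀ᶠ s in 𝓝 (y z), HasDerivAt θ (θ' s) s := by
    have : ∀ᶠ s in 𝓝 (y z), m₀ - 1 < s := lt_mem_nhds (by linarith [hm z hz])
    filter_upwards [this] with s hs using hd1 s (by linarith)
  have hlogx : ContDiffOn ℝ ∞ (fun w => Real.log (x w)) U := hx.log fun w hw => (hxp w hw).ne'
  have hlogg : ContDiffOn ℝ ∞ (fun w => Real.log (g w)) U := hg.log fun w hw => (hgp w hw).ne'
  have hθy : ContDiffOn ℝ ∞ (fun w => θ (y w)) U :=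
    (contDiffOn_const.mul hy).sub (((hy.sub contDiffOn_const).add contDiffOn_const).inv
      fun w hw => (hψ w hw).ne')
  have hlog : ∀ s : ℝ, 0 < s → ∀ᶠ r in 𝓝 s, HasDerivAt Real.log r⁻¹ r := fun s hs => by
    filter_upwards [lt_mem_nhds hs] with r hr using Real.hasDerivAt_log hr.ne'
  have hdx := ContDiffOn.differentiableAt_of_isOpen hx hU hz
  have hdg' := ContDiffOn.differentiableAt_of_isOpen hg hU hz
  have hdy := ContDiffOn.differentiableAt_of_isOpen hy hU hz
  have hmax' : IsLocalMax (fun w => Real.log (x w) - Real.log (g w) - θ (y w)) z := by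
    refine hmax.mono fun w hw => ?_
    simp only [hθ]
    linarith
  have hsm := (hlogx.sub hlogg).sub hθy
  have hD := fun {f : (Fin n → ℂ) → ℝ} (hf : ContDiffOn ℝ ∞ f U) =>
    ContDiffOn.differentiableAt_of_isOpen (ContDiffOn.ofReal hf) hU hz
  constructor
  · have h1 := dz_eq_zero_of_isLocalMax hmax'
      (ContDiffOn.differentiableAt_of_isOpen hsm hU hz) i
    simp only [Complex.ofReal_sub] at h1
    rw [dz_sub ((hD hlogx).fun_sub (hD hlogg)) (hD hθy), dz_sub (hD hlogx) (hD hlogg),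
      dz_comp_real (Real.hasDerivAt_log (hxp z hz).ne') hdx,
      dz_comp_real (Real.hasDerivAt_log (hgp z hz).ne') hdg',
      dz_comp_real hev.self_of_nhds hdy, hdg, mul_zero, sub_zero] at h1
    have hx0 : (x z : ℂ) ≠ 0 := by exact_mod_cast (hxp z hz).ne'
    have h2 := sub_eq_zero.1 h1
    rw [Complex.ofReal_inv, inv_mul_eq_iff_eq_mul₀ hx0] at h2
    rw [h2, Complex.ofReal_mul]
    ring
  · have h1 := complexHessian_diag_re_nonpos_of_isLocalMax hsm hU hz hmax' i
    rw [complexHessian_sub (hlogx.sub hlogg) hθy hU hz,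
      complexHessian_sub hlogx hlogg hU hz, Matrix.sub_apply, Matrix.sub_apply, Complex.sub_re,
      Complex.sub_re,
      complexHessian_diag_comp_real (hlog _ (hxp z hz)) (hasDerivAt_inv (hxp z hz).ne') hx hU hz,
      complexHessian_diag_comp_real (hlog _ (hgp z hz)) (hasDerivAt_inv (hgp z hz).ne') hg hU hz,
      complexHessian_diag_comp_real hev hd2 hy hU hz, hdg, hgz] at h1
    simp only [norm_zero] at h1
    have e1 : (-2 : ℝ) / (y z - m₀ + 1) ^ 3 = -(2 / (y z - m₀ + 1) ^ 3) := neg_div _ _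
    rw [e1] at h1
    simp only [hθ'] at h1
    linarith

variable {χ G : (Fin n → ℂ) → Matrix (Fin n) (Fin n) ℂ} {F : (Fin n → ℂ) → ℝ}
  {u : ℝ × (Fin n → ℂ) → ℝ} {a b t : ℝ} {d : Fin n → ℝ}

/-- The inequality at a maximum point `(t, z)` of
`log X_{mm̄} - log G_{mm̄} - A u + 1 / (u - m₀ + 1)`, in coordinates in which `G = 1`, `dG = 0` and
`X = χ + √-1 ∂∂̄u` is diagonal at the point. The constant `K` bounds the derivatives of `χ`, `G` and
`F` of order at most two. -/
theorem maximum_point_inequality (hU : IsOpen U) (hz : z ∈ U) (ht : t ∈ Set.Ioo a b)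
    (hχ : SmoothEntriesOn χ U) (hG : SmoothEntriesOn G U) (hF : ContDiffOn ℝ ∞ F U)
    (hu : ContDiffOn ℝ ∞ u (Set.Ioo a b ×ˢ U))
    (hXp : ∀ s ∈ Set.Ioo a b, ∀ w ∈ U,
      (χ w + complexHessian (fun w => u (s, w)) w).PosDef)
    (hGp : ∀ w ∈ U, (G w).PosDef)
    (heq : ∀ w ∈ U, HasDerivAt (fun s => u (s, w)) (Real.log n -
      Real.log ((χ w + complexHessian (fun w => u (t, w)) w)⁻¹ * G w).trace.re + F w) t)
    (hXz : χ z + complexHessian (fun w => u (t, w)) z = diagonal fun i => (d i : ℂ))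
    (hGz : G z = 1) (hdG : ∀ k, dzMatrix k G z = 0)
    (hkahler : ∀ w ∈ U, ∀ i j k, dz k (fun w => G w i j) w = dz i (fun w => G w k j) w)
    (m : Fin n) {A m₀ K : ℝ} (hA : 0 ≤ A)
    (hm : ∀ s ∈ Set.Ioo a b, ∀ w ∈ U, m₀ ≤ u (s, w))
    (hmaxspace : IsLocalMax (fun w =>
      Real.log (χ w m m + complexHessian (fun w => u (t, w)) w m m).re -
      Real.log (G w m m).re - A * u (t, w) + (u (t, w) - m₀ + 1)⁻¹) z)
    (hmaxtime : ∀ᶠ s in 𝓝[<] t,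
      Real.log (χ z m m + complexHessian (fun w => u (s, w)) z m m).re -
      Real.log (G z m m).re - A * u (s, z) + (u (s, z) - m₀ + 1)⁻¹ ≤
      Real.log (χ z m m + complexHessian (fun w => u (t, w)) z m m).re -
      Real.log (G z m m).re - A * u (t, z) + (u (t, z) - m₀ + 1)⁻¹)
    (hχ1 : ∀ i j k, ‖dz k (fun w => χ w i j) z‖ ≤ K)
    (hχ2 : ∀ i j k, ‖dz k (dzbar k fun w => χ w i j) z‖ ≤ K)
    (hG2 : ∀ i j k, ‖dz k (dzbar k fun w => G w i j) z‖ ≤ K)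
    (hF2 : ∀ k, ‖complexHessian F z k k‖ ≤ K) :
    0 ≤ 2 * K * (d m)⁻¹ + (2 * K * (d m)⁻¹ + K + 2 * K ^ 2 * (d m)⁻¹ ^ 2 *
        (A + ((u (t, z) - m₀ + 1) ^ 2)⁻¹) ^ 2 * (u (t, z) - m₀ + 1) ^ 3) *
        ((∑ i, (d i)⁻¹)⁻¹ * ∑ i, (d i)⁻¹ ^ 2) +
      (A + ((u (t, z) - m₀ + 1) ^ 2)⁻¹) *
        (1 - (Real.log n - Real.log (∑ i, (d i)⁻¹) + F z) -
          (∑ i, (d i)⁻¹)⁻¹ * ∑ i, (d i)⁻¹ ^ 2 * (χ z i i).re) := by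
  have hn : 0 < n := m.pos
  set X : ℝ → (Fin n → ℂ) → Matrix (Fin n) (Fin n) ℂ := fun s w =>
    χ w + complexHessian (fun w => u (s, w)) w with hXdef
  have hus : ∀ s ∈ Set.Ioo a b, ContDiffOn ℝ ∞ (fun w => u (s, w)) U := fun s hs =>
    contDiffOn_time_slice hu hs
  have hut := hus t ht
  have hutc := ContDiffOn.ofReal hut
  have hXsm := smoothEntriesOn_add_complexHessian hχ hU hut
  have hd : ∀ i, 0 < d i := fun i => by
    have h1 := hXp t ht z hz
    rw [hXz, posDef_diagonal_iff] at h1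
    exact_mod_cast h1 i
  have hSe : ((X t z)⁻¹ * G z).trace.re = ∑ i, (d i)⁻¹ := by
    rw [show X t z = _ from hXz, hGz, Matrix.mul_one, inv_diagonal_ofReal hd, trace_diagonal,
      ← Complex.ofReal_sum, Complex.ofReal_re]
  -- diagonal entries of positive definite matrices are positive reals
  have hdiag : ∀ {P : Matrix (Fin n) (Fin n) ℂ}, P.PosDef →
      0 < (P m m).re ∧ (((P m m).re : ℝ) : ℂ) = P m m := fun {P} hP => by
    have h1 := Complex.pos_iff.1 (hP.diag_pos (i := m))
    exact ⟨h1.1, Complex.ext rfl (by simpa using h1.2)⟩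
  have hxre : ∀ s ∈ Set.Ioo a b, ∀ w ∈ U, (((X s w m m).re : ℝ) : ℂ) = X s w m m :=
    fun s hs w hw => (hdiag (hXp s hs w hw)).2
  have hxpos : ∀ s ∈ Set.Ioo a b, ∀ w ∈ U, 0 < (X s w m m).re :=
    fun s hs w hw => (hdiag (hXp s hs w hw)).1
  have hgre : ∀ w ∈ U, (((G w m m).re : ℝ) : ℂ) = G w m m := fun w hw => (hdiag (hGp w hw)).2
  have hxz : (X t z m m).re = d m := by
    rw [show X t z = _ from hXz]
    simp
  have hgz : (G z m m).re = 1 := by simp [hGz]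
  have hxc : (fun w => (((X t w m m).re : ℝ) : ℂ)) =ᶠ[𝓝 z] fun w => X t w m m := by
    filter_upwards [hU.mem_nhds hz] with w hw using hxre t ht w hw
  have hgc : (fun w => (((G w m m).re : ℝ) : ℂ)) =ᶠ[𝓝 z] fun w => G w m m := by
    filter_upwards [hU.mem_nhds hz] with w hw using hgre w hw
  have hspace := fun i => space_conditions_at_max hU hz (ContDiffOn.re (hXsm m m))
    (ContDiffOn.re (hG m m)) hut (hxpos t ht) (fun w hw => (hdiag (hGp w hw)).1) hgz
    (hm t ht) hmaxspace i (by
      rw [dz_congr hgc]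
      exact congrFun (congrFun (hdG i) m) m)
  have hψ : 0 < u (t, z) - m₀ + 1 := by linarith [hm t ht z hz]
  set ψ := u (t, z) - m₀ + 1 with hψdef
  set B := A + (ψ ^ 2)⁻¹ with hBdef
  have hB : 0 ≤ B := by positivity
  have hK : 0 ≤ K := (norm_nonneg _).trans (hF2 m)
  -- the second derivatives of the entries of `X`
  have hX2 : ∀ i k, dz k (dzbar k fun w => X t w i i) z =
      dz k (dzbar k fun w => χ w i i) z +
        dz k (dzbar k (dz i (dzbar i fun w => (u (t, w) : ℂ)))) z := fun i k => by
    have hH : ContDiffOn ℝ ∞ (dz i (dzbar i fun w => (u (t, w) : ℂ))) U :=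
      ContDiffOn.dz (ContDiffOn.dzbar hutc hU i) hU i
    rw [← dz_add (ContDiffOn.differentiableAt_of_isOpen (ContDiffOn.dzbar (hχ i i) hU k) hU hz)
      (ContDiffOn.differentiableAt_of_isOpen (ContDiffOn.dzbar hH hU k) hU hz)]
    refine dz_congr ?_ k
    filter_upwards [hU.mem_nhds hz] with w hw
    exact dzbar_add (ContDiffOn.differentiableAt_of_isOpen (hχ i i) hU hw)
      (ContDiffOn.differentiableAt_of_isOpen hH hU hw) k
  have hX1 : ∀ i j k, dz k (fun w => X t w i j) z =
      dz k (fun w => χ w i j) z + dz k (dz i (dzbar j fun w => (u (t, w) : ℂ))) z :=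
    fun i j k => by
      have hH : ContDiffOn ℝ ∞ (dz i (dzbar j fun w => (u (t, w) : ℂ))) U :=
        ContDiffOn.dz (ContDiffOn.dzbar hutc hU j) hU i
      exact dz_add (ContDiffOn.differentiableAt_of_isOpen (hχ i j) hU hz)
        (ContDiffOn.differentiableAt_of_isOpen hH hU hz) k
  have hHx : ∀ i, (complexHessian (fun w => (X t w m m).re) z i i).re =
      (dz i (dzbar i fun w => X t w m m) z).re := fun i => by
    simp only [complexHessian, of_apply]
    rw [dz_congr (dzbar_eventuallyEq hxc i)]
  have hHg : ∀ i, (complexHessian (fun w => (G w m m).re) z i i).re =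
      (dz m (dzbar m fun w => G w i i) z).re := fun i => by
    simp only [complexHessian, of_apply]
    rw [dz_congr (dzbar_eventuallyEq hgc i), dz_dzbar_diag_of_kahler hG hU hz
      (fun w hw => (hGp w hw).isHermitian) hkahler i m]
  -- the time derivative of `X`
  set ut : (Fin n → ℂ) → ℝ := fun w => deriv (fun s => u (s, w)) t with hutdef
  set S : (Fin n → ℂ) → ℝ := fun w => ((X t w)⁻¹ * G w).trace.re with hSdef
  have hSpos : ∀ w ∈ U, 0 < S w := fun w hw => trace_inv_mul_pos hn (hXp t ht w hw) (hGp w hw)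
  have hSsm : ContDiffOn ℝ ∞ (fun w => Real.log (S w)) U := by
    refine ContDiffOn.log (ContDiffOn.re ?_) fun w hw => (hSpos w hw).ne'
    simp only [Matrix.trace, Matrix.diag]
    exact ContDiffOn.sum fun i _ => (SmoothEntriesOn.inv hXsm
      fun w hw => (hXp t ht w hw).det_pos.ne').mul hG i i
  have hutH : complexHessian ut z m m = complexHessian F z m m -
      complexHessian (fun w => Real.log (S w)) z m m := by
    have h1 : ut =ᶠ[𝓝 z] fun w => F w - (Real.log (S w) - Real.log n) := by
      filter_upwards [hU.mem_nhds hz] with w hw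
      rw [hutdef]
      simp only [(heq w hw).deriv]
      ring
    rw [complexHessian_congr h1, complexHessian_sub hF (hSsm.sub contDiffOn_const) hU hz,
      complexHessian_sub hSsm contDiffOn_const hU hz, complexHessian_const]
    simp
  have hxt : HasDerivAt (fun s => (X s z m m).re) (complexHessian ut z m m).re t := by
    have hopen : IsOpen (Set.Ioo a b ×ˢ U) := isOpen_Ioo.prod hU
    have h1 := hasDerivAt_dz_dzbar_slice (ContDiffOn.ofReal hu) hopen (p := (t, z)) ⟨ht, hz⟩ m m
    have h2 : (fun w => deriv (fun s => (u (s, w) : ℂ)) t) =ᶠ[𝓝 z] fun w => (ut w : ℂ) := by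
      filter_upwards [hU.mem_nhds hz] with w hw
      have h3 := heq w hw
      simp only [hutdef]
      rw [h3.deriv]
      exact h3.ofReal_comp.deriv
    simp only at h1
    rw [dz_congr (dzbar_eventuallyEq h2 m)] at h1
    have h4 := (h1.const_add (χ z m m))
    exact Complex.reCLM.hasFDerivAt.comp_hasDerivAt t h4
  have hutz : ut z = Real.log n - Real.log (∑ i, (d i)⁻¹) + F z := by
    rw [← hSe]
    exact (heq z hz).deriv
  have htime : 0 ≤ (d m)⁻¹ * (complexHessian ut z m m).re - B * ut z := by
    have hu1 : HasDerivAt (fun s => u (s, z)) (ut z) t := (heq z hz).differentiableAt.hasDerivAt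
    have h1 : HasDerivAt (fun s => u (s, z) - m₀ + 1) (ut z) t :=
      (hu1.sub_const m₀).add_const 1
    have h2 := (((hxt.log (hxpos t ht z hz).ne').sub_const (Real.log (G z m m).re)).sub
      (hu1.const_mul A)).add (h1.inv hψ.ne')
    have h3 := HasDerivAt.nonneg_of_le_left h2 hmaxtime
    rw [hxz] at h3
    have e1 : (d m)⁻¹ * (complexHessian ut z m m).re - B * ut z =
        (complexHessian ut z m m).re / d m - A * ut z + -ut z / (u (t, z) - m₀ + 1) ^ 2 := by
      rw [hBdef, hψdef]
      ring
    rw [e1]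
    exact h3
  have hlower := complexHessian_log_trace_ge hXsm hG hU hz (hXp t ht) hGp hXz hGz m (hdG m)
  rw [← hutz]
  refine maximum_algebra (e := fun i => (d i)⁻¹)
    (Hx := fun i => (dz i (dzbar i fun w => X t w m m) z).re)
    (Xi := fun i => ‖dz m (fun w => X t w i m) z‖)
    (N := fun i => ‖dz i (fun w => (u (t, w) : ℂ)) z‖)
    (Hg := fun i => (dz m (dzbar m fun w => G w i i) z).re)
    (Hy := fun i => (complexHessian (fun w => u (t, w)) z i i).re)
    (Xm := fun i => (dz m (dzbar m fun w => X t w i i) z).re)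
    (c := fun i => (χ z i i).re)
    (fun i => inv_pos.2 (hd i)) rfl hψ hB hK (fun i => norm_nonneg _) (fun i => norm_nonneg _)
    (fun i => ?_) htime (by rw [hutH, Complex.sub_re]) hlower
    ((Complex.re_le_norm _).trans (hF2 m)) (fun i => ?_) (fun i => ?_) (fun i => ?_) fun i => ?_
  · have h1 := (hspace i).2
    rw [(hspace i).1, norm_mul, Complex.norm_real, Real.norm_eq_abs, mul_pow, sq_abs, hxz,
      hHx i, hHg i] at h1
    have hdm := (hd m).ne'
    have e1 : -(d m ^ 2)⁻¹ * ((d m * B) ^ 2 * ‖dz i (fun w => (u (t, w) : ℂ)) z‖ ^ 2) =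
        -(B ^ 2 * ‖dz i (fun w => (u (t, w) : ℂ)) z‖ ^ 2) := by
      field_simp
    rw [e1] at h1
    have e2 : 2 * ‖dz i (fun w => (u (t, w) : ℂ)) z‖ ^ 2 / ψ ^ 3 =
        2 / ψ ^ 3 * ‖dz i (fun w => (u (t, w) : ℂ)) z‖ ^ 2 := by ring
    rw [e2]
    linarith
  · rw [hX2 i m, hX2 m i, dz_dzbar_dz_dzbar_comm hutc hU hz i m, Complex.add_re, Complex.add_re]
    have h1 := (abs_le.1 ((Complex.abs_re_le_norm _).trans (hχ2 i i m))).2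
    have h2 := (abs_le.1 ((Complex.abs_re_le_norm _).trans (hχ2 m m i))).1
    linarith
  · have h1 := (hspace i).1
    rw [dz_congr hxc] at h1
    have h2 := congrArg norm h1
    rw [norm_mul, Complex.norm_real, Real.norm_eq_abs, hxz,
      abs_of_nonneg (mul_nonneg (hd m).le hB)] at h2
    have h3 : dz i (fun w => X t w m m) z = dz m (fun w => X t w i m) z +
        (dz i (fun w => χ w m m) z - dz m (fun w => χ w i m) z) := by
      rw [hX1 m m i, hX1 i m m, dz_dz_comm (ContDiffOn.dzbar hutc hU m) hU hz i m]
      ring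
    have h4 : ‖dz i (fun w => X t w m m) z‖ ≤ ‖dz m (fun w => X t w i m) z‖ + 2 * K := by
      rw [h3]
      refine (norm_add_le _ _).trans (add_le_add le_rfl ((norm_sub_le _ _).trans ?_))
      linarith [hχ1 m m i, hχ1 i m m]
    rw [h2] at h4
    rw [inv_mul_eq_div, le_div_iff₀ (hd m)]
    linarith
  · exact (Complex.abs_re_le_norm _).trans (hG2 i i m)
  · have h1 : (χ z i i).re + (complexHessian (fun w => u (t, w)) z i i).re = d i := by
      have h2 := congrArg Complex.re (congrFun (congrFun hXz i) i)
      simpa using h2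
    rw [h1, inv_mul_cancel₀ (hd i).ne']

end MaximumPoint

/-! ### Coefficients of metrics in charts -/

section Charts

variable {n : ℕ} {M : Type*} [TopologicalSpace M] [ChartedSpace (Fin n → ℂ) M]

/-- A Hermitian metric at a point, as a function on the model space `ℂⁿ`, to which every tangent
space is identified by definition. -/
noncomputable def HermitianMetric.pairing (χ : HermitianMetric n M) (x : M)
    (v w : Fin n → ℂ) : ℂ :=
  χ.form x (v : TangentSpace 𝓘(ℂ, Fin n → ℂ) x) (w : TangentSpace 𝓘(ℂ, Fin n → ℂ) x)

/-- The differential of the inverse of a chart, as a map between model spaces. -/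
noncomputable def chartSymmDeriv (e : OpenPartialHomeomorph M (Fin n → ℂ)) (z : Fin n → ℂ) :
    (Fin n → ℂ) →L[ℂ] (Fin n → ℂ) :=
  mfderiv 𝓘(ℂ, Fin n → ℂ) 𝓘(ℂ, Fin n → ℂ) e.symm z

lemma HermitianMetric.coeff_eq_pairing (χ : HermitianMetric n M)
    (e : OpenPartialHomeomorph M (Fin n → ℂ)) (z : Fin n → ℂ) (i j : Fin n) :
    χ.coeff e z i j = χ.pairing (e.symm z) (chartSymmDeriv e z (Pi.single i 1))
      (chartSymmDeriv e z (Pi.single j 1)) := rfl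

lemma HermitianMetric.pairing_sum_smul (χ : HermitianMetric n M) (x : M)
    (D : (Fin n → ℂ) →L[ℂ] (Fin n → ℂ)) (v w : Fin n → ℂ) :
    χ.pairing x (D v) (D w) = ∑ i, ∑ j, v i * conj (w j) *
      χ.pairing x (D (Pi.single i 1)) (D (Pi.single j 1)) := by
  have hv : ∀ v : Fin n → ℂ, D v = ∑ i, v i • D (Pi.single i 1) := fun v => by
    conv_lhs => rw [pi_eq_sum_univ' v]
    rw [map_sum]
    refine Finset.sum_congr rfl fun i _ => ?_
    rw [map_smul]
  let B : (Fin n → ℂ) →ₗ[ℂ] (Fin n → ℂ) →ₗ⋆[ℂ] ℂ := χ.form x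
  have hB : ∀ v w, χ.pairing x v w = B v w := fun v w => rfl
  simp only [hB]
  rw [hv v, hv w]
  simp only [map_sum, LinearMap.sum_apply, map_smul, LinearMap.smul_apply, smul_eq_mul,
    LinearMap.map_smulₛₗ]
  rw [Finset.sum_comm]
  refine Finset.sum_congr rfl fun i _ => ?_
  rw [Finset.mul_sum]
  exact Finset.sum_congr rfl fun j _ => by ring

lemma HermitianMetric.dotProduct_coeff_mulVec (χ : HermitianMetric n M)
    (e : OpenPartialHomeomorph M (Fin n → ℂ)) (z x : Fin n → ℂ) :
    star x ⬝ᵥ χ.coeff e z *ᵥ x = χ.pairing (e.symm z) (chartSymmDeriv e z (star x))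
      (chartSymmDeriv e z (star x)) := by
  rw [χ.pairing_sum_smul]
  simp only [dotProduct, mulVec, Finset.mul_sum, ← χ.coeff_eq_pairing]
  refine Finset.sum_congr rfl fun i _ => Finset.sum_congr rfl fun j _ => ?_
  simp only [Pi.star_apply, RCLike.star_def, Complex.conj_conj]
  ring

lemma HermitianMetric.coeff_isHermitian (χ : HermitianMetric n M)
    (e : OpenPartialHomeomorph M (Fin n → ℂ)) (z : Fin n → ℂ) :
    (χ.coeff e z).IsHermitian := by
  ext i j
  exact χ.conj_symm (e.symm z) _ _

lemma HermitianMetric.coeff_smooth (χ : HermitianMetric n M)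
    {e : OpenPartialHomeomorph M (Fin n → ℂ)} (he : e ∈ atlas (Fin n → ℂ) M) :
    SmoothEntriesOn (χ.coeff e) e.target := fun i j => χ.smooth e he i j

variable [IsManifold 𝓘(ℂ, Fin n → ℂ) ω M]
  {e e' : OpenPartialHomeomorph M (Fin n → ℂ)} {z : Fin n → ℂ}

/-- The coordinate vector fields of a chart are linearly independent. -/
lemma chartSymmDeriv_injective (he : e ∈ atlas (Fin n → ℂ) M) (hz : z ∈ e.target) :
    Function.Injective (chartSymmDeriv e z) :=
  (mdifferentiable_of_mem_atlas (I := 𝓘(ℂ, Fin n → ℂ)) he).symm.mfderiv_injective hz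

lemma HermitianMetric.coeff_posDef (χ : HermitianMetric n M) (he : e ∈ atlas (Fin n → ℂ) M)
    (hz : z ∈ e.target) : (χ.coeff e z).PosDef := by
  refine PosDef.of_dotProduct_mulVec_pos (χ.coeff_isHermitian e z) fun x hx => ?_
  rw [χ.dotProduct_coeff_mulVec]
  have h0 : chartSymmDeriv e z (star x) ≠ 0 := fun h => hx <| by
    have := chartSymmDeriv_injective he hz (h.trans (map_zero _).symm)
    simpa using this
  have h1 := χ.pos (e.symm z) (chartSymmDeriv e z (star x)) h0
  have h2 := χ.conj_symm (e.symm z) (chartSymmDeriv e z (star x)) (chartSymmDeriv e z (star x))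
  rw [Complex.pos_iff]
  exact ⟨h1, (Complex.conj_eq_iff_im.1 h2).symm⟩

lemma coneCondition_coeff {χ g : HermitianMetric n M} {F : M → ℝ} (hcone : ConeCondition χ g F)
    (he : e ∈ atlas (Fin n → ℂ) M) (hz : z ∈ e.target) {x : Fin n → ℂ} (hx : x ≠ 0) :
    0 < (star x ⬝ᵥ χ.coeff e z *ᵥ x).re - ((n : ℝ) - 1) / (n * Real.exp (F (e.symm z))) *
      (star x ⬝ᵥ g.coeff e z *ᵥ x).re := by
  rw [χ.dotProduct_coeff_mulVec, g.dotProduct_coeff_mulVec]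
  have h0 : chartSymmDeriv e z (star x) ≠ 0 := fun h => hx <| by
    have := chartSymmDeriv_injective he hz (h.trans (map_zero _).symm)
    simpa using this
  exact hcone (e.symm z) (chartSymmDeriv e z (star x)) h0

/-- The transition map from the chart `e` to the chart `e'`. It is meaningful only on the part of
`e.target` that corresponds to `e.source ∩ e'.source`. -/
noncomputable def transition (e e' : OpenPartialHomeomorph M (Fin n → ℂ)) (z : Fin n → ℂ) :
    Fin n → ℂ :=
  e' (e.symm z)

omit [ChartedSpace (Fin n → ℂ) M] [IsManifold 𝓘(ℂ, Fin n → ℂ) ω M] in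
lemma isOpen_transition_domain (e e' : OpenPartialHomeomorph M (Fin n → ℂ)) :
    IsOpen (e.target ∩ e.symm ⁻¹' e'.source) :=
  e.isOpen_inter_preimage_symm e'.open_source

lemma transition_contDiffOn (he : e ∈ atlas (Fin n → ℂ) M) (he' : e' ∈ atlas (Fin n → ℂ) M) :
    ContDiffOn ℂ ∞ (transition e e') (e.target ∩ e.symm ⁻¹' e'.source) := by
  have h1 : ContMDiffOn 𝓘(ℂ, Fin n → ℂ) 𝓘(ℂ, Fin n → ℂ) ∞ e.symm e.target :=
    contMDiffOn_symm_of_mem_maximalAtlas (IsManifold.subset_maximalAtlas he)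
  have h2 : ContMDiffOn 𝓘(ℂ, Fin n → ℂ) 𝓘(ℂ, Fin n → ℂ) ∞ e' e'.source :=
    contMDiffOn_of_mem_maximalAtlas (IsManifold.subset_maximalAtlas he')
  exact contMDiffOn_iff_contDiffOn.1 (h2.comp' h1)

omit [ChartedSpace (Fin n → ℂ) M] [IsManifold 𝓘(ℂ, Fin n → ℂ) ω M] in
lemma transition_mapsTo (e e' : OpenPartialHomeomorph M (Fin n → ℂ)) :
    Set.MapsTo (transition e e') (e.target ∩ e.symm ⁻¹' e'.source) e'.target :=
  fun _ hz => e'.map_source hz.2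

omit [ChartedSpace (Fin n → ℂ) M] [IsManifold 𝓘(ℂ, Fin n → ℂ) ω M] in
lemma symm_transition (hz : z ∈ e.target ∩ e.symm ⁻¹' e'.source) :
    e'.symm (transition e e' z) = e.symm z := e'.left_inv hz.2

/-- Chain rule for coordinate vector fields. -/
lemma chartSymmDeriv_eq_comp (he : e ∈ atlas (Fin n → ℂ) M) (he' : e' ∈ atlas (Fin n → ℂ) M)
    (hz : z ∈ e.target ∩ e.symm ⁻¹' e'.source) (v : Fin n → ℂ) :
    chartSymmDeriv e z v = chartSymmDeriv e' (transition e e' z)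
      (fderiv ℂ (transition e e') z v) := by
  have hopen := isOpen_transition_domain e e'
  have hd : DifferentiableAt ℂ (transition e e') z :=
    ((transition_contDiffOn he he').contDiffAt (hopen.mem_nhds hz)).differentiableAt (by simp)
  have h1 : MDifferentiableAt 𝓘(ℂ, Fin n → ℂ) 𝓘(ℂ, Fin n → ℂ) e'.symm (transition e e' z) :=
    mdifferentiableAt_atlas_symm he' (transition_mapsTo e e' hz)
  have h2 : (e.symm : (Fin n → ℂ) → M) =ᶠ[𝓝 z] e'.symm ∘ transition e e' := by
    filter_upwards [hopen.mem_nhds hz] with w hw using (symm_transition hw).symm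
  have h3 := h1.hasMFDerivAt.comp z hd.mdifferentiableAt.hasMFDerivAt
  have h4 := (h3.congr_of_eventuallyEq h2).mfderiv
  rw [mfderiv_eq_fderiv] at h4
  have h5 : chartSymmDeriv e z =
      (chartSymmDeriv e' (transition e e' z)).comp (fderiv ℂ (transition e e') z) := h4
  rw [h5]
  rfl

lemma jacobian_transition_isUnit (he : e ∈ atlas (Fin n → ℂ) M)
    (he' : e' ∈ atlas (Fin n → ℂ) M) (hz : z ∈ e.target ∩ e.symm ⁻¹' e'.source) :
    IsUnit ((jacobian (transition e e') z).map conj).det := by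
  have h1 : (jacobian (transition e e') z).det ≠ 0 := by
    intro h0
    obtain ⟨v, hv, hv0⟩ := exists_mulVec_eq_zero_iff.2 h0
    refine hv (chartSymmDeriv_injective he hz.1 ?_)
    rw [chartSymmDeriv_eq_comp he he' hz, map_zero]
    have h2 : fderiv ℂ (transition e e') z v = jacobian (transition e e') z *ᵥ v := by
      conv_lhs => rw [pi_eq_sum_univ' v]
      rw [map_sum]
      ext b
      simp only [map_smul, Finset.sum_apply, Pi.smul_apply, smul_eq_mul, mulVec, dotProduct,
        jacobian, of_apply]
      refine Finset.sum_congr rfl fun i _ => ?_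
      rw [mul_comm]
    rw [h2, hv0, map_zero]
  have h2 : ((jacobian (transition e e') z).map conj).det =
      conj (jacobian (transition e e') z).det := by
    rw [← RingHom.mapMatrix_apply, RingHom.map_det]
  rw [h2, isUnit_iff_ne_zero]
  simpa using h1

/-- Transformation law of the coefficients of a metric under a change of charts. -/
lemma HermitianMetric.coeff_transition (χ : HermitianMetric n M)
    (he : e ∈ atlas (Fin n → ℂ) M) (he' : e' ∈ atlas (Fin n → ℂ) M)
    (hz : z ∈ e.target ∩ e.symm ⁻¹' e'.source) :
    χ.coeff e z = ((jacobian (transition e e') z).map conj)ᴴ * χ.coeff e' (transition e e' z) *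
      (jacobian (transition e e') z).map conj := by
  ext i j
  rw [χ.coeff_eq_pairing, chartSymmDeriv_eq_comp he he' hz, chartSymmDeriv_eq_comp he he' hz,
    ← symm_transition hz, χ.pairing_sum_smul]
  simp only [Matrix.mul_apply, conjTranspose_apply, map_apply, jacobian, of_apply,
    Finset.sum_mul, ← χ.coeff_eq_pairing]
  rw [Finset.sum_comm]
  refine Finset.sum_congr rfl fun b _ => Finset.sum_congr rfl fun a _ => ?_
  simp only [RCLike.star_def, Complex.conj_conj]
  ring

/-- Transformation law of the coefficients of `χ + √-1 ∂∂̄u` under a change of charts. -/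
lemma HermitianMetric.perturbedCoeff_transition (χ : HermitianMetric n M)
    (he : e ∈ atlas (Fin n → ℂ) M) (he' : e' ∈ atlas (Fin n → ℂ) M)
    (hz : z ∈ e.target ∩ e.symm ⁻¹' e'.source) {u : M → ℝ}
    (hu : ContDiffOn ℝ ∞ (fun w => u (e'.symm w)) e'.target) :
    χ.perturbedCoeff u e z = ((jacobian (transition e e') z).map conj)ᴴ *
      χ.perturbedCoeff u e' (transition e e' z) * (jacobian (transition e e') z).map conj := by
  have h1 : (fun w => u (e.symm w)) =ᶠ[𝓝 z] fun w => u (e'.symm (transition e e' w)) := by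
    filter_upwards [(isOpen_transition_domain e e').mem_nhds hz] with w hw
    rw [symm_transition hw]
  unfold HermitianMetric.perturbedCoeff
  rw [χ.coeff_transition he he' hz, complexHessian_congr h1,
    complexHessian_comp_holomorphic hu e'.open_target (transition_contDiffOn he he')
      (isOpen_transition_domain e e') (transition_mapsTo e e') hz, Matrix.mul_add,
    Matrix.add_mul]

/-- A complex manifold is a smooth real manifold. -/
lemma isManifold_real : IsManifold 𝓘(ℝ, Fin n → ℂ) ∞ M := by
  refine isManifold_of_contDiffOn _ _ _ fun e e' he he' => ?_
  have h := (transition_contDiffOn he he').restrict_scalars ℝ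
  refine h.congr_mono (fun w _ => rfl) fun w hw => ?_
  simpa using hw.1

lemma contDiffOn_comp_symm {F : M → ℝ} (hF : ContMDiff 𝓘(ℝ, Fin n → ℂ) 𝓘(ℝ, ℝ) ∞ F)
    (he : e ∈ atlas (Fin n → ℂ) M) : ContDiffOn ℝ ∞ (fun w => F (e.symm w)) e.target := by
  have := isManifold_real (n := n) (M := M)
  have h1 : ContMDiffOn 𝓘(ℝ, Fin n → ℂ) 𝓘(ℝ, Fin n → ℂ) ∞ e.symm e.target :=
    contMDiffOn_symm_of_mem_maximalAtlas (IsManifold.subset_maximalAtlas he)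
  exact contMDiffOn_iff_contDiffOn.1 (hF.comp_contMDiffOn h1)

variable {χ g : HermitianMetric n M} {F : M → ℝ} {T : EReal} {φ : ℝ → M → ℝ}

lemma IsSmoothSolution.contDiffOn (h : IsSmoothSolution χ g F T φ)
    (he : e ∈ atlas (Fin n → ℂ) M) :
    ContDiffOn ℝ ∞ (fun p : ℝ × (Fin n → ℂ) => φ p.1 (e.symm p.2))
      (timeInterval T ×ˢ e.target) := by
  have := isManifold_real (n := n) (M := M)
  have h1 : ContMDiffOn 𝓘(ℝ, Fin n → ℂ) 𝓘(ℝ, Fin n → ℂ) ∞ e.symm e.target :=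
    contMDiffOn_symm_of_mem_maximalAtlas (IsManifold.subset_maximalAtlas he)
  have h2 : ContMDiffOn (𝓘(ℝ, ℝ).prod 𝓘(ℝ, Fin n → ℂ)) (𝓘(ℝ, ℝ).prod 𝓘(ℝ, Fin n → ℂ)) ∞
      (fun p : ℝ × (Fin n → ℂ) => (p.1, e.symm p.2)) (timeInterval T ×ˢ e.target) :=
    (contMDiffOn_fst).prodMk (h1.comp contMDiffOn_snd fun p hp => hp.2)
  have h3 := h.smooth.comp h2 fun p hp => ⟨hp.1, Set.mem_univ _⟩
  rw [← contMDiffOn_iff_contDiffOn, modelWithCornersSelf_prod, ← chartedSpaceSelf_prod]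
  exact h3

lemma convex_timeInterval (T : EReal) : Convex ℝ (timeInterval T) := by
  refine Set.OrdConnected.convex ⟨fun a ha b hb c hc => ⟨ha.1.trans hc.1, ?_⟩⟩
  exact lt_of_le_of_lt (by exact_mod_cast hc.2) hb.2

lemma Icc_subset_timeInterval {T : EReal} {t : ℝ} (ht : t ∈ timeInterval T) :
    Set.Icc 0 t ⊆ timeInterval T := fun _ hs =>
  ⟨hs.1, lt_of_le_of_lt (by exact_mod_cast hs.2) ht.2⟩

lemma exists_lt_mem_timeInterval {T : EReal} {t : ℝ} (ht : t ∈ timeInterval T) :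
    ∃ s, t < s ∧ s ∈ timeInterval T := by
  obtain ⟨s, hs1, hs2⟩ := EReal.lt_iff_exists_real_btwn.1 ht.2
  have h : t < s := by exact_mod_cast hs1
  exact ⟨s, h, ht.1.trans h.le, hs2⟩

lemma zero_mem_timeInterval {T : EReal} (hT : 0 < T) : (0 : ℝ) ∈ timeInterval T :=
  ⟨le_rfl, by simpa using hT⟩

lemma timeInterval_mem_nhds {T : EReal} {t : ℝ} (ht : t ∈ timeInterval T) (h0 : 0 < t) :
    timeInterval T ∈ 𝓝 t := by
  obtain ⟨s, hts, hs⟩ := exists_lt_mem_timeInterval ht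
  exact mem_of_superset (Icc_mem_nhds h0 hts) (Icc_subset_timeInterval hs)

lemma uniqueDiffOn_timeInterval {T : EReal} (hT : 0 < T) : UniqueDiffOn ℝ (timeInterval T) := by
  refine uniqueDiffOn_convex (convex_timeInterval T) ?_
  obtain ⟨s, h0, hs⟩ := exists_lt_mem_timeInterval (zero_mem_timeInterval hT)
  refine ⟨s / 2, mem_interior_iff_mem_nhds.2 (timeInterval_mem_nhds
    (Icc_subset_timeInterval hs ⟨by linarith, by linarith⟩) (by linarith))⟩

/-- The coefficients of `χ_φ` are smooth in space and time, up to `t = 0`. -/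
lemma IsSmoothSolution.perturbedCoeff_contDiffOn (h : IsSmoothSolution χ g F T φ) (hT : 0 < T)
    (he : e ∈ atlas (Fin n → ℂ) M) (i j : Fin n) :
    ContDiffOn ℝ ∞ (fun p : ℝ × (Fin n → ℂ) => χ.perturbedCoeff (φ p.1) e p.2 i j)
      (timeInterval T ×ˢ e.target) := by
  have h1 : ContDiffOn ℝ ∞ (fun p : ℝ × (Fin n → ℂ) => χ.coeff e p.2 i j)
      (timeInterval T ×ˢ e.target) :=
    (χ.coeff_smooth he i j).comp contDiff_snd.contDiffOn fun p hp => hp.2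
  refine h1.add (contDiffOn_dz_dzbar_slice (Φ := fun p => (φ p.1 (e.symm p.2) : ℂ))
    (ContDiffOn.ofReal (h.contDiffOn he))
    ((uniqueDiffOn_timeInterval hT).prod e.open_target.uniqueDiffOn) (fun p hp => ?_) i j)
  filter_upwards [e.open_target.mem_nhds hp.2] with w hw using ⟨hp.1, hw⟩

lemma IsSmoothSolution.contDiffOn_slice (h : IsSmoothSolution χ g F T φ)
    (he : e ∈ atlas (Fin n → ℂ) M) {t : ℝ} (ht : t ∈ timeInterval T) :
    ContDiffOn ℝ ∞ (fun w => φ t (e.symm w)) e.target :=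
  contDiffOn_time_slice (u := fun p => φ p.1 (e.symm p.2)) (h.contDiffOn he) ht

omit [IsManifold 𝓘(ℂ, Fin n → ℂ) ω M] in
lemma IsSmoothSolution.continuousOn (h : IsSmoothSolution χ g F T φ) :
    ContinuousOn (fun p : ℝ × M => φ p.1 p.2) (timeInterval T ×ˢ Set.univ) :=
  h.smooth.continuousOn

end Charts

/-! ### The comparison principle and the bound on the time derivative -/

section Comparison

variable {n : ℕ} {M : Type*} [TopologicalSpace M] [CompactSpace M] [ChartedSpace (Fin n → ℂ) M]

/-- A compact manifold is covered by finitely many closed coordinate balls. -/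
lemma exists_finite_coordinate_balls (n : ℕ) (M : Type*) [TopologicalSpace M] [CompactSpace M]
    [ChartedSpace (Fin n → ℂ) M] :
    ∃ (s : Finset M) (r : M → ℝ),
      (∀ x, 0 < r x ∧ Metric.closedBall (chartAt (Fin n → ℂ) x x) (r x) ⊆
        (chartAt (Fin n → ℂ) x).target) ∧
      ∀ y, ∃ x ∈ s, y ∈ (chartAt (Fin n → ℂ) x).source ∧
        chartAt (Fin n → ℂ) x y ∈ Metric.closedBall (chartAt (Fin n → ℂ) x x) (r x) := by
  have h1 : ∀ x : M, ∃ r : ℝ, 0 < r ∧ Metric.closedBall (chartAt (Fin n → ℂ) x x) r ⊆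
      (chartAt (Fin n → ℂ) x).target := fun x =>
    Metric.nhds_basis_closedBall.mem_iff.1
      ((chartAt (Fin n → ℂ) x).open_target.mem_nhds (mem_chart_target _ x))
  choose r hr using h1
  have h2 : ∀ x : M, {y | y ∈ (chartAt (Fin n → ℂ) x).source ∧
      chartAt (Fin n → ℂ) x y ∈ Metric.closedBall (chartAt (Fin n → ℂ) x x) (r x)} ∈ 𝓝 x :=
    fun x => by
      have hc := (chartAt (Fin n → ℂ) x).continuousAt (mem_chart_source _ x)
      filter_upwards [(chartAt (Fin n → ℂ) x).open_source.mem_nhds (mem_chart_source _ x),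
        hc (Metric.closedBall_mem_nhds _ (hr x).1)] with y hy1 hy2 using ⟨hy1, hy2⟩
  obtain ⟨s, hs⟩ := CompactSpace.elim_nhds_subcover _ h2
  refine ⟨s, r, hr, fun y => ?_⟩
  have hy : y ∈ (⊤ : Set M) := trivial
  rw [← hs] at hy
  simpa [and_left_comm] using hy

variable [IsManifold 𝓘(ℂ, Fin n → ℂ) ω M] {χ g : HermitianMetric n M} {F : M → ℝ}

omit [CompactSpace M] [IsManifold 𝓘(ℂ, Fin n → ℂ) ω M] in
lemma perturbedCoeff_const (χ : HermitianMetric n M) (c : ℝ)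
    (e : OpenPartialHomeomorph M (Fin n → ℂ)) (z : Fin n → ℂ) :
    χ.perturbedCoeff (fun _ => c) e z = χ.coeff e z := by
  unfold HermitianMetric.perturbedCoeff
  rw [complexHessian_const, add_zero]

/-- The initial velocity of the flow is bounded, as it depends only on `χ`, `ω` and `F`. -/
lemma exists_initial_velocity_bound (hn : 0 < n) (χ g : HermitianMetric n M)
    (hF : ContMDiff 𝓘(ℝ, Fin n → ℂ) 𝓘(ℝ, ℝ) ∞ F) :
    ∃ C : ℝ, 0 ≤ C ∧ ∀ e ∈ atlas (Fin n → ℂ) M, ∀ z ∈ e.target,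
      |Real.log (topFormRatio (χ.coeff e z) (g.coeff e z)) + F (e.symm z)| ≤ C := by
  obtain ⟨s, r, hr, hs⟩ := exists_finite_coordinate_balls n M
  set f : M → (Fin n → ℂ) → ℝ := fun x z => Real.log n -
    Real.log ((χ.coeff (chartAt (Fin n → ℂ) x) z)⁻¹ *
      g.coeff (chartAt (Fin n → ℂ) x) z).trace.re + F ((chartAt (Fin n → ℂ) x).symm z) with hf
  have h1 : ∀ x : M, ∃ C : ℝ, ∀ z ∈ Metric.closedBall (chartAt (Fin n → ℂ) x x) (r x),
      ‖f x z‖ ≤ C := fun x => by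
    have he := chart_mem_atlas (Fin n → ℂ) x
    refine (isCompact_closedBall _ _).exists_bound_of_continuousOn ?_
    refine ContinuousOn.mono (s := (chartAt (Fin n → ℂ) x).target) ?_ (hr x).2
    have h2 : SmoothEntriesOn (fun z => (χ.coeff (chartAt (Fin n → ℂ) x) z)⁻¹ *
        g.coeff (chartAt (Fin n → ℂ) x) z) (chartAt (Fin n → ℂ) x).target :=
      (SmoothEntriesOn.inv (χ.coeff_smooth he)
        fun w hw => (χ.coeff_posDef he hw).det_pos.ne').mul (g.coeff_smooth he)
    have h3 : ContDiffOn ℝ ∞ (fun z => ((χ.coeff (chartAt (Fin n → ℂ) x) z)⁻¹ *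
        g.coeff (chartAt (Fin n → ℂ) x) z).trace.re) (chartAt (Fin n → ℂ) x).target := by
      refine ContDiffOn.re ?_
      simp only [Matrix.trace, Matrix.diag]
      exact ContDiffOn.sum fun i _ => h2 i i
    exact ((contDiffOn_const.sub (h3.log fun w hw => (trace_inv_mul_pos hn
      (χ.coeff_posDef he hw) (g.coeff_posDef he hw)).ne')).add
        (contDiffOn_comp_symm hF he)).continuousOn
  choose C hC using h1
  refine ⟨∑ x ∈ s, |C x|, Finset.sum_nonneg fun x _ => abs_nonneg _, fun e he z hz => ?_⟩
  obtain ⟨x, hxs, hx1, hx2⟩ := hs (e.symm z)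
  have he' := chart_mem_atlas (Fin n → ℂ) x
  have hz' : z ∈ e.target ∩ e.symm ⁻¹' (chartAt (Fin n → ℂ) x).source := ⟨hz, hx1⟩
  rw [log_topFormRatio hn (χ.coeff_posDef he hz) (g.coeff_posDef he hz),
    χ.coeff_transition he he' hz', g.coeff_transition he he' hz',
    trace_inv_mul_congr (jacobian_transition_isUnit he he' hz'), ← symm_transition hz']
  exact (hC x _ hx2).trans ((le_abs_self _).trans (Finset.single_le_sum
    (f := fun x => |C x|) (fun x _ => abs_nonneg _) hxs))

/-- Comparison principle for the flow: a subsolution `u` stays below a supersolution `v` up to the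
initial difference `c`. The time derivatives are needed for positive times only. -/
lemma comparison_principle (hn : 0 < n) {τ c : ℝ} {u v : ℝ → M → ℝ}
    (huc : ContinuousOn (fun p : ℝ × M => u p.1 p.2) (Set.Icc 0 τ ×ˢ Set.univ))
    (hvc : ContinuousOn (fun p : ℝ × M => v p.1 p.2) (Set.Icc 0 τ ×ˢ Set.univ))
    (hus : ∀ t ∈ Set.Ioc 0 τ, ∀ e ∈ atlas (Fin n → ℂ) M,
      ContDiffOn ℝ ∞ (fun w => u t (e.symm w)) e.target)
    (hvs : ∀ t ∈ Set.Ioc 0 τ, ∀ e ∈ atlas (Fin n → ℂ) M,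
      ContDiffOn ℝ ∞ (fun w => v t (e.symm w)) e.target)
    (hup : ∀ t ∈ Set.Ioc 0 τ, ∀ e ∈ atlas (Fin n → ℂ) M, ∀ z ∈ e.target,
      (χ.perturbedCoeff (u t) e z).PosDef)
    (hvp : ∀ t ∈ Set.Ioc 0 τ, ∀ e ∈ atlas (Fin n → ℂ) M, ∀ z ∈ e.target,
      (χ.perturbedCoeff (v t) e z).PosDef)
    (hut : ∀ t ∈ Set.Ioc 0 τ, ∀ e ∈ atlas (Fin n → ℂ) M, ∀ z ∈ e.target, ∃ u' : ℝ,
      HasDerivAt (fun s => u s (e.symm z)) u' t ∧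
      u' ≤ Real.log (topFormRatio (χ.perturbedCoeff (u t) e z) (g.coeff e z)) + F (e.symm z))
    (hvt : ∀ t ∈ Set.Ioc 0 τ, ∀ e ∈ atlas (Fin n → ℂ) M, ∀ z ∈ e.target, ∃ v' : ℝ,
      HasDerivAt (fun s => v s (e.symm z)) v' t ∧
      Real.log (topFormRatio (χ.perturbedCoeff (v t) e z) (g.coeff e z)) + F (e.symm z) ≤ v')
    (h0 : ∀ x, u 0 x ≤ v 0 x + c) :
    ∀ t ∈ Set.Icc 0 τ, ∀ x, u t x ≤ v t x + c := by
  have key : ∀ ε > 0, ∀ t ∈ Set.Icc 0 τ, ∀ x, u t x - v t x - ε * t ≤ c := by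
    intro ε hε t ht x
    have hc : ContinuousOn (fun p : ℝ × M => u p.1 p.2 - v p.1 p.2 - ε * p.1)
        (Set.Icc 0 τ ×ˢ Set.univ) := (huc.sub hvc).sub (by fun_prop)
    obtain ⟨⟨t₀, x₀⟩, ⟨ht₀, -⟩, hmax⟩ := (isCompact_Icc.prod isCompact_univ).exists_isMaxOn
      ⟨(t, x), ht, Set.mem_univ x⟩ hc
    replace ht₀ : t₀ ∈ Set.Icc 0 τ := ht₀
    have hmax' : ∀ s ∈ Set.Icc 0 τ, ∀ y, u s y - v s y - ε * s ≤
        u t₀ x₀ - v t₀ x₀ - ε * t₀ := fun s hs y => hmax (⟨hs, Set.mem_univ y⟩ :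
          ((s, y) : ℝ × M) ∈ Set.Icc 0 τ ×ˢ Set.univ)
    refine (hmax' t ht x).trans ?_
    rcases ht₀.1.eq_or_lt with h | hpos
    · rw [← h]
      linarith [h0 x₀]
    · exfalso
      have ht₀' : t₀ ∈ Set.Ioc 0 τ := ⟨hpos, ht₀.2⟩
      set e := chartAt (Fin n → ℂ) x₀ with he_def
      have he : e ∈ atlas (Fin n → ℂ) M := chart_mem_atlas _ x₀
      set z := e x₀ with hz_def
      have hz : z ∈ e.target := mem_chart_target _ x₀
      have hzx : e.symm z = x₀ := e.left_inv (mem_chart_source _ x₀)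
      have hlm : IsLocalMax (fun w => u t₀ (e.symm w) - v t₀ (e.symm w)) z := by
        refine Eventually.of_forall fun w => ?_
        have := hmax' t₀ ht₀ (e.symm w)
        simp only [hzx]
        linarith
      have h1 := complexHessian_posSemidef_of_isLocalMax
        ((hus t₀ ht₀' e he).sub (hvs t₀ ht₀' e he)) e.open_target hz hlm
      rw [complexHessian_sub (hus t₀ ht₀' e he) (hvs t₀ ht₀' e he) e.open_target hz] at h1
      have h2 : (χ.perturbedCoeff (v t₀) e z - χ.perturbedCoeff (u t₀) e z).PosSemidef := by
        convert h1 using 1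
        unfold HermitianMetric.perturbedCoeff
        abel
      have hG := g.coeff_posDef he hz
      have hu1 := hup t₀ ht₀' e he z hz
      have hv1 := hvp t₀ ht₀' e he z hz
      have h3 := trace_inv_mul_le_of_le hu1 hv1 h2 hG
      have h4 := Real.log_le_log (trace_inv_mul_pos hn hv1 hG) h3
      obtain ⟨u', hu', hu''⟩ := hut t₀ ht₀' e he z hz
      obtain ⟨v', hv', hv''⟩ := hvt t₀ ht₀' e he z hz
      rw [log_topFormRatio hn hu1 hG] at hu''
      rw [log_topFormRatio hn hv1 hG] at hv''
      have h5 : HasDerivAt (fun s => u s (e.symm z) - v s (e.symm z) - ε * s)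
          (u' - v' - ε * 1) t₀ := (hu'.sub hv').sub ((hasDerivAt_id t₀).const_mul ε)
      have h6 := HasDerivAt.nonneg_of_le_left h5 (by
        filter_upwards [Ioo_mem_nhdsLT hpos] with s hs
        rw [hzx]
        exact hmax' s ⟨hs.1.le, hs.2.le.trans ht₀.2⟩ x₀)
      linarith
  intro t ht x
  refine le_of_forall_pos_le_add fun ε hε => ?_
  have h1 := key (ε / (t + 1)) (div_pos hε (by linarith [ht.1])) t ht x
  have h2 : ε / (t + 1) * t ≤ ε := by
    rw [div_mul_eq_mul_div, div_le_iff₀ (by linarith [ht.1])]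
    nlinarith [ht.1]
  linarith

variable {T : EReal} {φ : ℝ → M → ℝ}

omit [CompactSpace M] [IsManifold 𝓘(ℂ, Fin n → ℂ) ω M] in
lemma IsSmoothSolution.hasDerivAt (h : IsSmoothSolution χ g F T φ) {t : ℝ}
    (ht : t ∈ timeInterval T) (hpos : 0 < t) {e : OpenPartialHomeomorph M (Fin n → ℂ)}
    (he : e ∈ atlas (Fin n → ℂ) M) {z : Fin n → ℂ} (hz : z ∈ e.target) :
    HasDerivAt (fun s => φ s (e.symm z))
      (Real.log (topFormRatio (χ.perturbedCoeff (φ t) e z) (g.coeff e z)) + F (e.symm z)) t :=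
  (h.equation t ht e he z hz).hasDerivAt (timeInterval_mem_nhds ht hpos)

/-- The time derivative of a solution is bounded by its initial size: compare `φ` with linear
functions of time, then `φ` with its translates in time. -/
lemma exists_velocity_bound (hn : 0 < n) (χ g : HermitianMetric n M)
    (hF : ContMDiff 𝓘(ℝ, Fin n → ℂ) 𝓘(ℝ, ℝ) ∞ F) :
    ∃ C : ℝ, ∀ (T : EReal), 0 < T → ∀ φ : ℝ → M → ℝ, IsSmoothSolution χ g F T φ →
      ∀ t ∈ timeInterval T, ∀ e ∈ atlas (Fin n → ℂ) M, ∀ z ∈ e.target,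
        |Real.log (topFormRatio (χ.perturbedCoeff (φ t) e z) (g.coeff e z)) + F (e.symm z)|
          ≤ C := by
  obtain ⟨C, hC0, hC⟩ := exists_initial_velocity_bound hn χ g hF
  refine ⟨C, fun T hT φ h t ht e he z hz => ?_⟩
  have hsub : ∀ {τ : ℝ}, τ ∈ timeInterval T → ∀ s ∈ Set.Ioc 0 τ, s ∈ timeInterval T :=
    fun hτ s hs => Icc_subset_timeInterval hτ ⟨hs.1.le, hs.2⟩
  have hφc : ∀ {τ : ℝ}, τ ∈ timeInterval T →
      ContinuousOn (fun p : ℝ × M => φ p.1 p.2) (Set.Icc 0 τ ×ˢ Set.univ) := fun hτ =>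
    h.continuousOn.mono (Set.prod_mono (Icc_subset_timeInterval hτ) subset_rfl)
  have hlin : ∀ k : ℝ, ∀ (t : ℝ) (x : M), HasDerivAt (fun s : ℝ => k * s) k t := fun k t x => by
    simpa using (hasDerivAt_id t).const_mul k
  -- comparison with linear functions of time
  have hub : ∀ τ ∈ timeInterval T, ∀ x, φ τ x ≤ C * τ := fun τ hτ x => by
    have := comparison_principle (χ := χ) (g := g) (F := F) (c := 0) (u := φ)
      (v := fun s _ => C * s) hn (hφc hτ) (by fun_prop)
      (fun s hs e he => h.contDiffOn_slice he (hsub hτ s hs)) (fun s _ e _ => contDiffOn_const)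
      (fun s hs e he z hz => h.pos s (hsub hτ s hs) e he z hz)
      (fun s _ e he z hz => by rw [perturbedCoeff_const]; exact χ.coeff_posDef he hz)
      (fun s hs e he z hz => ⟨_, h.hasDerivAt (hsub hτ s hs) hs.1 he hz, le_rfl⟩)
      (fun s _ e he z hz => ⟨C, hlin C s (e.symm z), by
        rw [perturbedCoeff_const]; exact (le_abs_self _).trans (hC e he z hz)⟩)
      (fun x => by simp [h.initial x]) τ ⟨hτ.1, le_rfl⟩ x
    simpa using this
  have hlb : ∀ τ ∈ timeInterval T, ∀ x, -C * τ ≤ φ τ x := fun τ hτ x => by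
    have := comparison_principle (χ := χ) (g := g) (F := F) (c := 0) (v := φ)
      (u := fun s _ => -C * s) hn (by fun_prop) (hφc hτ) (fun s _ e _ => contDiffOn_const)
      (fun s hs e he => h.contDiffOn_slice he (hsub hτ s hs))
      (fun s _ e he z hz => by rw [perturbedCoeff_const]; exact χ.coeff_posDef he hz)
      (fun s hs e he z hz => h.pos s (hsub hτ s hs) e he z hz)
      (fun s _ e he z hz => ⟨-C, hlin (-C) s (e.symm z), by
        rw [perturbedCoeff_const]; exact (abs_le.1 (hC e he z hz)).1⟩)
      (fun s hs e he z hz => ⟨_, h.hasDerivAt (hsub hτ s hs) hs.1 he hz, le_rfl⟩)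
      (fun x => by simp [h.initial x]) τ ⟨hτ.1, le_rfl⟩ x
    simpa using this
  -- comparison of `φ` with its translates
  have htrans : ∀ τ k : ℝ, 0 ≤ τ → 0 < k → τ + k ∈ timeInterval T → ∀ x,
      φ (τ + k) x ≤ φ τ x + C * k ∧ φ τ x ≤ φ (τ + k) x + C * k := fun τ k hτ0 hk hτk x => by
    have hτ : τ ∈ timeInterval T := Icc_subset_timeInterval hτk ⟨hτ0, by linarith⟩
    have hkT : k ∈ timeInterval T := Icc_subset_timeInterval hτk ⟨hk.le, by linarith⟩
    have hsub' : ∀ s ∈ Set.Icc 0 τ, s + k ∈ timeInterval T := fun s hs =>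
      Icc_subset_timeInterval hτk ⟨by linarith [hs.1], by linarith [hs.2]⟩
    have hsub'' : ∀ s ∈ Set.Ioc 0 τ, s + k ∈ timeInterval T := fun s hs =>
      hsub' s ⟨hs.1.le, hs.2⟩
    have hcs : ContinuousOn (fun p : ℝ × M => φ (p.1 + k) p.2) (Set.Icc 0 τ ×ˢ Set.univ) :=
      h.continuousOn.comp (f := fun p : ℝ × M => (p.1 + k, p.2)) (by fun_prop)
        fun p hp => ⟨hsub' p.1 hp.1, Set.mem_univ _⟩
    have hds : ∀ s ∈ Set.Ioc 0 τ, ∀ e ∈ atlas (Fin n → ℂ) M, ∀ z ∈ e.target,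
        HasDerivAt (fun s => φ (s + k) (e.symm z)) (Real.log (topFormRatio
          (χ.perturbedCoeff (φ (s + k)) e z) (g.coeff e z)) + F (e.symm z)) s :=
      fun s hs e he z hz => HasDerivAt.comp_add_const s k
        (h.hasDerivAt (hsub'' s hs) (by linarith [hs.1]) he hz)
    constructor
    · exact comparison_principle (χ := χ) (g := g) (F := F) (c := C * k)
        (u := fun s => φ (s + k)) (v := φ) hn hcs (hφc hτ)
        (fun s hs e he => h.contDiffOn_slice he (hsub'' s hs))
        (fun s hs e he => h.contDiffOn_slice he (hsub hτ s hs))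
        (fun s hs e he z hz => h.pos _ (hsub'' s hs) e he z hz)
        (fun s hs e he z hz => h.pos s (hsub hτ s hs) e he z hz)
        (fun s hs e he z hz => ⟨_, hds s hs e he z hz, le_rfl⟩)
        (fun s hs e he z hz => ⟨_, h.hasDerivAt (hsub hτ s hs) hs.1 he hz, le_rfl⟩)
        (fun x => by simpa [h.initial x] using hub k hkT x) τ ⟨hτ0, le_rfl⟩ x
    · exact comparison_principle (χ := χ) (g := g) (F := F) (c := C * k)
        (v := fun s => φ (s + k)) (u := φ) hn (hφc hτ) hcs
        (fun s hs e he => h.contDiffOn_slice he (hsub hτ s hs))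
        (fun s hs e he => h.contDiffOn_slice he (hsub'' s hs))
        (fun s hs e he z hz => h.pos s (hsub hτ s hs) e he z hz)
        (fun s hs e he z hz => h.pos _ (hsub'' s hs) e he z hz)
        (fun s hs e he z hz => ⟨_, h.hasDerivAt (hsub hτ s hs) hs.1 he hz, le_rfl⟩)
        (fun s hs e he z hz => ⟨_, hds s hs e he z hz, le_rfl⟩)
        (fun x => by
          have := hlb k hkT x
          simp only [h.initial x, zero_add]
          linarith) τ ⟨hτ0, le_rfl⟩ x
  rcases ht.1.eq_or_lt with h0 | hpos
  · have h1 : φ t = fun _ => 0 := by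
      rw [← h0]
      exact funext h.initial
    rw [h1, perturbedCoeff_const]
    exact hC e he z hz
  · have hd := (hasDerivAt_iff_tendsto_slope_left_right.1 (h.hasDerivAt ht hpos he hz)).2
    obtain ⟨t₁, ht₁, ht₁T⟩ := exists_lt_mem_timeInterval ht
    have hev : ∀ᶠ s in 𝓝[>] t, |slope (fun s => φ s (e.symm z)) t s| ≤ C := by
      filter_upwards [Ioo_mem_nhdsGT ht₁] with s hs
      have h1 := htrans t (s - t) ht.1 (by linarith [hs.1])
        (Icc_subset_timeInterval ht₁T ⟨by linarith [hs.1], by linarith [hs.2]⟩) (e.symm z)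
      have e1 : t + (s - t) = s := by ring
      rw [e1] at h1
      rw [slope_def_field, abs_div, abs_of_pos (sub_pos.2 hs.1), div_le_iff₀ (sub_pos.2 hs.1),
        abs_le]
      exact ⟨by linarith [h1.2], by linarith [h1.1]⟩
    exact le_of_tendsto hd.abs hev

end Comparison

/-! ### Quadratic changes of coordinates -/

section Quadratic

variable {n : ℕ}

/-- Coefficients of a quadratic polynomial map `ℂⁿ → ℂⁿ`: the constant, linear and quadratic parts.
The quadratic part is not required to be symmetric. -/
abbrev QuadParam (n : ℕ) : Type :=
  (Fin n → ℂ) × (Fin n → Fin n → ℂ) × (Fin n → Fin n → Fin n → ℂ)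

/-- The quadratic polynomial map with given coefficients. -/
noncomputable def quadMap (θ : QuadParam n) (w : Fin n → ℂ) : Fin n → ℂ := fun a =>
  θ.1 a + ∑ i, θ.2.1 a i * w i + 1 / 2 * ∑ k, ∑ i, θ.2.2 a k i * w k * w i

/-- The Jacobian matrix of `quadMap`. -/
noncomputable def quadJac (θ : QuadParam n) (w : Fin n → ℂ) : Matrix (Fin n) (Fin n) ℂ :=
  Matrix.of fun a i => θ.2.1 a i + 1 / 2 * ∑ k, (θ.2.2 a k i + θ.2.2 a i k) * w k

/-- The pullback under `quadMap` of a Hermitian form with coefficients `H`. -/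
noncomputable def quadPullback (θ : QuadParam n) (H : (Fin n → ℂ) → Matrix (Fin n) (Fin n) ℂ)
    (w : Fin n → ℂ) : Matrix (Fin n) (Fin n) ℂ :=
  ((quadJac θ w).map conj)ᴴ * H (quadMap θ w) * (quadJac θ w).map conj

@[simp]
lemma quadMap_zero (θ : QuadParam n) : quadMap θ 0 = θ.1 := by
  ext a
  simp [quadMap]

@[simp]
lemma quadJac_zero (θ : QuadParam n) : quadJac θ 0 = Matrix.of θ.2.1 := by
  ext a i
  simp [quadJac]

lemma quadPullback_apply (θ : QuadParam n) (H : (Fin n → ℂ) → Matrix (Fin n) (Fin n) ℂ)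
    (w : Fin n → ℂ) (i j : Fin n) : quadPullback θ H w i j =
      ∑ b, (∑ a, quadJac θ w a i * H (quadMap θ w) a b) * conj (quadJac θ w b j) := by
  simp [quadPullback, Matrix.mul_apply]

lemma contDiff_quadMap (θ : QuadParam n) : ContDiff ℂ ∞ (quadMap θ) := by
  unfold quadMap
  fun_prop

lemma jacobian_quadMap (θ : QuadParam n) (w : Fin n → ℂ) :
    jacobian (quadMap θ) w = quadJac θ w := by
  have h : ∀ i, HasFDerivAt (fun w : Fin n → ℂ => w i)
      (ContinuousLinearMap.proj (R := ℂ) (φ := fun _ : Fin n => ℂ) i) w :=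
    fun i => (ContinuousLinearMap.proj (R := ℂ) (φ := fun _ : Fin n => ℂ) i).hasFDerivAt
  ext a j
  have h1 : HasFDerivAt (fun w => quadMap θ w a) _ w :=
    ((HasFDerivAt.fun_sum (u := Finset.univ) fun i _ => (h i).const_mul (θ.2.1 a i)).const_add
      (θ.1 a)).add ((HasFDerivAt.fun_sum (u := Finset.univ) fun k _ =>
        HasFDerivAt.fun_sum (u := Finset.univ) fun i _ =>
          ((h k).const_mul (θ.2.2 a k i)).mul (h i)).const_mul (1 / 2))
  have h2 : fderiv ℂ (quadMap θ) w (Pi.single j 1) a =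
      fderiv ℂ (fun w => quadMap θ w a) w (Pi.single j 1) := by
    rw [(hasFDerivAt_pi'.1 ((contDiff_quadMap θ).differentiable (by simp) w).hasFDerivAt a).fderiv]
    rfl
  simp only [jacobian, of_apply]
  rw [h2, h1.fderiv]
  simp only [quadJac, of_apply, _root_.add_apply, _root_.smul_apply, _root_.sum_apply,
    ContinuousLinearMap.proj_apply, Pi.single_apply, smul_eq_mul, mul_ite, mul_one, mul_zero,
    Finset.sum_add_distrib, Finset.sum_ite_eq', Finset.mem_univ, if_true, add_mul]
  congr 2
  rw [Finset.sum_comm]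
  simp [mul_comm]

lemma continuous_quadMap_prod :
    Continuous fun p : QuadParam n × (Fin n → ℂ) => quadMap p.1 p.2 := by
  unfold quadMap
  fun_prop

lemma contDiff_quadMap_prod :
    ContDiff ℝ ∞ fun p : QuadParam n × (Fin n → ℂ) => quadMap p.1 p.2 := by
  unfold quadMap
  fun_prop

lemma contDiff_quadJac_prod (a i : Fin n) :
    ContDiff ℝ ∞ fun p : QuadParam n × (Fin n → ℂ) => quadJac p.1 p.2 a i := by
  simp only [quadJac, of_apply]
  fun_prop

variable {U : Set (Fin n → ℂ)} {H : (Fin n → ℂ) → Matrix (Fin n) (Fin n) ℂ}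

lemma isOpen_quadMap_preimage_prod (hU : IsOpen U) :
    IsOpen {p : QuadParam n × (Fin n → ℂ) | quadMap p.1 p.2 ∈ U} :=
  hU.preimage continuous_quadMap_prod

/-- Pullbacks depend smoothly on the change of coordinates. -/
lemma contDiffOn_quadPullback_prod (hH : SmoothEntriesOn H U) (i j : Fin n) :
    ContDiffOn ℝ ∞ (fun p : QuadParam n × (Fin n → ℂ) => quadPullback p.1 H p.2 i j)
      {p | quadMap p.1 p.2 ∈ U} := by
  simp only [quadPullback_apply]
  refine ContDiffOn.sum fun b _ => (ContDiffOn.sum fun a _ =>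
    (contDiff_quadJac_prod a i).contDiffOn.mul ?_).mul
      (ContDiffOn.conj (contDiff_quadJac_prod b j).contDiffOn)
  exact (hH a b).comp contDiff_quadMap_prod.contDiffOn fun p hp => hp

lemma smoothEntriesOn_quadPullback (hH : SmoothEntriesOn H U) (θ : QuadParam n) :
    SmoothEntriesOn (quadPullback θ H) (quadMap θ ⁻¹' U) := fun i j => by
  have h : ContDiff ℝ ∞ fun w : Fin n → ℂ => (θ, w) := contDiff_prodMk_right θ
  exact ContDiffOn.comp (g := fun p : QuadParam n × (Fin n → ℂ) => quadPullback p.1 H p.2 i j)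
    (f := fun w => (θ, w)) (contDiffOn_quadPullback_prod hH i j) h.contDiffOn fun _ hw => hw

lemma dz_quadJac (θ : QuadParam n) (w : Fin n → ℂ) (a i k : Fin n) :
    dz k (fun w => quadJac θ w a i) w = 1 / 2 * (θ.2.2 a k i + θ.2.2 a i k) := by
  have h : ∀ i, HasFDerivAt (fun w : Fin n → ℂ => w i)
      (ContinuousLinearMap.proj (R := ℂ) (φ := fun _ : Fin n => ℂ) i) w :=
    fun i => (ContinuousLinearMap.proj (R := ℂ) (φ := fun _ : Fin n => ℂ) i).hasFDerivAt
  have h1 : HasFDerivAt (fun w => quadJac θ w a i) _ w :=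
    (((HasFDerivAt.fun_sum (u := Finset.univ) fun k _ =>
      (h k).const_mul (θ.2.2 a k i + θ.2.2 a i k)).const_mul (1 / 2)).const_add (θ.2.1 a i))
  rw [dz_holomorphic h1.differentiableAt, h1.fderiv]
  simp [Pi.single_apply]

/-- First derivatives of a pullback. -/
lemma dz_quadPullback (hH : SmoothEntriesOn H U) (hU : IsOpen U) (θ : QuadParam n)
    {w : Fin n → ℂ} (hw : quadMap θ w ∈ U) (i j k : Fin n) :
    dz k (fun w => quadPullback θ H w i j) w =
      ∑ b, (∑ a, (1 / 2 * (θ.2.2 a k i + θ.2.2 a i k) * H (quadMap θ w) a b +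
        ∑ c, quadJac θ w a i * quadJac θ w c k * dz c (fun z => H z a b) (quadMap θ w))) *
          conj (quadJac θ w b j) := by
  have hJc : ∀ a i, DifferentiableAt ℂ (fun w => quadJac θ w a i) w := fun a i => by
    simp only [quadJac, of_apply]
    fun_prop
  have hJ : ∀ a i, DifferentiableAt ℝ (fun w => quadJac θ w a i) w :=
    fun a i => (hJc a i).restrictScalars ℝ
  have hφ : DifferentiableAt ℂ (quadMap θ) w := (contDiff_quadMap θ).differentiable (by simp) w
  have hHd : ∀ a b, DifferentiableAt ℝ (fun w => H (quadMap θ w) a b) w := fun a b =>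
    (ContDiffOn.differentiableAt_of_isOpen (hH a b) hU hw).comp w (hφ.restrictScalars ℝ)
  have hcj : ∀ b j, DifferentiableAt ℝ (fun w => conj (quadJac θ w b j)) w := fun b j =>
    Complex.conjCLE.differentiable.differentiableAt.comp w (hJ b j)
  have hs : ∀ b, DifferentiableAt ℝ (fun w => ∑ a, quadJac θ w a i * H (quadMap θ w) a b) w :=
    fun b => DifferentiableAt.fun_sum fun a _ => (hJ a i).fun_mul (hHd a b)
  simp only [quadPullback_apply]
  rw [dz_sum _ fun b _ => (hs b).fun_mul (hcj b j)]
  refine Finset.sum_congr rfl fun b _ => ?_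
  rw [dz_mul (hs b) (hcj b j), dz_conj, dzbar_holomorphic (hJc b j), map_zero, mul_zero, add_zero,
    dz_sum _ fun a _ => (hJ a i).fun_mul (hHd a b)]
  congr 1
  refine Finset.sum_congr rfl fun a _ => ?_
  rw [dz_mul (hJ a i) (hHd a b), dz_quadJac,
    dz_comp_holomorphic (f := fun z => H z a b)
      (ContDiffOn.differentiableAt_of_isOpen (hH a b) hU hw) hφ, Finset.mul_sum, jacobian_quadMap]
  congr 1
  exact Finset.sum_congr rfl fun c _ => by ring

/-- The Kähler condition is preserved by holomorphic changes of coordinates. -/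
lemma kahler_quadPullback (hH : SmoothEntriesOn H U) (hU : IsOpen U)
    (hk : ∀ w ∈ U, ∀ i j k, dz k (fun w => H w i j) w = dz i (fun w => H w k j) w)
    (θ : QuadParam n) {w : Fin n → ℂ} (hw : quadMap θ w ∈ U) (i j k : Fin n) :
    dz k (fun w => quadPullback θ H w i j) w = dz i (fun w => quadPullback θ H w k j) w := by
  rw [dz_quadPullback hH hU θ hw, dz_quadPullback hH hU θ hw]
  refine Finset.sum_congr rfl fun b _ => ?_
  congr 1
  rw [Finset.sum_add_distrib, Finset.sum_add_distrib]
  congr 1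
  · exact Finset.sum_congr rfl fun a _ => by ring
  · rw [Finset.sum_comm]
    refine Finset.sum_congr rfl fun a _ => Finset.sum_congr rfl fun c _ => ?_
    rw [hk _ hw c b a]
    ring

/-- The quadratic part of a change of coordinates, with constant part `c` and linear part `P`, that
makes the first derivatives of a Kähler metric vanish at the origin: it solves
`∑ a, Q a k i * G a b = -∑ d l, P d i * P l k * ∂_l G d b`. -/
noncomputable def normalQuad (G : (Fin n → ℂ) → Matrix (Fin n) (Fin n) ℂ) (c : Fin n → ℂ)
    (P : Fin n → Fin n → ℂ) : Fin n → Fin n → Fin n → ℂ := fun a k i =>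
  -∑ x, (∑ d, ∑ l, P d i * P l k * dz l (fun z => G z d x) c) * (G c)⁻¹ x a

/-- The coefficients of a change to normal coordinates. -/
noncomputable def normalParam (G : (Fin n → ℂ) → Matrix (Fin n) (Fin n) ℂ)
    (p : (Fin n → ℂ) × (Fin n → Fin n → ℂ)) : QuadParam n := (p.1, p.2, normalQuad G p.1 p.2)

variable {G : (Fin n → ℂ) → Matrix (Fin n) (Fin n) ℂ}

/-- In normal coordinates the first derivatives of the metric vanish at the centre. The Kähler
condition makes `normalQuad` symmetric, so that it is the derivative of the Jacobian matrix. -/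
lemma dzMatrix_normal_eq_zero (hG : SmoothEntriesOn G U) (hU : IsOpen U)
    (hk : ∀ w ∈ U, ∀ i j k, dz k (fun w => G w i j) w = dz i (fun w => G w k j) w)
    {p : (Fin n → ℂ) × (Fin n → Fin n → ℂ)} (hp : p.1 ∈ U) (hdet : IsUnit (G p.1).det)
    (k : Fin n) : dzMatrix k (quadPullback (normalParam G p) G) 0 = 0 := by
  have hw : quadMap (normalParam G p) 0 ∈ U := by simpa [normalParam] using hp
  have hsymm : ∀ a i k, normalQuad G p.1 p.2 a k i = normalQuad G p.1 p.2 a i k := fun a i k => by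
    unfold normalQuad
    congr 1
    refine Finset.sum_congr rfl fun x _ => ?_
    congr 1
    rw [Finset.sum_comm]
    refine Finset.sum_congr rfl fun l _ => Finset.sum_congr rfl fun d _ => ?_
    rw [hk _ hp d x l]
    ring
  have hQ : ∀ b i, ∑ a, normalQuad G p.1 p.2 a k i * G p.1 a b =
      -∑ d, ∑ l, p.2 d i * p.2 l k * dz l (fun z => G z d b) p.1 := fun b i => by
    set T : Matrix (Fin n) (Fin n) ℂ := Matrix.of fun i x =>
      ∑ d, ∑ l, p.2 d i * p.2 l k * dz l (fun z => G z d x) p.1 with hT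
    have h1 : ∀ a, normalQuad G p.1 p.2 a k i = -(T * (G p.1)⁻¹) i a := fun a => by
      simp [normalQuad, hT, Matrix.mul_apply]
    have h2 : ∑ a, normalQuad G p.1 p.2 a k i * G p.1 a b = -(T * (G p.1)⁻¹ * G p.1) i b := by
      rw [Matrix.mul_apply, ← Finset.sum_neg_distrib]
      exact Finset.sum_congr rfl fun a _ => by rw [h1]; ring
    rw [h2, Matrix.mul_assoc, nonsing_inv_mul _ hdet, Matrix.mul_one]
    rfl
  ext i j
  simp only [dzMatrix, of_apply, Matrix.zero_apply]
  rw [dz_quadPullback hG hU _ hw]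
  refine Finset.sum_eq_zero fun b _ => ?_
  convert zero_mul _
  rw [Finset.sum_add_distrib, quadMap_zero, quadJac_zero]
  have h3 : ∑ a, 1 / 2 * ((normalParam G p).2.2 a k i + (normalParam G p).2.2 a i k) *
      G (normalParam G p).1 a b = ∑ a, normalQuad G p.1 p.2 a k i * G p.1 a b := by
    refine Finset.sum_congr rfl fun a _ => ?_
    simp only [normalParam]
    rw [hsymm a k i]
    ring
  rw [h3, hQ]
  simp [normalParam]

end Quadratic

/-! ### Uniform bounds in normal coordinates -/

section UniformBounds

variable {n : ℕ} {U K : Set (Fin n → ℂ)} {χ G H : (Fin n → ℂ) → Matrix (Fin n) (Fin n) ℂ}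
  {F : (Fin n → ℂ) → ℝ}

/-- The unitary frames of a Hermitian metric over `K`: the points of `K` together with a basis of
the tangent space in which the metric is the identity matrix. The second component holds the
vectors of the basis as columns. -/
def unitaryFrames (G : (Fin n → ℂ) → Matrix (Fin n) (Fin n) ℂ) (K : Set (Fin n → ℂ)) :
    Set ((Fin n → ℂ) × (Fin n → Fin n → ℂ)) :=
  {p | p.1 ∈ K ∧ ((Matrix.of p.2).map conj)ᴴ * G p.1 * (Matrix.of p.2).map conj = 1}

lemma quadPullback_normalParam_zero (G H : (Fin n → ℂ) → Matrix (Fin n) (Fin n) ℂ)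
    (p : (Fin n → ℂ) × (Fin n → Fin n → ℂ)) : quadPullback (normalParam G p) H 0 =
      ((Matrix.of p.2).map conj)ᴴ * H p.1 * (Matrix.of p.2).map conj := by
  simp [quadPullback, normalParam]

lemma isUnit_det_of_conjTranspose_mul_mul_eq_one {A R : Matrix (Fin n) (Fin n) ℂ}
    (h : Rᴴ * A * R = 1) : IsUnit R.det :=
  (isUnit_iff_isUnit_det _).1 (IsUnit.of_mul_eq_one_right _ h)

/-- The diagonal entries of a congruent matrix are the values of the form on the columns. -/
lemma conjTranspose_mul_mul_diag (A R : Matrix (Fin n) (Fin n) ℂ) (i : Fin n) :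
    (Rᴴ * A * R) i i = star (R *ᵥ Pi.single i 1) ⬝ᵥ A *ᵥ (R *ᵥ Pi.single i 1) := by
  rw [star_mulVec, ← dotProduct_mulVec, mulVec_mulVec, mulVec_mulVec]
  simp [dotProduct, Pi.single_apply, mulVec]

lemma mulVec_ne_zero_of_isUnit_det {R : Matrix (Fin n) (Fin n) ℂ} (hR : IsUnit R.det)
    {v : Fin n → ℂ} (hv : v ≠ 0) : R *ᵥ v ≠ 0 := fun h => hv <| by
  have h2 : R⁻¹ *ᵥ (R *ᵥ v) = 0 := by rw [h, mulVec_zero]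
  rwa [mulVec_mulVec, nonsing_inv_mul _ hR, one_mulVec] at h2

lemma mulVec_single_ne_zero {R : Matrix (Fin n) (Fin n) ℂ} (hR : IsUnit R.det) (i : Fin n) :
    R *ᵥ Pi.single i 1 ≠ 0 :=
  mulVec_ne_zero_of_isUnit_det hR fun h => by simpa using congrFun h i

lemma inv_eq_mul_conjTranspose {A R : Matrix (Fin n) (Fin n) ℂ} (h : Rᴴ * A * R = 1) :
    A⁻¹ = R * Rᴴ := by
  refine inv_eq_right_inv ?_
  have h1 : R * (Rᴴ * A) = 1 := mul_eq_one_comm.1 h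
  have h2 : Rᴴ * (A * R) = 1 := by rw [← Matrix.mul_assoc, h]
  have h3 : A * R * Rᴴ = 1 := mul_eq_one_comm.1 h2
  rw [← Matrix.mul_assoc, h3]

lemma norm_sq_le_inv_diag {A R : Matrix (Fin n) (Fin n) ℂ} (h : Rᴴ * A * R = 1) (a i : Fin n) :
    ‖R a i‖ ^ 2 ≤ (A⁻¹ a a).re := by
  rw [inv_eq_mul_conjTranspose h, Matrix.mul_apply, Complex.re_sum]
  have h1 : ∀ j, (R a j * Rᴴ j a).re = ‖R a j‖ ^ 2 := fun j => by
    rw [conjTranspose_apply, RCLike.star_def, Complex.mul_conj, Complex.ofReal_re,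
      Complex.normSq_eq_norm_sq]
  simp only [h1]
  exact Finset.single_le_sum (f := fun j => ‖R a j‖ ^ 2) (fun j _ => by positivity)
    (Finset.mem_univ i)

lemma continuousOn_frame_entries (hH : SmoothEntriesOn H U) (hKU : K ⊆ U) (i j : Fin n) :
    ContinuousOn (fun p : (Fin n → ℂ) × (Fin n → Fin n → ℂ) =>
      (((Matrix.of p.2).map conj)ᴴ * H p.1 * (Matrix.of p.2).map conj) i j)
      (K ×ˢ Set.univ) := by
  simp only [Matrix.mul_apply, conjTranspose_apply, map_apply, of_apply, RCLike.star_def,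
    Complex.conj_conj]
  refine continuousOn_finsetSum _ fun b _ => (continuousOn_finsetSum _ fun a _ =>
    ContinuousOn.mul (by fun_prop) ?_).mul ?_
  · exact ((hH a b).continuousOn.mono hKU).comp continuousOn_fst fun p hp => hp.1
  · exact (Complex.continuous_conj.comp (by fun_prop)).continuousOn

/-- The columns of unitary frames are bounded, because `G⁻¹ = R Rᴴ` is bounded over `K`. -/
lemma isCompact_unitaryFrames (hK : IsCompact K) (hKU : K ⊆ U) (hG : SmoothEntriesOn G U)
    (hGp : ∀ w ∈ U, (G w).PosDef) : IsCompact (unitaryFrames G K) := by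
  have hinv : SmoothEntriesOn (fun w => (G w)⁻¹) U :=
    SmoothEntriesOn.inv hG fun w hw => (hGp w hw).det_pos.ne'
  have h1 : ∀ a, ∃ C : ℝ, ∀ z ∈ K, ‖(G z)⁻¹ a a‖ ≤ C := fun a =>
    hK.exists_bound_of_continuousOn ((hinv a a).continuousOn.mono hKU)
  choose C hC using h1
  set B : ℝ := 1 + ∑ a, |C a| with hB
  have hB0 : 0 ≤ ∑ a, |C a| := Finset.sum_nonneg fun a _ => abs_nonneg _
  have hcl : IsClosed ((K ×ˢ (Set.univ : Set (Fin n → Fin n → ℂ))) ∩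
      (fun p => ((Matrix.of p.2).map conj)ᴴ * G p.1 * (Matrix.of p.2).map conj) ⁻¹' {1}) := by
    refine ContinuousOn.preimage_isClosed_of_isClosed ?_ (hK.isClosed.prod isClosed_univ)
      isClosed_singleton
    exact continuousOn_pi.2 fun i => continuousOn_pi.2 fun j =>
      continuousOn_frame_entries hG hKU i j
  have heq : unitaryFrames G K = (K ×ˢ (Set.univ : Set (Fin n → Fin n → ℂ))) ∩
      (fun p => ((Matrix.of p.2).map conj)ᴴ * G p.1 * (Matrix.of p.2).map conj) ⁻¹' {1} := by
    ext p
    simp [unitaryFrames]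
  refine (hK.prod (isCompact_closedBall (0 : Fin n → Fin n → ℂ) B)).of_isClosed_subset
    (heq ▸ hcl) fun p hp => ⟨hp.1, ?_⟩
  rw [mem_closedBall_zero_iff]
  refine (pi_norm_le_iff_of_nonneg (by positivity)).2 fun a =>
    (pi_norm_le_iff_of_nonneg (by positivity)).2 fun i => ?_
  have h2 := norm_sq_le_inv_diag hp.2 a i
  have h3 : ((G p.1)⁻¹ a a).re ≤ ∑ a, |C a| := ((Complex.re_le_norm _).trans (hC a _ hp.1)).trans
    ((le_abs_self _).trans (Finset.single_le_sum (f := fun a => |C a|)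
      (fun a _ => abs_nonneg _) (Finset.mem_univ a)))
  simp only [map_apply, of_apply, RCLike.norm_conj] at h2
  nlinarith [norm_nonneg (p.2 a i), sq_nonneg (‖p.2 a i‖ - 1)]

lemma continuousOn_normalParam (hU : IsOpen U) (hKU : K ⊆ U) (hG : SmoothEntriesOn G U)
    (hGp : ∀ w ∈ U, (G w).PosDef) : ContinuousOn (normalParam G) (unitaryFrames G K) := by
  have hinv : SmoothEntriesOn (fun w => (G w)⁻¹) U :=
    SmoothEntriesOn.inv hG fun w hw => (hGp w hw).det_pos.ne'
  have hmaps : Set.MapsTo Prod.fst (unitaryFrames G K) U := fun p hp => hKU hp.1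
  refine continuousOn_fst.prodMk (continuousOn_snd.prodMk ?_)
  refine continuousOn_pi.2 fun a => continuousOn_pi.2 fun k => continuousOn_pi.2 fun i => ?_
  unfold normalQuad
  refine ContinuousOn.neg (continuousOn_finsetSum _ fun x _ => (continuousOn_finsetSum _ fun d _ =>
    continuousOn_finsetSum _ fun l _ => ContinuousOn.mul (by fun_prop) ?_).mul ?_)
  · exact (ContDiffOn.dz (hG d x) hU l).continuousOn.comp continuousOn_fst hmaps
  · exact (hinv x a).continuousOn.comp continuousOn_fst hmaps

/-- In normal coordinates centred at the points of a compact set, the derivatives of `χ`, `G`, `F`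
of order at most two are bounded, uniformly in the centre and in the unitary frame. -/
lemma exists_bound_normal_derivatives (hU : IsOpen U) (hK : IsCompact K) (hKU : K ⊆ U)
    (hχ : SmoothEntriesOn χ U) (hG : SmoothEntriesOn G U) (hGp : ∀ w ∈ U, (G w).PosDef)
    (hF : ContDiffOn ℝ ∞ F U) :
    ∃ C : ℝ, ∀ p ∈ unitaryFrames G K,
      (∀ i j k, ‖dz k (fun w => quadPullback (normalParam G p) χ w i j) 0‖ ≤ C) ∧
      (∀ i j k, ‖dz k (dzbar k fun w => quadPullback (normalParam G p) χ w i j) 0‖ ≤ C) ∧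
      (∀ i j k, ‖dz k (dzbar k fun w => quadPullback (normalParam G p) G w i j) 0‖ ≤ C) ∧
      ∀ k, ‖complexHessian (fun w => F (quadMap (normalParam G p) w)) 0 k k‖ ≤ C := by
  have hΘ : IsCompact (normalParam G '' unitaryFrames G K) :=
    (isCompact_unitaryFrames hK hKU hG hGp).image_of_continuousOn
      (continuousOn_normalParam hU hKU hG hGp)
  have hD := isOpen_quadMap_preimage_prod (n := n) hU
  have hΘD : ∀ θ ∈ normalParam G '' unitaryFrames G K,
      (θ, (0 : Fin n → ℂ)) ∈ {p : QuadParam n × (Fin n → ℂ) | quadMap p.1 p.2 ∈ U} := by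
    rintro _ ⟨p, hp, rfl⟩
    simpa [normalParam] using hKU hp.1
  choose C₁ hC₁ using fun i j => exists_bound_slice_derivatives
    (contDiffOn_quadPullback_prod hχ i j) hD hΘ hΘD
  choose C₂ hC₂ using fun i j => exists_bound_slice_derivatives
    (contDiffOn_quadPullback_prod hG i j) hD hΘ hΘD
  have hF' : ContDiffOn ℝ ∞ (fun p : QuadParam n × (Fin n → ℂ) => F (quadMap p.1 p.2))
      {p : QuadParam n × (Fin n → ℂ) | quadMap p.1 p.2 ∈ U} :=
    hF.comp contDiff_quadMap_prod.contDiffOn fun p hp => hp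
  obtain ⟨C₃, hC₃⟩ := exists_bound_slice_derivatives (ContDiffOn.ofReal hF') hD hΘ hΘD
  have h1 : ∀ (f : Fin n → Fin n → ℝ) i j, f i j ≤ ∑ i, ∑ j, |f i j| := fun f i j =>
    ((le_abs_self _).trans (Finset.single_le_sum (f := fun j => |f i j|)
      (fun j _ => abs_nonneg _) (Finset.mem_univ j))).trans
      (Finset.single_le_sum (f := fun i => ∑ j, |f i j|)
      (fun i _ => Finset.sum_nonneg fun j _ => abs_nonneg _) (Finset.mem_univ i))
  have h2 : ∀ (f : Fin n → Fin n → ℝ), 0 ≤ ∑ i, ∑ j, |f i j| := fun f =>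
    Finset.sum_nonneg fun i _ => Finset.sum_nonneg fun j _ => abs_nonneg _
  refine ⟨∑ i, ∑ j, |C₁ i j| + ∑ i, ∑ j, |C₂ i j| + |C₃|, fun p hp => ?_⟩
  have hp' := Set.mem_image_of_mem (normalParam G) hp
  refine ⟨fun i j k => (hC₁ i j _ hp' k).1.trans ?_, fun i j k => (hC₁ i j _ hp' k).2.trans ?_,
    fun i j k => (hC₂ i j _ hp' k).2.trans ?_, fun k => (hC₃ _ hp' k).2.trans ?_⟩
  · linarith [h1 C₁ i j, h2 C₂, abs_nonneg C₃]
  · linarith [h1 C₁ i j, h2 C₂, abs_nonneg C₃]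
  · linarith [h2 C₁, h1 C₂ i j, abs_nonneg C₃]
  · linarith [h2 C₁, h2 C₂, le_abs_self C₃]

/-- In unitary frames over a compact set, the diagonal entries of `χ` are bounded, and
the cone condition holds with a uniform gap. -/
lemma exists_cone_gap (hK : IsCompact K) (hKU : K ⊆ U)
    (hχ : SmoothEntriesOn χ U) (hG : SmoothEntriesOn G U) (hGp : ∀ w ∈ U, (G w).PosDef)
    (hF : ContDiffOn ℝ ∞ F U)
    (hcone : ∀ z ∈ U, ∀ x : Fin n → ℂ, x ≠ 0 → 0 < (star x ⬝ᵥ χ z *ᵥ x).re -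
      ((n : ℝ) - 1) / (n * Real.exp (F z)) * (star x ⬝ᵥ G z *ᵥ x).re) :
    ∃ ε C : ℝ, 0 < ε ∧ ∀ p ∈ unitaryFrames G K, ∀ i,
      ((n : ℝ) - 1) / (n * Real.exp (F p.1)) + ε ≤
        (quadPullback (normalParam G p) χ 0 i i).re ∧
      (quadPullback (normalParam G p) χ 0 i i).re ≤ C := by
  have hcomp := isCompact_unitaryFrames hK hKU hG hGp
  have hsub : unitaryFrames G K ⊆ K ×ˢ Set.univ := fun p hp => ⟨hp.1, Set.mem_univ _⟩
  have hc : ∀ i, ContinuousOn (fun p => (quadPullback (normalParam G p) χ 0 i i).re)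
      (unitaryFrames G K) := fun i => by
    simp only [quadPullback_normalParam_zero]
    exact Complex.continuous_re.comp_continuousOn
      ((continuousOn_frame_entries hχ hKU i i).mono hsub)
  have hFc : ContinuousOn (fun p : (Fin n → ℂ) × (Fin n → Fin n → ℂ) =>
      ((n : ℝ) - 1) / (n * Real.exp (F p.1))) (unitaryFrames G K) := by
    rcases Nat.eq_zero_or_pos n with h0 | h0
    · subst h0
      simpa using continuousOn_const
    · refine continuousOn_const.div (continuousOn_const.mul (Real.continuous_exp.comp_continuousOn
        (hF.continuousOn.comp continuousOn_fst fun p hp => hKU hp.1))) fun p _ => ?_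
      positivity
  have hpos : ∀ i, ∀ p ∈ unitaryFrames G K, 0 < (quadPullback (normalParam G p) χ 0 i i).re -
      ((n : ℝ) - 1) / (n * Real.exp (F p.1)) := fun i p hp => by
    set R := (Matrix.of p.2).map conj with hR
    have hRu := isUnit_det_of_conjTranspose_mul_mul_eq_one hp.2
    have h1 := hcone p.1 (hKU hp.1) _ (mulVec_single_ne_zero hRu i)
    rw [← conjTranspose_mul_mul_diag, ← conjTranspose_mul_mul_diag, hp.2] at h1
    simpa [quadPullback_normalParam_zero] using h1
  have h1 : ∀ i, ∃ ε : ℝ, 0 < ε ∧ ∀ p ∈ unitaryFrames G K, ε ≤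
      (quadPullback (normalParam G p) χ 0 i i).re - ((n : ℝ) - 1) / (n * Real.exp (F p.1)) :=
    fun i => hcomp.exists_forall_le' ((hc i).sub hFc) (hpos i)
  have h2 : ∀ i, ∃ C : ℝ, ∀ p ∈ unitaryFrames G K,
      ‖(quadPullback (normalParam G p) χ 0 i i).re‖ ≤ C :=
    fun i => hcomp.exists_bound_of_continuousOn (hc i)
  choose ε hε0 hε using h1
  choose C hC using h2
  obtain ⟨δ, hδ0, hδ⟩ : ∃ δ : ℝ, 0 < δ ∧ ∀ i, δ ≤ ε i := by
    rcases isEmpty_or_nonempty (Fin n) with h | h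
    · exact ⟨1, one_pos, fun i => h.elim i⟩
    · obtain ⟨j, hj⟩ := Finite.exists_min ε
      exact ⟨ε j, hε0 j, hj⟩
  refine ⟨δ, ∑ i, |C i|, hδ0, fun p hp i => ⟨by linarith [hε i p hp, hδ i], ?_⟩⟩
  exact ((Real.le_norm_self _).trans (hC i p hp)).trans ((le_abs_self _).trans
    (Finset.single_le_sum (f := fun i => |C i|) (fun i _ => abs_nonneg _) (Finset.mem_univ i)))

end UniformBounds

/-! ### The largest eigenvalue at a maximum point -/

section Barrier

variable {n : ℕ}

/-- The Cauchy-Schwarz inequality for all but one of the summands. -/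
lemma sq_sum_sub_le (x : Fin n → ℝ) (m : Fin n) :
    (∑ i, x i - x m) ^ 2 ≤ ((n : ℝ) - 1) * ∑ i, x i ^ 2 := by
  have h1 : ∑ i, x i - x m = ∑ i ∈ Finset.univ.erase m, x i := by
    rw [← Finset.add_sum_erase _ _ (Finset.mem_univ m)]
    ring
  have h2 : ((Finset.univ.erase m).card : ℝ) = n - 1 := by
    rw [Finset.card_erase_of_mem (Finset.mem_univ m), Finset.card_univ, Fintype.card_fin,
      Nat.cast_sub m.pos, Nat.cast_one]
  rw [h1, ← h2]
  refine sq_sum_le_card_mul_sum_sq.trans (mul_le_mul_of_nonneg_left ?_ (by positivity))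
  exact Finset.sum_le_sum_of_subset_of_nonneg (Finset.erase_subset _ _) fun i _ _ => sq_nonneg _

/-- The cone condition bounds the coefficient of the barrier term at a maximum point. Here `x i` are
the reciprocals of the eigenvalues, and `v` is the time derivative of the solution. -/
lemma barrier_coefficient_le (hn : 2 ≤ n) {x c : Fin n → ℝ} {v f ε : ℝ} (hx : ∀ i, 0 < x i)
    (hε : 0 < ε) (hv : v = Real.log n - Real.log (∑ i, x i) + f)
    (hc : ∀ i, ((n : ℝ) - 1) / (n * Real.exp f) + ε ≤ c i) (m : Fin n) :
    1 - v - (∑ i, x i)⁻¹ * ∑ i, x i ^ 2 * c i ≤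
      2 * Real.exp (-v) * x m / (∑ i, x i) - ε * (∑ i, x i) / n := by
  set S := ∑ i, x i with hS
  set Q := ∑ i, x i ^ 2 with hQ
  have hn0 : (0 : ℝ) < n := by exact_mod_cast (by omega : 0 < n)
  have hn1 : (0 : ℝ) < n - 1 := by
    have : (2 : ℝ) ≤ n := by exact_mod_cast hn
    linarith
  have hS0 : 0 < S := Finset.sum_pos (fun i _ => hx i) ⟨m, Finset.mem_univ m⟩
  have hnf : n * Real.exp f = S * Real.exp v := by
    rw [hv, Real.exp_add, Real.exp_sub, Real.exp_log hn0, Real.exp_log hS0]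
    field_simp
  have h1 : (((n : ℝ) - 1) / (n * Real.exp f) + ε) * Q ≤ ∑ i, x i ^ 2 * c i := by
    rw [hQ, Finset.mul_sum]
    refine Finset.sum_le_sum fun i _ => ?_
    rw [mul_comm]
    exact mul_le_mul_of_nonneg_left (hc i) (sq_nonneg _)
  have h2 : (S - x m) ^ 2 ≤ (n - 1) * Q := sq_sum_sub_le x m
  have h3 : S ^ 2 ≤ n * Q := by
    have := sq_sum_le_card_mul_sum_sq (s := Finset.univ) (f := x)
    simpa using this
  have h4 : 1 - v ≤ Real.exp (-v) := by linarith [Real.add_one_le_exp (-v)]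
  have h5 : S⁻¹ * ((((n : ℝ) - 1) / (n * Real.exp f) + ε) * Q) ≤ S⁻¹ * ∑ i, x i ^ 2 * c i :=
    mul_le_mul_of_nonneg_left h1 (by positivity)
  have h6 : S⁻¹ * ((((n : ℝ) - 1) / (n * Real.exp f) + ε) * Q) =
      Real.exp (-v) * ((n - 1) * Q / S ^ 2) + ε * (Q / S) := by
    rw [hnf, Real.exp_neg]
    have := (Real.exp_pos v).ne'
    field_simp
  -- all summands of `S` but `x m` are used here, which is where the factor `n - 1` comes from
  have h7 : 1 - 2 * x m / S ≤ (n - 1) * Q / S ^ 2 := by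
    rw [le_div_iff₀ (by positivity)]
    have : (1 - 2 * x m / S) * S ^ 2 = S ^ 2 - 2 * x m * S := by field_simp
    nlinarith [sq_nonneg (x m)]
  have h8 : S / n ≤ Q / S := by
    rw [div_le_div_iff₀ hn0 hS0]
    nlinarith
  have h9 := mul_le_mul_of_nonneg_left h7 (Real.exp_pos (-v)).le
  have h10 := mul_le_mul_of_nonneg_left h8 hε.le
  have h11 : 2 * Real.exp (-v) * x m / S = Real.exp (-v) * (2 * x m / S) := by ring
  have h12 : ε * S / n = ε * (S / n) := by ring
  rw [h11, h12]
  nlinarith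

/-- If the barrier constant `A` is large, then the inequality of `maximum_point_inequality` bounds
the eigenvalue `d m` by a multiple of `ψ²`. -/
lemma exists_barrier_constants (hn : 2 ≤ n) (C B : ℝ) {K ε : ℝ} (hK : 0 ≤ K) (hε : 0 < ε) :
    ∃ A L : ℝ, 2 ≤ A ∧ 1 ≤ L ∧ ∀ (d c : Fin n → ℝ) (f ψ : ℝ) (m : Fin n), (∀ i, 0 < d i) →
      1 ≤ ψ → |Real.log n - Real.log (∑ i, (d i)⁻¹) + f| ≤ C → |f| ≤ B →
      (∀ i, ((n : ℝ) - 1) / (n * Real.exp f) + ε ≤ c i) →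
      0 ≤ 2 * K * (d m)⁻¹ + (2 * K * (d m)⁻¹ + K + 2 * K ^ 2 * (d m)⁻¹ ^ 2 *
        (A + (ψ ^ 2)⁻¹) ^ 2 * ψ ^ 3) * ((∑ i, (d i)⁻¹)⁻¹ * ∑ i, (d i)⁻¹ ^ 2) +
        (A + (ψ ^ 2)⁻¹) * (1 - (Real.log n - Real.log (∑ i, (d i)⁻¹) + f) -
          (∑ i, (d i)⁻¹)⁻¹ * ∑ i, (d i)⁻¹ ^ 2 * c i) → d m ≤ L * ψ ^ 2 := by
  have hn0 : (0 : ℝ) < n := by exact_mod_cast (by omega : 0 < n)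
  set s₀ : ℝ := n * Real.exp (-B - C) with hs₀
  set s₁ : ℝ := n * Real.exp (B + C) with hs₁
  have hs₀0 : 0 < s₀ := by positivity
  have hs₁0 : 0 < s₁ := by positivity
  set δ : ℝ := ε * s₀ / (2 * n) with hδ
  have hδ0 : 0 < δ := by positivity
  -- for `1 / d m ≤ x₀` the coefficient of `A` is at most `-δ`
  set x₀ : ℝ := δ * s₀ / (2 * Real.exp C) with hx₀
  have hx₀0 : 0 < x₀ := by positivity
  set N : ℝ := 2 * K + (3 * K + 2 * K ^ 2) * s₁ with hN
  have hN0 : 0 ≤ N := by positivity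
  set A : ℝ := 2 + N / δ with hA
  have hA2 : 2 ≤ A := by
    have : 0 ≤ N / δ := by positivity
    linarith
  have hAδ : N < A * δ := by
    rw [hA, add_mul, div_mul_cancel₀ _ hδ0.ne']
    linarith
  -- `d m > x₀⁻¹ ψ²` makes the coefficient of `A` negative, and `d m > (A + 1) ψ²` bounds the term
  -- that is produced by the gradient of the solution
  refine ⟨A, x₀⁻¹ + (A + 1), hA2, by linarith [inv_pos.2 hx₀0], ?_⟩
  intro d c f ψ m hd hψ hv hf hc hineq
  by_contra hcon
  push Not at hcon
  set v := Real.log n - Real.log (∑ i, (d i)⁻¹) + f with hvdef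
  set S := ∑ i, (d i)⁻¹ with hS
  have hx : ∀ i, 0 < (d i)⁻¹ := fun i => inv_pos.2 (hd i)
  have hS0 : 0 < S := Finset.sum_pos (fun i _ => hx i) ⟨m, Finset.mem_univ m⟩
  have hSv : S = n * Real.exp (f - v) := by
    have h : f - v = Real.log S - Real.log n := by rw [hvdef]; ring
    rw [h, Real.exp_sub, Real.exp_log hS0, Real.exp_log hn0]
    field_simp
  obtain ⟨hv1, hv2⟩ := abs_le.1 hv
  obtain ⟨hf1, hf2⟩ := abs_le.1 hf
  have hS1 : s₀ ≤ S := by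
    rw [hSv]
    exact mul_le_mul_of_nonneg_left (Real.exp_le_exp.2 (by linarith)) hn0.le
  have hS2 : S ≤ s₁ := by
    rw [hSv]
    exact mul_le_mul_of_nonneg_left (Real.exp_le_exp.2 (by linarith)) hn0.le
  have hb := barrier_coefficient_le hn hx hε hvdef hc m
  rw [← hS] at hb
  have hψ2 : 1 ≤ ψ ^ 2 := one_le_pow₀ hψ
  have hdm0 : x₀⁻¹ ≤ x₀⁻¹ * ψ ^ 2 := le_mul_of_one_le_right (inv_pos.2 hx₀0).le hψ2
  have hdm3 : (0 : ℝ) ≤ (A + 1) * ψ ^ 2 := by positivity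
  rw [add_mul] at hcon
  have hdm1 : x₀⁻¹ ≤ d m := by linarith
  have hdm2 : (A + 1) * ψ ^ 2 ≤ d m := by linarith [inv_pos.2 hx₀0]
  set y := (d m)⁻¹ with hy
  have hy0 : 0 < y := hx m
  have hyd : y * d m = 1 := inv_mul_cancel₀ (hd m).ne'
  have hy1 : y ≤ x₀ := by
    rw [hy]
    exact inv_le_of_inv_le₀ hx₀0 hdm1
  have hy2 : y * ((A + 1) * ψ ^ 2) ≤ 1 :=
    (mul_le_mul_of_nonneg_left hdm2 hy0.le).trans_eq hyd
  have hy3 : y ≤ 1 := by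
    have h : 1 ≤ (A + 1) * ψ ^ 2 := one_le_mul_of_one_le_of_one_le (by linarith) hψ2
    exact (le_mul_of_one_le_right hy0.le h).trans hy2
  set E := 1 - v - S⁻¹ * ∑ i, (d i)⁻¹ ^ 2 * c i with hE
  -- the coefficient of the barrier constant is negative
  have hE1 : E ≤ -δ := by
    refine hb.trans ?_
    have h1 : 2 * Real.exp (-v) * y / S ≤ 2 * Real.exp C * x₀ / s₀ := by
      refine div_le_div₀ (by positivity) ?_ hs₀0 hS1
      refine mul_le_mul ?_ hy1 hy0.le (by positivity)
      exact mul_le_mul_of_nonneg_left (Real.exp_le_exp.2 (by linarith)) (by norm_num)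
    have h2 : 2 * Real.exp C * x₀ / s₀ = δ := by
      rw [hx₀]
      field_simp
    have h3 : ε * S / n ≥ 2 * δ := by
      have : 2 * δ = ε * s₀ / n := by rw [hδ]; field_simp
      rw [this]
      exact div_le_div_of_nonneg_right (mul_le_mul_of_nonneg_left hS1 hε.le) hn0.le
    linarith
  set Q := S⁻¹ * ∑ i, (d i)⁻¹ ^ 2 with hQ
  have hQ0 : 0 ≤ Q := mul_nonneg (inv_nonneg.2 hS0.le) (Finset.sum_nonneg fun i _ => sq_nonneg _)
  have hQ1 : Q ≤ s₁ := by
    refine le_trans ?_ hS2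
    rw [hQ, inv_mul_le_iff₀ hS0]
    conv_rhs => rw [hS, Finset.sum_mul]
    refine Finset.sum_le_sum fun i _ => ?_
    rw [sq]
    refine mul_le_mul_of_nonneg_left ?_ (hx i).le
    exact Finset.single_le_sum (f := fun i => (d i)⁻¹) (fun i _ => (hx i).le) (Finset.mem_univ i)
  set a := (ψ ^ 2)⁻¹ with ha
  have ha0 : 0 < a := by positivity
  have ha1 : a ≤ 1 := inv_le_one_of_one_le₀ hψ2
  -- the term produced by the gradient of the barrier
  have hgrad : 2 * K ^ 2 * y ^ 2 * (A + a) ^ 2 * ψ ^ 3 ≤ 2 * K ^ 2 := by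
    have h1 : y * (A + a) * ψ ^ 2 ≤ 1 := by
      refine le_trans ?_ hy2
      rw [mul_assoc]
      refine mul_le_mul_of_nonneg_left ?_ hy0.le
      exact mul_le_mul_of_nonneg_right (by linarith) (by positivity)
    have h2 : (y * (A + a) * ψ ^ 2) ^ 2 ≤ 1 := pow_le_one₀ (by positivity) h1
    have h3 : y ^ 2 * (A + a) ^ 2 * ψ ^ 3 ≤ (y * (A + a) * ψ ^ 2) ^ 2 := by
      have : ψ ^ 3 ≤ ψ ^ 4 := pow_le_pow_right₀ hψ (by norm_num)
      calc y ^ 2 * (A + a) ^ 2 * ψ ^ 3 ≤ y ^ 2 * (A + a) ^ 2 * ψ ^ 4 :=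
            mul_le_mul_of_nonneg_left this (by positivity)
        _ = _ := by ring
    calc _ = 2 * K ^ 2 * (y ^ 2 * (A + a) ^ 2 * ψ ^ 3) := by ring
      _ ≤ 2 * K ^ 2 * 1 := mul_le_mul_of_nonneg_left (h3.trans h2) (by positivity)
      _ = _ := by ring
  have hKy : K * y ≤ K := mul_le_of_le_one_right hK hy3
  have h1 : (2 * K * y + K + 2 * K ^ 2 * y ^ 2 * (A + a) ^ 2 * ψ ^ 3) * Q ≤
      (3 * K + 2 * K ^ 2) * s₁ :=
    mul_le_mul (by linarith) hQ1 hQ0 (by positivity)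
  have h2 : (A + a) * E ≤ -(A * δ) := by
    have h3 : (A + a) * E ≤ (A + a) * -δ := mul_le_mul_of_nonneg_left hE1 (by linarith)
    have h4 : 0 < a * δ := by positivity
    linarith
  linarith

end Barrier

/-! ### The test function and its maximum -/

section TestFunction

variable {n : ℕ}

/-- The value of the Hermitian form with coefficients `A` on the vector `v`. -/
noncomputable def hermValue (A : Matrix (Fin n) (Fin n) ℂ) (v : Fin n → ℂ) : ℝ :=
  (star v ⬝ᵥ A *ᵥ v).re

lemma hermValue_congr (A R : Matrix (Fin n) (Fin n) ℂ) (v : Fin n → ℂ) :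
    hermValue (Rᴴ * A * R) v = hermValue A (R *ᵥ v) := by
  unfold hermValue
  rw [star_mulVec, ← dotProduct_mulVec, mulVec_mulVec, mulVec_mulVec, Matrix.mul_assoc]

lemma hermValue_mulVec_single (A R : Matrix (Fin n) (Fin n) ℂ) (i : Fin n) :
    hermValue A (R *ᵥ Pi.single i 1) = ((Rᴴ * A * R) i i).re := by
  rw [conjTranspose_mul_mul_diag]
  rfl

lemma hermValue_pos {A : Matrix (Fin n) (Fin n) ℂ} (hA : A.PosDef) {v : Fin n → ℂ} (hv : v ≠ 0) :
    0 < hermValue A v :=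
  (Complex.pos_iff.1 (hA.dotProduct_mulVec_pos hv)).1

lemma hermValue_smul (A : Matrix (Fin n) (Fin n) ℂ) (c : ℝ) (v : Fin n → ℂ) :
    hermValue A ((c : ℂ) • v) = c ^ 2 * hermValue A v := by
  unfold hermValue
  rw [star_smul, mulVec_smul, smul_dotProduct, dotProduct_smul, smul_smul, RCLike.star_def,
    Complex.conj_ofReal, ← Complex.ofReal_mul, smul_eq_mul, Complex.re_ofReal_mul, sq]

lemma hermValue_diagonal (d : Fin n → ℝ) (v : Fin n → ℂ) :
    hermValue (diagonal fun i => (d i : ℂ)) v = ∑ i, d i * ‖v i‖ ^ 2 := by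
  unfold hermValue
  simp only [dotProduct, mulVec_diagonal, Pi.star_apply, RCLike.star_def, Complex.re_sum]
  refine Finset.sum_congr rfl fun i _ => ?_
  rw [mul_left_comm, Complex.conj_mul', ← Complex.ofReal_pow, ← Complex.ofReal_mul,
    Complex.ofReal_re]

/-- The maximum of a Hermitian form relative to another one is the largest eigenvalue. -/
lemma hermValue_le_of_simultaneous_diagonal {G X R : Matrix (Fin n) (Fin n) ℂ} {d : Fin n → ℝ}
    (hR : IsUnit R.det) (hG : Rᴴ * G * R = 1) (hX : Rᴴ * X * R = diagonal fun i => (d i : ℂ))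
    {m : Fin n} (hm : ∀ i, d i ≤ d m) (v : Fin n → ℂ) :
    hermValue X v ≤ d m * hermValue G v := by
  have hv : R *ᵥ (R⁻¹ *ᵥ v) = v := by
    rw [mulVec_mulVec, mul_nonsing_inv _ hR, one_mulVec]
  rw [← hv, ← hermValue_congr X R, ← hermValue_congr G R, hG, hX, ← diagonal_one]
  have h1 : (diagonal fun _ => 1 : Matrix (Fin n) (Fin n) ℂ) =
      diagonal fun _ => ((1 : ℝ) : ℂ) := by simp
  rw [h1, hermValue_diagonal, hermValue_diagonal, Finset.mul_sum]
  refine Finset.sum_le_sum fun i _ => ?_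
  rw [one_mul]
  exact mul_le_mul_of_nonneg_right (hm i) (sq_nonneg _)

variable {M : Type*} [TopologicalSpace M] [ChartedSpace (Fin n → ℂ) M]
  {χ g : HermitianMetric n M} {F : M → ℝ} {T : EReal} {φ : ℝ → M → ℝ} {A m₀ : ℝ}
  {e e' : OpenPartialHomeomorph M (Fin n → ℂ)}

/-- The function `log χ_φ(v, v) - log ω(v, v) - A φ + 1 / (φ - m₀ + 1)` of a point, given by its
coordinates `z` in the chart `e`, and a tangent vector `v` there. Its maximum over `v` is the
logarithm of the largest eigenvalue of `χ_φ` with respect to `ω`, plus the barrier terms. -/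
noncomputable def testFunction (χ g : HermitianMetric n M) (A m₀ : ℝ) (u : M → ℝ)
    (e : OpenPartialHomeomorph M (Fin n → ℂ)) (z v : Fin n → ℂ) : ℝ :=
  Real.log (hermValue (χ.perturbedCoeff u e z) v) - Real.log (hermValue (g.coeff e z) v) -
    A * u (e.symm z) + (u (e.symm z) - m₀ + 1)⁻¹

lemma testFunction_smul {u : M → ℝ} {z v : Fin n → ℂ}
    (hX : 0 < hermValue (χ.perturbedCoeff u e z) v) (hG : 0 < hermValue (g.coeff e z) v) {c : ℝ}
    (hc : c ≠ 0) :
    testFunction χ g A m₀ u e z ((c : ℂ) • v) = testFunction χ g A m₀ u e z v := by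
  unfold testFunction
  rw [hermValue_smul, hermValue_smul, Real.log_mul (pow_ne_zero 2 hc) hX.ne',
    Real.log_mul (pow_ne_zero 2 hc) hG.ne']
  ring

variable [IsManifold 𝓘(ℂ, Fin n → ℂ) ω M]

lemma testFunction_transition (he : e ∈ atlas (Fin n → ℂ) M) (he' : e' ∈ atlas (Fin n → ℂ) M)
    {z : Fin n → ℂ} (hz : z ∈ e.target ∩ e.symm ⁻¹' e'.source) {u : M → ℝ}
    (hu : ContDiffOn ℝ ∞ (fun w => u (e'.symm w)) e'.target) (v : Fin n → ℂ) :
    testFunction χ g A m₀ u e z v = testFunction χ g A m₀ u e' (transition e e' z)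
      ((jacobian (transition e e') z).map conj *ᵥ v) := by
  unfold testFunction
  rw [χ.perturbedCoeff_transition he he' hz hu, g.coeff_transition he he' hz, hermValue_congr,
    hermValue_congr, symm_transition hz]

lemma continuousOn_hermValue {E : Type*} [TopologicalSpace E] {D : Set E}
    {H : E → Matrix (Fin n) (Fin n) ℂ} {v : E → Fin n → ℂ}
    (hH : ∀ i j, ContinuousOn (fun p => H p i j) D) (hv : ContinuousOn v D) :
    ContinuousOn (fun p => hermValue (H p) (v p)) D := by
  have hvi : ∀ i, ContinuousOn (fun p => v p i) D := fun i => continuousOn_pi.1 hv i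
  unfold hermValue
  simp only [dotProduct, mulVec, Pi.star_apply, RCLike.star_def]
  refine Complex.continuous_re.comp_continuousOn (continuousOn_finsetSum _ fun i _ =>
    (Complex.continuous_conj.comp_continuousOn (hvi i)).mul (continuousOn_finsetSum _ fun j _ =>
      (hH i j).mul (hvi j)))

lemma continuousOn_testFunction (h : IsSmoothSolution χ g F T φ) (hT : 0 < T)
    (hm : ∀ t ∈ timeInterval T, ∀ y, m₀ ≤ φ t y) (he : e ∈ atlas (Fin n → ℂ) M) :
    ContinuousOn (fun p : ℝ × (Fin n → ℂ) × (Fin n → ℂ) =>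
      testFunction χ g A m₀ (φ p.1) e p.2.1 p.2.2)
      (timeInterval T ×ˢ e.target ×ˢ {v | v ≠ 0}) := by
  set D : Set (ℝ × (Fin n → ℂ) × (Fin n → ℂ)) := timeInterval T ×ˢ e.target ×ˢ {v | v ≠ 0} with hD
  set f : ℝ × (Fin n → ℂ) × (Fin n → ℂ) → ℝ × (Fin n → ℂ) := fun p => (p.1, p.2.1) with hf
  have hmap : Set.MapsTo f D (timeInterval T ×ˢ e.target) := fun p hp => ⟨hp.1, hp.2.1⟩
  have hproj : ContinuousOn f D := by fun_prop
  have hv : ContinuousOn (fun p : ℝ × (Fin n → ℂ) × (Fin n → ℂ) => p.2.2) D := by fun_prop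
  have hφ : ContinuousOn (fun p : ℝ × (Fin n → ℂ) × (Fin n → ℂ) => φ p.1 (e.symm p.2.1)) D :=
    ContinuousOn.comp (g := fun q : ℝ × (Fin n → ℂ) => φ q.1 (e.symm q.2)) (f := f)
      (h.contDiffOn he).continuousOn hproj hmap
  have hX : ContinuousOn (fun p : ℝ × (Fin n → ℂ) × (Fin n → ℂ) =>
      hermValue (χ.perturbedCoeff (φ p.1) e p.2.1) p.2.2) D :=
    continuousOn_hermValue (fun i j => ContinuousOn.comp
      (g := fun q : ℝ × (Fin n → ℂ) => χ.perturbedCoeff (φ q.1) e q.2 i j) (f := f)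
      (h.perturbedCoeff_contDiffOn hT he i j).continuousOn hproj hmap) hv
  have hG : ContinuousOn (fun p : ℝ × (Fin n → ℂ) × (Fin n → ℂ) =>
      hermValue (g.coeff e p.2.1) p.2.2) D :=
    continuousOn_hermValue (fun i j => ContinuousOn.comp (g := fun z => g.coeff e z i j)
      (f := fun p : ℝ × (Fin n → ℂ) × (Fin n → ℂ) => p.2.1) (t := e.target)
      (g.coeff_smooth he i j).continuousOn (by fun_prop) fun p hp => hp.2.1) hv
  have hX0 : ∀ p ∈ D, hermValue (χ.perturbedCoeff (φ p.1) e p.2.1) p.2.2 ≠ 0 := fun p hp =>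
    (hermValue_pos (h.pos _ hp.1 e he _ hp.2.1) hp.2.2).ne'
  have hG0 : ∀ p ∈ D, hermValue (g.coeff e p.2.1) p.2.2 ≠ 0 := fun p hp =>
    (hermValue_pos (g.coeff_posDef he hp.2.1) hp.2.2).ne'
  have hψ0 : ∀ p ∈ D, φ p.1 (e.symm p.2.1) - m₀ + 1 ≠ 0 := fun p hp => by
    have := hm p.1 hp.1 (e.symm p.2.1)
    linarith
  have hψ : ContinuousOn (fun p : ℝ × (Fin n → ℂ) × (Fin n → ℂ) =>
      φ p.1 (e.symm p.2.1) - m₀ + 1) D :=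
    (hφ.sub continuousOn_const).add continuousOn_const
  unfold testFunction
  exact (((hX.log hX0).sub (hG.log hG0)).sub (continuousOn_const.mul hφ)).add (hψ.inv₀ hψ0)

/-- The test function attains its maximum over `[0, τ]`, at a point of one of finitely many given
coordinate balls, provided that these cover `M`. -/
lemma exists_max_testFunction (hn : 0 < n) (h : IsSmoothSolution χ g F T φ) (hT : 0 < T)
    (hm : ∀ t ∈ timeInterval T, ∀ y, m₀ ≤ φ t y) {s : Finset M} {r : M → ℝ}
    (hr : ∀ x, 0 < r x ∧ Metric.closedBall (chartAt (Fin n → ℂ) x x) (r x) ⊆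
      (chartAt (Fin n → ℂ) x).target)
    (hs : ∀ y, ∃ x ∈ s, y ∈ (chartAt (Fin n → ℂ) x).source ∧
      chartAt (Fin n → ℂ) x y ∈ Metric.closedBall (chartAt (Fin n → ℂ) x x) (r x))
    [Nonempty M] {τ : ℝ} (hτ : τ ∈ timeInterval T) :
    ∃ t ∈ Set.Icc 0 τ, ∃ x ∈ s, ∃ z ∈ Metric.closedBall (chartAt (Fin n → ℂ) x x) (r x),
      ∃ v : Fin n → ℂ, v ≠ 0 ∧ ∀ t' ∈ Set.Icc 0 τ, ∀ e ∈ atlas (Fin n → ℂ) M, ∀ z' ∈ e.target,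
        ∀ v' : Fin n → ℂ, v' ≠ 0 → testFunction χ g A m₀ (φ t') e z' v' ≤
          testFunction χ g A m₀ (φ t) (chartAt (Fin n → ℂ) x) z v := by
  have : Nonempty (Fin n) := ⟨⟨0, hn⟩⟩
  have hτ0 : 0 ≤ τ := hτ.1
  have hne : ∀ {v : Fin n → ℂ}, v ∈ Metric.sphere (0 : Fin n → ℂ) 1 → v ≠ 0 := fun hv h0 => by
    simp [h0] at hv
  -- the maximum over one ball
  have h1 : ∀ x : M, ∃ p : ℝ × (Fin n → ℂ) × (Fin n → ℂ), p ∈ Set.Icc 0 τ ×ˢ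
      Metric.closedBall (chartAt (Fin n → ℂ) x x) (r x) ×ˢ Metric.sphere (0 : Fin n → ℂ) 1 ∧
      ∀ q ∈ Set.Icc 0 τ ×ˢ Metric.closedBall (chartAt (Fin n → ℂ) x x) (r x) ×ˢ
        Metric.sphere (0 : Fin n → ℂ) 1,
        testFunction χ g A m₀ (φ q.1) (chartAt (Fin n → ℂ) x) q.2.1 q.2.2 ≤
          testFunction χ g A m₀ (φ p.1) (chartAt (Fin n → ℂ) x) p.2.1 p.2.2 := fun x => by
    refine IsCompact.exists_isMaxOn (isCompact_Icc.prod ((isCompact_closedBall _ _).prod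
      (isCompact_sphere _ _))) ?_ ((continuousOn_testFunction h hT hm
        (chart_mem_atlas _ x)).mono ?_)
    · exact (Set.nonempty_Icc.2 hτ0).prod ((Metric.nonempty_closedBall.2 (hr x).1.le).prod
        (NormedSpace.sphere_nonempty.2 zero_le_one))
    · exact Set.prod_mono (Icc_subset_timeInterval hτ) (Set.prod_mono (hr x).2 fun v hv => hne hv)
  choose p hp hpmax using h1
  have hsne : s.Nonempty := by
    obtain ⟨x, hx, -⟩ := hs (Classical.arbitrary M)
    exact ⟨x, hx⟩
  obtain ⟨x, hx, hxmax⟩ := s.exists_max_image (fun x =>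
    testFunction χ g A m₀ (φ (p x).1) (chartAt (Fin n → ℂ) x) (p x).2.1 (p x).2.2) hsne
  refine ⟨(p x).1, (hp x).1, x, hx, (p x).2.1, (hp x).2.1, (p x).2.2, hne (hp x).2.2, ?_⟩
  intro t' ht' e he z' hz' v' hv'
  obtain ⟨y, hy, hysource, hyball⟩ := hs (e.symm z')
  have hy' := chart_mem_atlas (Fin n → ℂ) y
  have hzz : z' ∈ e.target ∩ e.symm ⁻¹' (chartAt (Fin n → ℂ) y).source := ⟨hz', hysource⟩
  have ht'' := Icc_subset_timeInterval hτ ht'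
  rw [testFunction_transition he hy' hzz (h.contDiffOn_slice hy' ht'')]
  set z'' := transition e (chartAt (Fin n → ℂ) y) z' with hz''
  set v'' := (jacobian (transition e (chartAt (Fin n → ℂ) y)) z').map conj *ᵥ v' with hv''
  have hv0 : v'' ≠ 0 := mulVec_ne_zero_of_isUnit_det (jacobian_transition_isUnit he hy' hzz) hv'
  have hzt : z'' ∈ (chartAt (Fin n → ℂ) y).target := transition_mapsTo _ _ hzz
  have hnorm : ‖v''‖ ≠ 0 := norm_ne_zero_iff.2 hv0
  rw [← testFunction_smul (hermValue_pos (h.pos _ ht'' _ hy' _ hzt) hv0)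
    (hermValue_pos (g.coeff_posDef hy' hzt) hv0) (inv_ne_zero hnorm)]
  refine (hpmax y (t', z'', ((‖v''‖⁻¹ : ℝ) : ℂ) • v'') ⟨ht', hyball, ?_⟩).trans (hxmax y hy)
  rw [mem_sphere_zero_iff_norm, norm_smul, Complex.norm_real, norm_inv, norm_norm,
    inv_mul_cancel₀ hnorm]

end TestFunction

/-! ### The estimate at a maximum point of the test function -/

section MaximumPoint

variable {n : ℕ} {M : Type*} [TopologicalSpace M] [ChartedSpace (Fin n → ℂ) M]
  {χ g : HermitianMetric n M} {F : M → ℝ} {T : EReal}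
  {φ : ℝ → M → ℝ} {A m₀ : ℝ} {e : OpenPartialHomeomorph M (Fin n → ℂ)}

/-- The coefficients of `χ + √-1 ∂∂̄u` in the coordinates given by a quadratic map. -/
lemma quadPullback_perturbedCoeff (θ : QuadParam n)
    {w : Fin n → ℂ} (hw : quadMap θ w ∈ e.target) {u : M → ℝ}
    (hu : ContDiffOn ℝ ∞ (fun w => u (e.symm w)) e.target) :
    quadPullback θ (χ.coeff e) w + complexHessian (fun w => u (e.symm (quadMap θ w))) w =
      quadPullback θ (χ.perturbedCoeff u e) w := by
  have hopen : IsOpen (quadMap θ ⁻¹' e.target) :=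
    e.open_target.preimage (contDiff_quadMap θ).continuous
  rw [complexHessian_comp_holomorphic (u := fun w => u (e.symm w)) hu e.open_target
    (contDiff_quadMap θ).contDiffOn hopen (fun _ h => h) hw, jacobian_quadMap]
  unfold quadPullback HermitianMetric.perturbedCoeff
  rw [Matrix.mul_add, Matrix.add_mul]

lemma isUnit_det_quadJac_conj {θ : QuadParam n} {w : Fin n → ℂ} (h : (quadJac θ w).det ≠ 0) :
    IsUnit ((quadJac θ w).map conj).det := by
  have h2 : ((quadJac θ w).map conj).det = conj (quadJac θ w).det := by
    rw [← RingHom.mapMatrix_apply, RingHom.map_det]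
  rw [h2, isUnit_iff_ne_zero]
  simpa using h

lemma continuous_quadJac_det (θ : QuadParam n) : Continuous fun w => (quadJac θ w).det := by
  refine Continuous.matrix_det ?_
  refine continuous_pi fun a => continuous_pi fun i => ?_
  simp only [quadJac, of_apply]
  fun_prop

variable [IsManifold 𝓘(ℂ, Fin n → ℂ) ω M]

/-- The inequality of `maximum_point_inequality` at a maximum point of the test function, obtained
in normal coordinates for `ω` in which `χ_φ` is diagonal. -/
lemma inequality_at_max_testFunction (h : IsSmoothSolution χ g F T φ) (hg : g.IsKahler)
    (hF : ContMDiff 𝓘(ℝ, Fin n → ℂ) 𝓘(ℝ, ℝ) ∞ F)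
    (hm : ∀ t ∈ timeInterval T, ∀ y, m₀ ≤ φ t y) (he : e ∈ atlas (Fin n → ℂ) M) {t : ℝ}
    (ht : t ∈ timeInterval T) (ht0 : 0 < t) {p : (Fin n → ℂ) × (Fin n → Fin n → ℂ)}
    (hz : p.1 ∈ e.target) {R : Matrix (Fin n) (Fin n) ℂ} (hR : (Matrix.of p.2).map conj = R)
    {d : Fin n → ℝ} (hRG : Rᴴ * g.coeff e p.1 * R = 1)
    (hRX : Rᴴ * χ.perturbedCoeff (φ t) e p.1 * R = diagonal fun i => (d i : ℂ))
    (m : Fin n) (hA : 0 ≤ A)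
    (hmax : ∀ t' ∈ Set.Icc 0 t, ∀ z' ∈ e.target, ∀ v' : Fin n → ℂ, v' ≠ 0 →
      testFunction χ g A m₀ (φ t') e z' v' ≤
        testFunction χ g A m₀ (φ t) e p.1 (R *ᵥ Pi.single m 1)) {K : ℝ}
    (hχ1 : ∀ i j k, ‖dz k (fun w =>
      quadPullback (normalParam (g.coeff e) p) (χ.coeff e) w i j) 0‖ ≤ K)
    (hχ2 : ∀ i j k, ‖dz k (dzbar k fun w =>
      quadPullback (normalParam (g.coeff e) p) (χ.coeff e) w i j) 0‖ ≤ K)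
    (hG2 : ∀ i j k, ‖dz k (dzbar k fun w =>
      quadPullback (normalParam (g.coeff e) p) (g.coeff e) w i j) 0‖ ≤ K)
    (hF2 : ∀ k, ‖complexHessian (fun w =>
      F (e.symm (quadMap (normalParam (g.coeff e) p) w))) 0 k k‖ ≤ K) :
    0 ≤ 2 * K * (d m)⁻¹ + (2 * K * (d m)⁻¹ + K + 2 * K ^ 2 * (d m)⁻¹ ^ 2 *
        (A + ((φ t (e.symm p.1) - m₀ + 1) ^ 2)⁻¹) ^ 2 * (φ t (e.symm p.1) - m₀ + 1) ^ 3) *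
        ((∑ i, (d i)⁻¹)⁻¹ * ∑ i, (d i)⁻¹ ^ 2) +
      (A + ((φ t (e.symm p.1) - m₀ + 1) ^ 2)⁻¹) *
        (1 - (Real.log n - Real.log (∑ i, (d i)⁻¹) + F (e.symm p.1)) -
          (∑ i, (d i)⁻¹)⁻¹ * ∑ i, (d i)⁻¹ ^ 2 *
            (quadPullback (normalParam (g.coeff e) p) (χ.coeff e) 0 i i).re) := by
  obtain ⟨b, htb, hb⟩ := exists_lt_mem_timeInterval ht
  have hIoo : Set.Ioo 0 b ⊆ timeInterval T := fun s hs =>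
    Icc_subset_timeInterval hb ⟨hs.1.le, hs.2.le⟩
  set θ := normalParam (g.coeff e) p with hθ
  have hθ0 : quadMap θ 0 = p.1 := by simp [hθ, normalParam]
  have hJ0 : (quadJac θ 0).map conj = R := by simp [hθ, normalParam, hR]
  have hq : ContDiff ℝ ∞ (quadMap θ) := (contDiff_quadMap θ).restrict_scalars ℝ
  set U : Set (Fin n → ℂ) := quadMap θ ⁻¹' e.target ∩ {w | (quadJac θ w).det ≠ 0} with hUdef
  have hU : IsOpen U := (e.open_target.preimage hq.continuous).inter
    (isOpen_ne.preimage (continuous_quadJac_det θ))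
  have hRu := isUnit_det_of_conjTranspose_mul_mul_eq_one hRG
  have h0U : (0 : Fin n → ℂ) ∈ U := by
    refine ⟨by simpa [hθ0] using hz, fun h0 => ?_⟩
    have h1 : ((quadJac θ 0).map conj).det = conj (quadJac θ 0).det := by
      rw [← RingHom.mapMatrix_apply, RingHom.map_det]
    rw [hJ0, h0, map_zero] at h1
    exact hRu.ne_zero h1
  have hUt : Set.MapsTo (quadMap θ) U e.target := fun w hw => hw.1
  have hRw : ∀ w ∈ U, IsUnit ((quadJac θ w).map conj).det := fun w hw =>
    isUnit_det_quadJac_conj hw.2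
  have hX : ∀ s ∈ Set.Ioo 0 b, ∀ w ∈ U, quadPullback θ (χ.coeff e) w +
      complexHessian (fun w => φ s (e.symm (quadMap θ w))) w =
        quadPullback θ (χ.perturbedCoeff (φ s) e) w := fun s hs w hw =>
    quadPullback_perturbedCoeff θ (hUt hw) (h.contDiffOn_slice he (hIoo hs))
  have htI : t ∈ Set.Ioo 0 b := ⟨ht0, htb⟩
  have hm1 : ∀ w : Fin n → ℂ, w ∈ U → (quadJac θ w).map conj *ᵥ Pi.single m 1 ≠ 0 :=
    fun w hw => mulVec_single_ne_zero (hRw w hw) m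
  -- the test function in the new coordinates
  have htest : ∀ s ∈ Set.Ioo 0 b, ∀ w ∈ U,
      Real.log (quadPullback θ (χ.coeff e) w m m +
        complexHessian (fun w => φ s (e.symm (quadMap θ w))) w m m).re -
      Real.log (quadPullback θ (g.coeff e) w m m).re - A * φ s (e.symm (quadMap θ w)) +
        (φ s (e.symm (quadMap θ w)) - m₀ + 1)⁻¹ =
      testFunction χ g A m₀ (φ s) e (quadMap θ w)
        ((quadJac θ w).map conj *ᵥ Pi.single m 1) := fun s hs w hw => by
    rw [← Matrix.add_apply, hX s hs w hw]
    unfold testFunction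
    rw [hermValue_mulVec_single, hermValue_mulVec_single]
    rfl
  have htest0 : testFunction χ g A m₀ (φ t) e p.1 (R *ᵥ Pi.single m 1) =
      testFunction χ g A m₀ (φ t) e (quadMap θ 0) ((quadJac θ 0).map conj *ᵥ Pi.single m 1) := by
    rw [hθ0, hJ0]
  have hus : ContDiffOn ℝ ∞ (fun q : ℝ × (Fin n → ℂ) => φ q.1 (e.symm (quadMap θ q.2)))
      (Set.Ioo 0 b ×ˢ U) := by
    have h1 : ContDiff ℝ ∞ fun q : ℝ × (Fin n → ℂ) => (q.1, quadMap θ q.2) :=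
      contDiff_fst.prodMk (hq.comp contDiff_snd)
    exact ContDiffOn.comp (g := fun q : ℝ × (Fin n → ℂ) => φ q.1 (e.symm q.2))
      (f := fun q : ℝ × (Fin n → ℂ) => (q.1, quadMap θ q.2)) (h.contDiffOn he) h1.contDiffOn
      fun q hq => ⟨hIoo hq.1, hUt hq.2⟩
  have hkah : ∀ w ∈ e.target, ∀ i j k, dz k (fun w => g.coeff e w i j) w =
      dz i (fun w => g.coeff e w k j) w := fun w hw i j k => hg e he w hw i j k
  have key := maximum_point_inequality (χ := quadPullback θ (χ.coeff e))
    (G := quadPullback θ (g.coeff e)) (F := fun w => F (e.symm (quadMap θ w)))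
    (u := fun q => φ q.1 (e.symm (quadMap θ q.2))) (d := d) (m₀ := m₀) (A := A) (K := K)
    hU h0U htI
    (fun i j => (smoothEntriesOn_quadPullback (χ.coeff_smooth he) θ i j).mono
      Set.inter_subset_left)
    (fun i j => (smoothEntriesOn_quadPullback (g.coeff_smooth he) θ i j).mono
      Set.inter_subset_left)
    ((contDiffOn_comp_symm hF he).comp hq.contDiffOn hUt) hus
    (fun s hs w hw => by
      rw [hX s hs w hw]
      exact posDef_congr (h.pos s (hIoo hs) e he _ (hUt hw)) (hRw w hw))
    (fun w hw => posDef_congr (g.coeff_posDef he (hUt hw)) (hRw w hw))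
    (fun w hw => by
      rw [hX t htI w hw]
      unfold quadPullback
      rw [trace_inv_mul_congr (hRw w hw), ← log_topFormRatio m.pos (h.pos t ht e he _ (hUt hw))
        (g.coeff_posDef he (hUt hw))]
      exact h.hasDerivAt ht ht0 he (hUt hw))
    (by
      rw [hX t htI 0 h0U, ← hRX, hθ, quadPullback_normalParam_zero, hR])
    (by rw [hθ, quadPullback_normalParam_zero, hR, hRG])
    (fun k => dzMatrix_normal_eq_zero (g.coeff_smooth he) e.open_target hkah hz
      (isUnit_iff_ne_zero.2 (g.coeff_posDef he hz).det_pos.ne') k)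
    (fun w hw => kahler_quadPullback (g.coeff_smooth he) e.open_target hkah θ (hUt hw))
    m hA (fun s hs w _ => hm s (hIoo hs) _)
    (by
      filter_upwards [hU.mem_nhds h0U] with w hw
      exact (htest t htI w hw).trans_le ((hmax t ⟨ht0.le, le_rfl⟩ _ (hUt hw) _ (hm1 w hw)).trans_eq
        (htest0.trans (htest t htI 0 h0U).symm)))
    (by
      filter_upwards [Ioo_mem_nhdsLT ht0] with s hs
      have hsI : s ∈ Set.Ioo 0 b := ⟨hs.1, hs.2.trans htb⟩
      rw [htest s hsI 0 h0U, htest t htI 0 h0U, ← htest0]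
      exact hmax s ⟨hs.1.le, hs.2.le⟩ _ (hUt h0U) _ (hm1 0 h0U))
    hχ1 hχ2 hG2 hF2
  simpa only [hθ0] using key

end MaximumPoint

/-! ### The upper and lower bounds for the trace -/

section TraceBounds

variable {n : ℕ} {M : Type*} [TopologicalSpace M] [ChartedSpace (Fin n → ℂ) M]
  {χ g : HermitianMetric n M} {F : M → ℝ}

lemma traceWrt_eq_sum {G X R : Matrix (Fin n) (Fin n) ℂ} {d : Fin n → ℝ}
    (hRG : Rᴴ * G * R = 1) (hRX : Rᴴ * X * R = diagonal fun i => (d i : ℂ)) :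
    traceWrt G X = ∑ i, d i := by
  unfold traceWrt
  rw [← trace_inv_mul_congr (isUnit_det_of_conjTranspose_mul_mul_eq_one hRG), hRG, hRX, inv_one,
    Matrix.one_mul, trace_diagonal, ← Complex.ofReal_sum, Complex.ofReal_re]

lemma trace_inv_mul_eq_sum {G X R : Matrix (Fin n) (Fin n) ℂ} {d : Fin n → ℝ}
    (hd : ∀ i, 0 < d i) (hRG : Rᴴ * G * R = 1)
    (hRX : Rᴴ * X * R = diagonal fun i => (d i : ℂ)) : (X⁻¹ * G).trace.re = ∑ i, (d i)⁻¹ := by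
  rw [← trace_inv_mul_congr (isUnit_det_of_conjTranspose_mul_mul_eq_one hRG), hRG, hRX,
    Matrix.mul_one, inv_diagonal_ofReal hd, trace_diagonal, ← Complex.ofReal_sum,
    Complex.ofReal_re]

lemma eigenvalue_pos {X R : Matrix (Fin n) (Fin n) ℂ} {d : Fin n → ℝ} (hX : X.PosDef)
    (hR : IsUnit R.det) (hRX : Rᴴ * X * R = diagonal fun i => (d i : ℂ)) (i : Fin n) :
    0 < d i := by
  have h1 := posDef_congr hX hR
  rw [hRX, posDef_diagonal_iff] at h1
  exact_mod_cast h1 i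

variable [CompactSpace M]

lemma exists_bound_of_contMDiff (hF : ContMDiff 𝓘(ℝ, Fin n → ℂ) 𝓘(ℝ, ℝ) ∞ F) :
    ∃ B : ℝ, ∀ x, |F x| ≤ B := by
  obtain ⟨B, hB⟩ := isCompact_univ.exists_bound_of_continuousOn hF.continuous.continuousOn
  exact ⟨B, fun x => hB x (Set.mem_univ x)⟩

variable [IsManifold 𝓘(ℂ, Fin n → ℂ) ω M]

/-- The trace is bounded below, because `χ_φⁿ / (ω ∧ χ_φⁿ⁻¹)` is. -/
lemma exists_lower_bound_trace (hn : 0 < n) (χ g : HermitianMetric n M) [T2Space M]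
    (hF : ContMDiff 𝓘(ℝ, Fin n → ℂ) 𝓘(ℝ, ℝ) ∞ F) :
    ∃ C : ℝ, 0 < C ∧ ∀ (T : EReal), 0 < T → ∀ φ : ℝ → M → ℝ, IsSmoothSolution χ g F T φ →
      ∀ t ∈ timeInterval T, ∀ e ∈ atlas (Fin n → ℂ) M, ∀ z ∈ e.target,
        C ≤ traceWrt (g.coeff e z) (χ.perturbedCoeff (φ t) e z) := by
  obtain ⟨C, hC⟩ := exists_velocity_bound hn χ g hF
  obtain ⟨B, hB⟩ := exists_bound_of_contMDiff hF
  refine ⟨Real.exp (-(B + C)), Real.exp_pos _, fun T hT φ h t ht e he z hz => ?_⟩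
  have hX := h.pos t ht e he z hz
  have hG := g.coeff_posDef he hz
  obtain ⟨R, d, hR, hRG, hRX⟩ := exists_simultaneous_diagonal hG hX.isHermitian
  have hd := eigenvalue_pos hX hR hRX
  have h1 := hC T hT φ h t ht e he z hz
  rw [log_topFormRatio hn hX hG, trace_inv_mul_eq_sum hd hRG hRX] at h1
  rw [traceWrt_eq_sum hRG hRX]
  have hn0 : (0 : ℝ) < n := by exact_mod_cast hn
  have hn1 : (1 : ℝ) ≤ n := by exact_mod_cast hn
  have hS0 : 0 < ∑ i, (d i)⁻¹ :=
    Finset.sum_pos (fun i _ => inv_pos.2 (hd i)) ⟨⟨0, hn⟩, Finset.mem_univ _⟩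
  have hS : ∑ i, (d i)⁻¹ ≤ n * Real.exp (B + C) := by
    rw [← Real.log_le_log_iff hS0 (by positivity), Real.log_mul hn0.ne' (Real.exp_pos _).ne',
      Real.log_exp]
    linarith [abs_le.1 h1, (abs_le.1 (hB (e.symm z))).2]
  have h2 : ∀ i, (n * Real.exp (B + C))⁻¹ ≤ d i := fun i => by
    refine inv_le_of_inv_le₀ (hd i) (le_trans ?_ hS)
    exact Finset.single_le_sum (f := fun i => (d i)⁻¹) (fun i _ => (inv_pos.2 (hd i)).le)
      (Finset.mem_univ i)
  calc Real.exp (-(B + C)) = ∑ _i : Fin n, (n * Real.exp (B + C))⁻¹ := by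
        rw [Finset.sum_const, Finset.card_univ, Fintype.card_fin, nsmul_eq_mul, Real.exp_neg]
        field_simp
    _ ≤ ∑ i, d i := Finset.sum_le_sum fun i _ => h2 i

/-- The test function is bounded above in terms of the lower bound `m₀` of the solution. -/
lemma exists_bound_testFunction (hn : 2 ≤ n) [T2Space M] (hg : g.IsKahler)
    (hF : ContMDiff 𝓘(ℝ, Fin n → ℂ) 𝓘(ℝ, ℝ) ∞ F) (hcone : ConeCondition χ g F) :
    ∃ A C : ℝ, 0 < A ∧ ∀ (T : EReal), 0 < T → ∀ φ : ℝ → M → ℝ, IsSmoothSolution χ g F T φ →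
      ∀ m₀ : ℝ, (∀ t ∈ timeInterval T, ∀ y, m₀ ≤ φ t y) → ∀ t ∈ timeInterval T,
        ∀ e ∈ atlas (Fin n → ℂ) M, ∀ z ∈ e.target, ∀ v : Fin n → ℂ, v ≠ 0 →
          testFunction χ g A m₀ (φ t) e z v ≤ C - A * m₀ := by
  have hn0 : 0 < n := by omega
  obtain ⟨s, r, hr, hs⟩ := exists_finite_coordinate_balls n M
  obtain ⟨C, hC⟩ := exists_velocity_bound hn0 χ g hF
  obtain ⟨B, hB⟩ := exists_bound_of_contMDiff hF
  have hcomp : ∀ x : M, IsCompact (Metric.closedBall (chartAt (Fin n → ℂ) x x) (r x)) :=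
    fun x => isCompact_closedBall _ _
  have hch : ∀ x : M, chartAt (Fin n → ℂ) x ∈ atlas (Fin n → ℂ) M := chart_mem_atlas _
  choose k hk using fun x : M => exists_bound_normal_derivatives
    (chartAt (Fin n → ℂ) x).open_target (hcomp x) (hr x).2 (χ.coeff_smooth (hch x))
    (g.coeff_smooth (hch x)) (fun w hw => g.coeff_posDef (hch x) hw)
    (contDiffOn_comp_symm hF (hch x))
  choose ε l hε0 hl using fun x : M => exists_cone_gap (hcomp x) (hr x).2
    (χ.coeff_smooth (hch x)) (g.coeff_smooth (hch x))
    (fun w hw => g.coeff_posDef (hch x) hw) (contDiffOn_comp_symm hF (hch x))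
    (fun z hz v hv => coneCondition_coeff hcone (hch x) hz hv)
  obtain ⟨ε₀, hε₀0, hε₀⟩ : ∃ ε₀ : ℝ, 0 < ε₀ ∧ ∀ x ∈ s, ε₀ ≤ ε x := by
    rcases s.eq_empty_or_nonempty with h | h
    · exact ⟨1, one_pos, by simp [h]⟩
    · obtain ⟨y, -, hy⟩ := s.exists_min_image ε h
      exact ⟨ε y, hε0 y, hy⟩
  set K : ℝ := ∑ x ∈ s, |k x| with hKdef
  have hK : ∀ x ∈ s, k x ≤ K := fun x hx => (le_abs_self _).trans
    (Finset.single_le_sum (f := fun x => |k x|) (fun x _ => abs_nonneg _) hx)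
  have hK0 : 0 ≤ K := Finset.sum_nonneg fun x _ => abs_nonneg _
  set Λ : ℝ := 1 + ∑ x ∈ s, |l x| with hΛdef
  have hΛ : ∀ x ∈ s, l x ≤ Λ := fun x hx => by
    have := (le_abs_self _).trans
      (Finset.single_le_sum (f := fun x => |l x|) (fun x _ => abs_nonneg _) hx)
    linarith
  have hΛ1 : 1 ≤ Λ := by
    have : 0 ≤ ∑ x ∈ s, |l x| := Finset.sum_nonneg fun x _ => abs_nonneg _
    linarith
  obtain ⟨A, L, hA, hL, hAL⟩ := exists_barrier_constants hn C B hK0 hε₀0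
  refine ⟨A, Real.log L + Real.log Λ + A + 1, by linarith, ?_⟩
  intro T hT φ h m₀ hm τ hτ e' he' z' hz' v' hv'
  have : Nonempty M := ⟨e'.symm z'⟩
  obtain ⟨t, htτ, x, hx, z, hz, v, hv, hmax⟩ :=
    exists_max_testFunction (χ := χ) (g := g) (A := A) hn0 h hT hm hr hs hτ
  refine (hmax τ ⟨hτ.1, le_rfl⟩ e' he' z' hz' v' hv').trans ?_
  set e := chartAt (Fin n → ℂ) x with he
  have hzt : z ∈ e.target := (hr x).2 hz
  have ht := Icc_subset_timeInterval hτ htτ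
  have hX := h.pos t ht e (hch x) z hzt
  have hG := g.coeff_posDef (hch x) hzt
  obtain ⟨R, d, hR, hRG, hRX⟩ := exists_simultaneous_diagonal hG hX.isHermitian
  have hd := eigenvalue_pos hX hR hRX
  have : Nonempty (Fin n) := ⟨⟨0, hn0⟩⟩
  obtain ⟨m, hmd⟩ := Finite.exists_max d
  set y := e.symm z with hy
  set ψ := φ t y - m₀ + 1 with hψ
  have hψ1 : 1 ≤ ψ := by linarith [hm t ht y]
  have hval : testFunction χ g A m₀ (φ t) e z (R *ᵥ Pi.single m 1) =
      Real.log (d m) - A * φ t y + ψ⁻¹ := by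
    unfold testFunction
    rw [hermValue_mulVec_single, hermValue_mulVec_single, hRG, hRX]
    simp [← hy, ← hψ]
  -- the eigenvector of the largest eigenvalue is also a maximum point
  have hle : testFunction χ g A m₀ (φ t) e z v ≤
      testFunction χ g A m₀ (φ t) e z (R *ᵥ Pi.single m 1) := by
    rw [hval]
    have h1 := hermValue_le_of_simultaneous_diagonal hR hRG hRX hmd v
    have h2 := hermValue_pos hX hv
    have h3 := hermValue_pos hG hv
    have h4 := Real.log_le_log h2 h1
    rw [Real.log_mul (hd m).ne' h3.ne'] at h4
    unfold testFunction
    linarith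
  refine hle.trans ?_
  rw [hval]
  have hψinv : ψ⁻¹ ≤ 1 := inv_le_one_of_one_le₀ hψ1
  have hlogL : 0 ≤ Real.log L := Real.log_nonneg hL
  have hlogΛ : 0 ≤ Real.log Λ := Real.log_nonneg hΛ1
  set p : (Fin n → ℂ) × (Fin n → Fin n → ℂ) := (z, fun a i => conj (R a i)) with hp
  have hpR : (Matrix.of p.2).map conj = R := by
    ext a i
    simp [hp]
  have hpU : p ∈ unitaryFrames (g.coeff e) (Metric.closedBall (e x) (r x)) :=
    ⟨hz, by rw [hpR]; exact hRG⟩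
  rcases htτ.1.eq_or_lt with ht0 | ht0
  · -- at the initial time `χ_φ = χ`
    have hφ0 : ∀ y, φ t y = 0 := by
      rw [← ht0]
      exact h.initial
    have h1 : χ.perturbedCoeff (φ t) e z = χ.coeff e z := by
      rw [show φ t = fun _ => 0 from funext hφ0, perturbedCoeff_const]
    have h2 : d m ≤ Λ := by
      have h3 := (hl x p hpU m).2.trans (hΛ x hx)
      rw [quadPullback_normalParam_zero, hpR] at h3
      rw [h1] at hRX
      have h4 := congrFun (congrFun hRX m) m
      change (Rᴴ * χ.coeff e z * R) m m = _ at h4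
      have h5 : ((Rᴴ * χ.coeff e z * R) m m).re ≤ Λ := h3
      rw [h4] at h5
      simpa using h5
    have h3 := Real.log_le_log (hd m) h2
    have h4 : A * m₀ ≤ 0 := by
      have := hm t ht y
      rw [hφ0] at this
      nlinarith
    rw [hφ0]
    linarith
  · obtain ⟨hχ1, hχ2, hG2, hF2⟩ := hk x p hpU
    have hineq := inequality_at_max_testFunction (K := K) (A := A) h hg hF hm (hch x) ht ht0
      (p := p) hzt hpR hRG hRX m (by linarith) (fun t' ht' z' hz' v' hv' =>
        (hmax t' ⟨ht'.1, ht'.2.trans htτ.2⟩ e (hch x) z' hz' v' hv').trans hle)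
      (fun i j q => (hχ1 i j q).trans (hK x hx)) (fun i j q => (hχ2 i j q).trans (hK x hx))
      (fun i j q => (hG2 i j q).trans (hK x hx)) (fun q => (hF2 q).trans (hK x hx))
    have hvel := hC T hT φ h t ht e (hch x) z hzt
    rw [log_topFormRatio hn0 hX hG, trace_inv_mul_eq_sum hd hRG hRX] at hvel
    have hdm := hAL d _ (F y) ψ m hd hψ1 hvel (hB y)
      (fun i => (add_le_add_right (hε₀ x hx) _).trans (hl x p hpU i).1) hineq
    have h1 := Real.log_le_log (hd m) hdm
    have hψ0 : 0 < ψ := by linarith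
    rw [Real.log_mul (by linarith) (by positivity), Real.log_pow] at h1
    have h2 := Real.log_le_sub_one_of_pos hψ0
    have h3 : φ t y = ψ + m₀ - 1 := by rw [hψ]; ring
    rw [h3]
    push_cast at h1
    nlinarith

/-- The upper bound for the trace, in terms of any lower bound of the solution. -/
lemma exists_upper_bound_trace (hn : 2 ≤ n) [T2Space M] (hg : g.IsKahler)
    (hF : ContMDiff 𝓘(ℝ, Fin n → ℂ) 𝓘(ℝ, ℝ) ∞ F) (hcone : ConeCondition χ g F) :
    ∃ A C : ℝ, 0 < A ∧ 0 < C ∧ ∀ (T : EReal), 0 < T → ∀ φ : ℝ → M → ℝ,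
      IsSmoothSolution χ g F T φ → ∀ m₀ : ℝ, (∀ t ∈ timeInterval T, ∀ y, m₀ ≤ φ t y) →
        ∀ t ∈ timeInterval T, ∀ e ∈ atlas (Fin n → ℂ) M, ∀ z ∈ e.target,
          traceWrt (g.coeff e z) (χ.perturbedCoeff (φ t) e z) ≤
            C * Real.exp (A * (φ t (e.symm z) - m₀)) := by
  obtain ⟨A, C, hA, hC⟩ := exists_bound_testFunction hn hg hF hcone
  have hn0 : (0 : ℝ) < n := by exact_mod_cast (by omega : 0 < n)
  refine ⟨A, n * Real.exp C, hA, by positivity, fun T hT φ h m₀ hm t ht e he z hz => ?_⟩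
  have hX := h.pos t ht e he z hz
  have hG := g.coeff_posDef he hz
  obtain ⟨R, d, hR, hRG, hRX⟩ := exists_simultaneous_diagonal hG hX.isHermitian
  have hd := eigenvalue_pos hX hR hRX
  rw [traceWrt_eq_sum hRG hRX]
  have h1 : ∀ i, d i ≤ Real.exp C * Real.exp (A * (φ t (e.symm z) - m₀)) := fun i => by
    have h2 := hC T hT φ h m₀ hm t ht e he z hz _ (mulVec_single_ne_zero hR i)
    unfold testFunction at h2
    rw [hermValue_mulVec_single, hermValue_mulVec_single, hRG, hRX] at h2
    simp only [diagonal_apply_eq, one_apply_eq, Complex.ofReal_re, Complex.one_re, Real.log_one,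
      sub_zero] at h2
    have h3 : 0 ≤ (φ t (e.symm z) - m₀ + 1)⁻¹ := inv_nonneg.2 (by linarith [hm t ht (e.symm z)])
    rw [← Real.exp_add, ← Real.log_le_iff_le_exp (hd i)]
    linarith
  calc ∑ i, d i ≤ ∑ _i : Fin n, Real.exp C * Real.exp (A * (φ t (e.symm z) - m₀)) :=
        Finset.sum_le_sum fun i _ => h1 i
    _ = _ := by
        rw [Finset.sum_const, Finset.card_univ, Fintype.card_fin, nsmul_eq_mul]
        ring

end TraceBounds

end ParabolicDonaldson

theorem theorem2p2 {n : ℕ} (hn : 2 ≤ n) {M : Type*} [TopologicalSpace M] [T2Space M]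
    [CompactSpace M] [ChartedSpace (Fin n → ℂ) M] [IsManifold 𝓘(ℂ, Fin n → ℂ) ω M]
    (χ g : HermitianMetric n M) (hg : g.IsKahler)
    (F : M → ℝ) (hF : ContMDiff 𝓘(ℝ, Fin n → ℂ) 𝓘(ℝ, ℝ) ∞ F)
    (hcone : ConeCondition χ g F) :
    ∃ A₁ C₁ C₂ : ℝ, 0 < A₁ ∧ 0 < C₁ ∧ 0 < C₂ ∧
      ∀ (T : EReal), 0 < T → ∀ φ : ℝ → M → ℝ, IsSmoothSolution χ g F T φ →
        ∀ t ∈ timeInterval T, ∀ e ∈ atlas (Fin n → ℂ) M, ∀ z ∈ e.target,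
          C₁ ≤ traceWrt (g.coeff e z) (χ.perturbedCoeff (φ t) e z) ∧
          ENNReal.ofReal (traceWrt (g.coeff e z) (χ.perturbedCoeff (φ t) e z)) ≤
            ENNReal.ofReal C₂ * EReal.exp ((A₁ : EReal) *
              ((φ t (e.symm z) : EReal) -
                ⨅ s ∈ timeInterval T, ⨅ y : M, (φ s y : EReal))) := by
  obtain ⟨C₁, hC₁, hlower⟩ := exists_lower_bound_trace (by omega : 0 < n) χ g hF
  obtain ⟨A, C₂, hA, hC₂, hupper⟩ := exists_upper_bound_trace hn hg hF hcone
  refine ⟨A, C₁, C₂, hA, hC₁, hC₂, fun T hT φ h t ht e he z hz =>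
    ⟨hlower T hT φ h t ht e he z hz, ?_⟩⟩
  have hle : ∀ s ∈ timeInterval T, ∀ y, (⨅ s ∈ timeInterval T, ⨅ y : M, (φ s y : EReal)) ≤ φ s y :=
    fun s hs y => (iInf₂_le s hs).trans (iInf_le _ y)
  generalize (⨅ s ∈ timeInterval T, ⨅ y : M, (φ s y : EReal)) = I at hle
  induction I with
  | bot =>
    rw [EReal.sub_bot (EReal.coe_ne_bot _), EReal.coe_mul_top_of_pos hA, EReal.exp_top,
      ENNReal.mul_top (by simpa using hC₂)]
    exact le_top
  | top => exact absurd (hle t ht (e.symm z)) (by simp)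
  | coe m₀ =>
    have hm : ∀ s ∈ timeInterval T, ∀ y, m₀ ≤ φ s y := fun s hs y => by exact_mod_cast hle s hs y
    rw [← EReal.coe_sub, ← EReal.coe_mul, EReal.exp_coe, ← ENNReal.ofReal_mul hC₂.le]
    exact ENNReal.ofReal_le_ofReal (hupper T hT φ h m₀ hm t ht e he z hz)
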